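/- Let $m\in\{2,3,4,6\}$ and let $E=\mathbb C/\Lambda$, $\Lambda=2\omega_1\mathbb Z+2\omega_2\mathbb Z$, be an elliptic curve, arbitrary if $m=2$, with $\omega_2/\omega_1=i$ if $m=4$ and $\omega_2/\omega_1=e^{\pi i/3}$ if $m=3,6$. Let $\mathbb Z_m$ act on $E$ by $q\mapsto\omega q$, $\omega=e^{2\pi i/m}$, and put $\omega_3=\omega_1+\omega_2$, $\eta_1=2\omega_3/3$, $\eta_2=2\eta_1$. Let $\mathcal S$ be the set of non-zero fixed points ($\{\omega_1,\omega_2,\omega_3\}$ for $m=2,4$; $\{\eta_1,\eta_2\}$ for $m=3$; the union of both for $m=6$). The couplings $c_l(x)$ ($1\le l\le m-1$, $x\in E$) are $\mathbb Z_m$-invariant complex numbers with $c_l(x)=0$ unless $\omega^l x=x$ in $E$; the linear masses are $\mu_j(x)=\sum_{l=1}^{m-1}\omega^{-jl}c_l(x)$. Put $f_k(q)=\sum_{x\in\mathcal S}\mu_k(x)\,\frac{\wp'(q)+\wp'(x)}{2(\wp(q)-\wp(x))}$ and $\tilde\mu_j=\sum_{x\in\mathcal S}\mu_j(x)$. The classical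 hamiltonian is $$h(p,q)=\prod_{j=0}^{m-1}(p-f_j)+\sum_{i=2}^m\alpha_i\,\wp^{(i-2)}(q)\prod_{j=0}^{m-i-1}(p-f_j),$$ where the constants $\alpha_i$ are determined by $$\prod_{j=0}^{m-1}\Big(p-\frac{\mu_j(0)}q\Big)=\prod_{j=0}^{m-1}\Big(p+\frac{\tilde\mu_j}q\Big)+\sum_{i=2}^m(-1)^i(i-1)!\,\frac{\alpha_i}{q^{i}}\prod_{j=0}^{m-i-1}\Big(p+\frac{\tilde\mu_j}q\Big).$$ Define $(u,v)=(\wp,\tfrac12\wp'),\ (\tfrac12\wp',\wp),\ (\wp^2,\tfrac12\wp'),\ (\wp^3,\tfrac12\wp\wp')$ and $P_m(t)=t^3-\tfrac14g_2t-\tfrac14g_3,\ t^2+\tfrac14g_3,\ t(t-\tfrac14g_2)^2,\ t^2(t-\tfrac14g_3)^3$ for $m=2,3,4,6$. Choose $(x_i)_{i\ge1}=(\omega_1,\omega_2,\omega_3),\ (\eta_1,\eta_2),\ (\omega_3,\omega_1),\ (\eta_1,\omega_1)$ respectively, let $m_i$ be the order of the stabiliser of $x_i$, $n_i=m/m_i$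 (so $(n_i)=(1,1,1),(1,1),(1,2),(2,3)$) and $e_i=u(x_i)$. Let $d=2$ if $m=2$ and $d=1$ otherwise, and use homogeneous coordinates $(x:y:w)$ on $\mathbb P^2_{1,d,1}$ (so on $\mathbb P^2$ for $m=3,4,6$). Then the constants $\alpha_i$ exist and are unique, the $e_i$ are pairwise distinct, $v^m=P_m(u)$, and $P_m(t)=\prod_i(t-e_i)^{n_i}$. With $P=w\prod_i(x-e_iw)^{n_i}$ there is $Q=y^m+\sum_{j=2}^mQ_j(x,w)y^{m-j}$, $Q_j$ homogeneous of degree $dj$, such that the following hold. 1. $Q(u(q),v(q)p,1)=P_m(u(q))\,h(p,q)$ for all $p$ and all $q$ not fixed by a non-trivial element of $\mathbb Z_m$; for every $z$, the image of the level set $h(p,q)=z$ (over such $q$) under $x=u(q)$, $y=v(q)p$ is the set of points with $P_m(x)\ne0$ on the affine curve $Q-zP=0$ ($w=1$). The curves $Q-zP=0$ have (weighted) degree $dm$, that is, they are plane curves of degree $3,4,6$ for $m=3,4,6$, and weighted quartics in $\mathbb P^2_{1,2,1}$ for $m=2$. 2. The lines $\ell_0:w=0$ and $\ell_i:x-e_iw=0$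 are concurrent, meeting in the single point $(0:1:0)$. For every $z$, $Q-zP$ restricts to $\prod_{j=0}^{m-1}(y+\mu_j(0))$ on $\ell_0$ ($x=1$, $w=0$) and to $\prod_{j=0}^{m_i-1}(y-\beta_{ij})^{n_i}$ on $\ell_i$ ($x=e_i$, $w=1$), where $\beta_{ij}=n_i\mu_j(x_i)\prod_{k\ne i}(e_i-e_k)$. Thus every curve meets $\ell_0$ exactly in the points $(1:-\mu_j(0):0)$ and $\ell_i$ exactly in the points $(e_i:\beta_{ij}:1)$, and all these points together are the base points of the pencil. Every curve has multiplicity at least $n_i$ at $(e_i:\beta_{ij}:1)$. 3. The Seiberg–Witten differential $\lambda=\dfrac{y\,(w\,dx-x\,dw)}{w\prod_i(x-e_iw)}$ has, along every holomorphic branch $y=Y(w)$ ($x=1$) over $\ell_0$ or $y=Y(x)$ ($w=1$) over $\ell_i$ of every curve, residue $\mu_j(0)$ or $n_i\mu_j(x_i)$ respectively, for some index $j$ such that $(1:-\mu_j(0):0)$ or $(e_i:\beta_{ij}:1)$, respectively, is the base point through which the branch passes. So up to the factor $n_i$ the residues are the linear masses. 4. Suppose that the points listed on each line are distinct, i.e.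 the $\mu_j(0)$ ($0\le j<m$) are distinct and for each $i$ the $\mu_j(x_i)$ ($0\le j<m_i$) are distinct. Then for every $z$ the curve has multiplicity exactly $1$ at $(1:-\mu_j(0):0)$ and exactly $n_i$ at $(e_i:\beta_{ij}:1)$. For all but finitely many $z$ the curve is irreducible; its singular points are exactly the points $(e_i:\beta_{ij}:1)$ with $n_i\ge2$; these are ordinary $n_i$-fold points (two double points for $m=4$; three double and two triple points for $m=6$); and its geometric genus, computed by adjunction as $1+\frac12\big(m(dm-d-2)-\sum_a\nu_a(\nu_a-1)\big)$ with $\nu_a$ the multiplicity at $a$, is $1$. Moreover, for these $z$ the curve consists near $\ell_0$ of $m$ holomorphic branches, one through each $(1:-\mu_j(0):0)$ with residue $\mu_j(0)$ of $\lambda$, and near $\ell_i$ of $m$ holomorphic branches, $n_i$ of them (with distinct tangents) through each $(e_i:\beta_{ij}:1)$, with residue $n_i\mu_j(x_i)$ of $\lambda$. -/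

import Mathlib

open scoped Topology

noncomputable section

namespace EllipticPencil

/-! ### Elliptic curves with symmetries

`L : PeriodPair` has periods `L.ω₁`, `L.ω₂` (usually written `2ω₁`, `2ω₂`), and
`E = ℂ / L.lattice`. -/

/-- `ω = e^{2πi/m}`; the generator of `ℤ_m` acts on `E` by `q ↦ ω q`. -/
def root (m : ℕ) : ℂ := Complex.exp (2 * Real.pi * Complex.I / m)

/-- The shape of the lattice: arbitrary for `m = 2`, square for `m = 4`, hexagonal for
`m = 3, 6`. -/
def IsSymmetricLattice (m : ℕ) (L : PeriodPair) : Prop :=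
  (m = 4 → L.ω₂ / L.ω₁ = Complex.I) ∧
  (m = 3 ∨ m = 6 → L.ω₂ / L.ω₁ = Complex.exp (Real.pi * Complex.I / 3))

/-- `q` represents a point of `E` with non-trivial stabiliser in `ℤ_m`. -/
def IsFixedPoint (m : ℕ) (L : PeriodPair) (q : ℂ) : Prop :=
  ∃ l : ℕ, 1 ≤ l ∧ l < m ∧ root m ^ l * q - q ∈ L.lattice

/-- The list `𝒮` of the non-zero fixed points of `ℤ_m` on `E`: the half-periods `ω₁, ω₂, ω₃` and/or
the points `η₁, η₂` of order three. -/
def nonzeroFixedPoints (m : ℕ) (L : PeriodPair) : List ℂ :=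
  let halfPeriods := [L.ω₁ / 2, L.ω₂ / 2, (L.ω₁ + L.ω₂) / 2]
  let etas := [(L.ω₁ + L.ω₂) / 3, 2 * ((L.ω₁ + L.ω₂) / 3)]
  match m with
  | 2 => halfPeriods
  | 3 => etas
  | 4 => halfPeriods
  | 6 => halfPeriods ++ etas
  | _ => []

/-- The elliptic function `u`. -/
def u (m : ℕ) (L : PeriodPair) (q : ℂ) : ℂ :=
  match m with
  | 2 => L.weierstrassP q
  | 3 => L.derivWeierstrassP q / 2
  | 4 => L.weierstrassP q ^ 2
  | 6 => L.weierstrassP q ^ 3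
  | _ => 0

/-- The elliptic function `v`. -/
def v (m : ℕ) (L : PeriodPair) (q : ℂ) : ℂ :=
  match m with
  | 2 => L.derivWeierstrassP q / 2
  | 3 => L.weierstrassP q
  | 4 => L.derivWeierstrassP q / 2
  | 6 => L.weierstrassP q * L.derivWeierstrassP q / 2
  | _ => 0

/-- The polynomial `P_m` with `v ^ m = P_m(u)`. -/
def tableP (m : ℕ) (L : PeriodPair) (t : ℂ) : ℂ :=
  match m with
  | 2 => t ^ 3 - L.g₂ / 4 * t - L.g₃ / 4
  | 3 => t ^ 2 + L.g₃ / 4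
  | 4 => t * (t - L.g₂ / 4) ^ 2
  | 6 => t ^ 2 * (t - L.g₃ / 4) ^ 3
  | _ => 0

/-- The number of finite branch points of `u : E → ℙ¹` (the remaining one is `u(0) = ∞`). -/
def numBranch (m : ℕ) : ℕ := if m = 2 then 3 else 2

/-- Representatives `x_i` of the `ℤ_m`-orbits of non-zero fixed points (numbered from `0`):
`ω₁, ω₂, ω₃` for `m = 2`; `η₁, η₂` for `m = 3`; `ω₃, ω₁` for `m = 4`; `η₁, ω₁` for `m = 6`. -/
def branchPt (m : ℕ) (L : PeriodPair) (i : Fin (numBranch m)) : ℂ :=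
  match m, i.val with
  | 2, 0 => L.ω₁ / 2
  | 2, 1 => L.ω₂ / 2
  | 2, _ => (L.ω₁ + L.ω₂) / 2
  | 3, 0 => (L.ω₁ + L.ω₂) / 3
  | 3, _ => 2 * ((L.ω₁ + L.ω₂) / 3)
  | 4, 0 => (L.ω₁ + L.ω₂) / 2
  | 4, _ => L.ω₁ / 2
  | 6, 0 => (L.ω₁ + L.ω₂) / 3
  | 6, _ => L.ω₁ / 2
  | _, _ => 0

/-- The order `m_i` of the stabiliser of `x_i`. -/
def stabOrder (m : ℕ) (i : Fin (numBranch m)) : ℕ :=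
  match m, i.val with
  | 2, _ => 2
  | 3, _ => 3
  | 4, 0 => 4
  | 4, _ => 2
  | 6, 0 => 3
  | 6, _ => 2
  | _, _ => 1

/-- `n_i = m / m_i`: all `n_i = 1` for `m = 2, 3`; `(1, 2)` for `m = 4`; `(2, 3)` for `m = 6`. -/
def mult (m : ℕ) (i : Fin (numBranch m)) : ℕ := m / stabOrder m i

/-- The branch points `e_i = u(x_i)`. -/
def e (m : ℕ) (L : PeriodPair) (i : Fin (numBranch m)) : ℂ := u m L (branchPt m L i)

/-! ### Coupling parameters and the classical hamiltonian -/

/-- The couplings `c_l(x)`, `1 ≤ l ≤ m - 1`, `x ∈ E`: `ℤ_m`-invariant and zero unless `x` is fixed by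
`s^l`. (The values for other `l` are never used.) -/
structure Couplings (m : ℕ) (L : PeriodPair) where
  c : ℕ → ℂ → ℂ
  periodic : ∀ l x, ∀ γ ∈ L.lattice, c l (x + γ) = c l x
  invariant : ∀ l x, c l (root m * x) = c l x
  vanish : ∀ l x, root m ^ l * x - x ∉ L.lattice → c l x = 0

/-- The linear masses `μ_j(x) = ∑_{l=1}^{m-1} ω^{-jl} c_l(x)`. -/
def Couplings.mu {m : ℕ} {L : PeriodPair} (c : Couplings m L) (j : ℕ) (x : ℂ) : ℂ :=
  ∑ l ∈ Finset.Ico 1 m, (root m)⁻¹ ^ (j * l) * c.c l x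

/-- `∑_{x ∈ 𝒮} μ_j(x)`. -/
def Couplings.muTotal {m : ℕ} {L : PeriodPair} (c : Couplings m L) (j : ℕ) : ℂ :=
  ((nonzeroFixedPoints m L).map (fun x => c.mu j x)).sum

/-- `f(q, x) = ζ(q - x) - ζ(q) + ζ(x) = (℘'(q) + ℘'(x)) / (2 (℘(q) - ℘(x)))`. -/
def kernelF (L : PeriodPair) (q x : ℂ) : ℂ :=
  (L.derivWeierstrassP q + L.derivWeierstrassP x) / (2 * (L.weierstrassP q - L.weierstrassP x))

/-- `f_k(q) = ∑_{x ∈ 𝒮} μ_k(x) f(q, x)`. -/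
def Couplings.f {m : ℕ} {L : PeriodPair} (c : Couplings m L) (k : ℕ) (q : ℂ) : ℂ :=
  ((nonzeroFixedPoints m L).map (fun x => c.mu k x * kernelF L q x)).sum

/-- The relation that determines the coefficients `α_2, …, α_m` of the hamiltonian; `α i` stands
for `α_{i+2}`. -/
def Couplings.AlphaRelation {m : ℕ} {L : PeriodPair} (c : Couplings m L)
    (α : Fin (m - 1) → ℂ) : Prop :=
  ∀ p q : ℂ, q ≠ 0 →
    ∏ j ∈ Finset.range m, (p - c.mu j 0 * q⁻¹) =
      ∏ j ∈ Finset.range m, (p + c.muTotal j * q⁻¹) +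
        ∑ i : Fin (m - 1), (-1) ^ (i.val + 2) * ((i.val + 1).factorial : ℂ) * α i *
          q⁻¹ ^ (i.val + 2) * ∏ j ∈ Finset.range (m - (i.val + 2)), (p + c.muTotal j * q⁻¹)

/-- The classical hamiltonian
`h = (p - f_{m-1}) ⋯ (p - f_0) + ∑_{i=2}^m α_i ℘^{(i-2)}(q) (p - f_{m-i-1}) ⋯ (p - f_0)`. -/
def Couplings.h {m : ℕ} {L : PeriodPair} (c : Couplings m L) (α : Fin (m - 1) → ℂ)
    (p q : ℂ) : ℂ :=
  ∏ j ∈ Finset.range m, (p - c.f j q) +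
    ∑ i : Fin (m - 1), α i * iteratedDeriv i.val L.weierstrassP q *
      ∏ j ∈ Finset.range (m - (i.val + 2)), (p - c.f j q)

/-! ### Curves in the weighted projective plane `ℙ²_{1,d,1}`

Homogeneous coordinates are `(x : y : w)`, with indices `0, 1, 2`. For `d = 1` this is `ℙ²`. -/

/-- `(x, y, w) ∼ (t x, t ^ d y, t w)` for `t ≠ 0`. -/
def wSetoid (d : ℕ) : Setoid {a : Fin 3 → ℂ // a ≠ 0} where
  r a b := ∃ t : ℂ, t ≠ 0 ∧ b.1 = ![t * a.1 0, t ^ d * a.1 1, t * a.1 2]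
  iseqv :=
    { refl := fun a => ⟨1, one_ne_zero, by ext i; fin_cases i <;> simp⟩
      symm := by
        rintro a b ⟨t, ht, h⟩
        refine ⟨t⁻¹, inv_ne_zero ht, ?_⟩
        rw [h]
        ext i
        fin_cases i <;> simp [ht]
      trans := by
        rintro a b c ⟨t, ht, h⟩ ⟨s, hs, h'⟩
        refine ⟨s * t, mul_ne_zero hs ht, ?_⟩
        rw [h', h]
        ext i
        fin_cases i <;> simp <;> ring }

/-- The weighted projective plane `ℙ²_{1,d,1}`. -/
def WPlane (d : ℕ) : Type := Quotient (wSetoid d)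

/-- The point with the given homogeneous coordinates. -/
def WPlane.mk (d : ℕ) (a : {a : Fin 3 → ℂ // a ≠ 0}) : WPlane d := Quotient.mk (wSetoid d) a

/-- A representative of a point. -/
def WPlane.rep {d : ℕ} (x : WPlane d) : Fin 3 → ℂ := (Quotient.out x).1

/-- The curve `F = 0`, for `F` weighted homogeneous. -/
def curve (d : ℕ) (F : MvPolynomial (Fin 3) ℂ) : Set (WPlane d) :=
  {x | ∃ a, WPlane.mk d a = x ∧ MvPolynomial.eval a.1 F = 0}

/-- The Taylor expansion of `F` at `a`. -/
def taylor (F : MvPolynomial (Fin 3) ℂ) (a : Fin 3 → ℂ) : MvPolynomial (Fin 3) ℂ :=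
  MvPolynomial.aeval (fun i => MvPolynomial.X i + MvPolynomial.C (a i)) F

/-- The order of vanishing of `F ≠ 0` at `a`. For `F` weighted homogeneous and `a` with `x ≠ 0` or
`w ≠ 0`, the cone over the curve is near `a` the product of the curve with an orbit of `ℂˣ`, so this
is the multiplicity of the curve `F = 0` at the point `(x : y : w)`. -/
def multAt (F : MvPolynomial (Fin 3) ℂ) (a : Fin 3 → ℂ) : ℕ :=
  sInf {k | MvPolynomial.homogeneousComponent k (taylor F a) ≠ 0}

/-- The point is an ordinary multiple point (with multiplicity `multAt F a`): the lowest-order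
form of `F` at `a` is a product of pairwise non-proportional linear forms, i.e. the tangent lines are
distinct. -/
def IsOrdinaryAt (F : MvPolynomial (Fin 3) ℂ) (a : Fin 3 → ℂ) : Prop :=
  ∃ l : Fin (multAt F a) → Fin 3 → ℂ,
    (∀ r s, r ≠ s → LinearIndependent ℂ ![l r, l s]) ∧
    MvPolynomial.homogeneousComponent (multAt F a) (taylor F a) =
      ∏ r, ∑ i, MvPolynomial.C (l r i) * MvPolynomial.X i

/-- The set of singular points of the curve `F = 0`. -/
def singularPoints (d : ℕ) (F : MvPolynomial (Fin 3) ℂ) : Set (WPlane d) :=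
  {x | 2 ≤ multAt F x.rep}

/-- The geometric genus of an irreducible curve `F = 0` of weighted degree `d m` in `ℙ²_{1,d,1}`,
not passing through `(0 : 1 : 0)` and having only ordinary multiple points as singularities: by
adjunction, `2 g - 2 = m (d m - d - 2) - ∑_x n_x (n_x - 1)`, with `n_x` the multiplicity at `x`. For
`d = 1` this is `g = (m-1)(m-2)/2 - ∑_x n_x (n_x - 1)/2`. -/
def ordinaryGenus (d m : ℕ) (F : MvPolynomial (Fin 3) ℂ) : ℚ :=
  1 + ((m : ℚ) * (d * m - d - 2)
    - ∑ᶠ x : WPlane d, (multAt F x.rep : ℚ) * ((multAt F x.rep : ℚ) - 1)) / 2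

/-! ### The pencil -/

/-- The weight of `y`: two for `m = 2`, one for `m = 3, 4, 6`. -/
def yWeight (m : ℕ) : ℕ := if m = 2 then 2 else 1

/-- `P(x, w) = w ∏ (x - e_i w)^{n_i}`, the homogeneous form of `P_m`. -/
def homP (m : ℕ) (L : PeriodPair) : MvPolynomial (Fin 3) ℂ :=
  MvPolynomial.X 2 *
    ∏ i, (MvPolynomial.X 0 - MvPolynomial.C (e m L i) * MvPolynomial.X 2) ^ mult m i

/-- The member `Q - z P` of the pencil. -/
def member (m : ℕ) (L : PeriodPair) (Q : MvPolynomial (Fin 3) ℂ) (z : ℂ) :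
    MvPolynomial (Fin 3) ℂ :=
  Q - MvPolynomial.C z * homP m L

/-- The line `w = 0`. -/
def lineInf (m : ℕ) : Set (WPlane (yWeight m)) := curve (yWeight m) (MvPolynomial.X 2)

/-- The line `x - e_i w = 0`. -/
def line (m : ℕ) (L : PeriodPair) (i : Fin (numBranch m)) : Set (WPlane (yWeight m)) :=
  curve (yWeight m) (MvPolynomial.X 0 - MvPolynomial.C (e m L i) * MvPolynomial.X 2)

/-- `∏_{k ≠ i} (e_i - e_k)`. -/
def eProd (m : ℕ) (L : PeriodPair) (i : Fin (numBranch m)) : ℂ :=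
  ∏ k ∈ Finset.univ.erase i, (e m L i - e m L k)

/-- Coordinates of the point `(1 : -μ_j(0) : 0)`. -/
def Couplings.vecInf {m : ℕ} {L : PeriodPair} (c : Couplings m L) (j : Fin m) :
    {a : Fin 3 → ℂ // a ≠ 0} :=
  ⟨![1, -c.mu j 0, 0], fun h => one_ne_zero (congrFun h 0)⟩

/-- Coordinates of the point `(e_i : n_i μ_j(x_i) ∏_{k ≠ i} (e_i - e_k) : 1)`. -/
def Couplings.vec {m : ℕ} {L : PeriodPair} (c : Couplings m L) (i : Fin (numBranch m))
    (j : Fin (stabOrder m i)) : {a : Fin 3 → ℂ // a ≠ 0} :=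
  ⟨![e m L i, mult m i * c.mu j (branchPt m L i) * eProd m L i, 1],
    fun h => one_ne_zero (congrFun h 2)⟩

/-- On each line the prescribed points are distinct. -/
def Couplings.Generic {m : ℕ} {L : PeriodPair} (c : Couplings m L) : Prop :=
  Function.Injective (fun j : Fin m => c.mu j 0) ∧
  ∀ i, Function.Injective (fun j : Fin (stabOrder m i) => c.mu j (branchPt m L i))

/-! ### The Seiberg--Witten differential -/

/-- The pullback (as a coefficient of `dt`) of
`λ = y (w dx - x dw) / (w ∏ (x - e_i w))`, in the affine chart `w = 1` equal to
`y dx / ∏ (x - e_i)`, along a parametrised curve `t ↦ (x(t) : y(t) : w(t))`. -/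
def swPullback (m : ℕ) (L : PeriodPair) (x y w : ℂ → ℂ) (t : ℂ) : ℂ :=
  y t * (w t * deriv x t - x t * deriv w t) / (w t * ∏ i, (x t - e m L i * w t))

/-- `F(t) dt` has residue `r` at `a`. -/
def HasResidue (F : ℂ → ℂ) (a r : ℂ) : Prop :=
  ∀ᶠ ρ in 𝓝[>] (0 : ℝ), (∮ t in C(a, ρ), F t) = 2 * Real.pi * Complex.I * r

end EllipticPencil

end

open EllipticPencil

noncomputable section

namespace EllipticPencil

open Filter

variable {m : ℕ} {L : PeriodPair}

/-! The function `v` has weight one under ℤ_m, while f_j and ℘^(k-2) have weights -1 and -k. Hence v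
f_j and v^k ℘^(k-2) are invariant, and they turn out to be polynomials A_j and B_k in `u`
(`Couplings.v_mul_f`, `v_pow_mul_iteratedDeriv`). Since v^m = P_m(u), multiplying h by v^m turns it
into a polynomial in u and y = vp. Its homogenisation Q = ∏(y - A_j) + ∑ α_k B_k ∏_{j<m-k}(y - A_j)
is `Couplings.bigQ`.

P vanishes on all the lines, so z plays no role there. On w = 0 the form A_j restricts to the total
mass and B_k to (k-1)!, so the relation defining the α_k says exactly that Q restricts to ∏(y +
μ_j(0)). The α_k are coefficients in a Newton basis, hence exist and are unique. On ℓ_i every B_k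
vanishes and only the i-th term of A_j survives; as the masses at x_i depend only on j modulo m_i,
the restriction is an n_i-th power. For the multiplicity n_i, B_k vanishes on ℓ_i to order ⌈k/m_i⌉,
and ∏_{j<m-k}(y - A_j) supplies the missing ⌊(m-k)/m_i⌋ (`Couplings.mult_le_multAt`). The residues
then follow from Cauchy's formula.

In the generic case three finite sets of z are removed. First, changing z translates the initial
form at a base point, restricted to an affine line, by a non-zero multiple of z, so outside a finite
set it has n_i distinct roots (`Couplings.finite_degenerate`). These give ordinary points and, by
the implicit function theorem after a blow-up, branches. Secondly, Q/P has finitely many critical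
values off P = 0 (`finite_critical_values`): a critical point over a finite extension of ℂ(z) would,
on differentiating Q = zP with respect to z, satisfy P = 0. Thirdly, a monic factor of degree at
most m/2 in y is determined by its restrictions to the lines, for which there are finitely many
possibilities. Infinitely many reducible members would thus lead to two with a common factor, which
would divide a multiple of P and so be constant in y (`Couplings.finite_reducible`). The genus is
then a count of multiplicities. -/

/-! ### Elliptic functions -/

/-- A meromorphic function without poles that is periodic with respect to a lattice is constant. -/
lemma exists_const_of_periodic (L : PeriodPair) {f : ℂ → ℂ} (hf : Meromorphic f)
    (hper : ∀ z, ∀ l ∈ L.lattice, f (z + l) = f z) (hord : ∀ x, 0 ≤ meromorphicOrderAt f x) :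
    ∃ K, (∀ x, f =ᶠ[𝓝[≠] x] fun _ => K) ∧ ∀ x, ContinuousAt f x → f x = K := by
  have hf' : MeromorphicOn f Set.univ := meromorphicOn_univ.2 hf
  -- The normal form fills in the removable singularities of f. Thus F is entire, and periodic
  -- because its values are limits of f, so Liouville's theorem applies.
  set F : ℂ → ℂ := toMeromorphicNFOn f Set.univ with hF
  have hE : ∀ x, f =ᶠ[𝓝[≠] x] F := fun x =>
    (hf'.toMeromorphicNFOn_eq_self_on_nhdsNE (Set.mem_univ x)).symm
  have hA : ∀ x, AnalyticAt ℂ F x := fun x =>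
    (meromorphicNFOn_toMeromorphicNFOn f Set.univ (Set.mem_univ
      x)).meromorphicOrderAt_nonneg_iff_analyticAt.1
      (by rw [← meromorphicOrderAt_congr (hE x)]; exact hord x)
  have hlim : ∀ x, Tendsto f (𝓝[≠] x) (𝓝 (F x)) := fun x =>
    ((hA x).continuousAt.tendsto.mono_left nhdsWithin_le_nhds).congr' (hE x).symm
  have hFper : ∀ z, ∀ l ∈ L.lattice, F (z + l) = F z := by
    intro z l hl
    have h1 : Tendsto (fun w => w + l) (𝓝[≠] z) (𝓝[≠] (z + l)) := by
      refine tendsto_nhdsWithin_iff.2 ⟨?_, ?_⟩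
      · exact ((continuous_add_const l).tendsto z).mono_left nhdsWithin_le_nhds
      · filter_upwards [self_mem_nhdsWithin] with w hw
        simpa using hw
    exact tendsto_nhds_unique ((hlim (z + l)).comp h1)
      ((hlim z).congr fun w => (hper w l hl).symm)
  have hd : Differentiable ℂ F := fun x => (hA x).differentiableAt
  have hc : ∀ x, F x = F 0 := fun x =>
    hd.apply_eq_apply_of_bounded (IsZLattice.isCompact_range_of_periodic L.lattice F
      hd.continuous hFper).isBounded x 0
  refine ⟨F 0, fun x => (hE x).trans (Eventually.of_forall hc), fun x hx => ?_⟩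
  rw [← hc x]
  exact tendsto_nhds_unique (hx.tendsto.mono_left nhdsWithin_le_nhds) (hlim x)

variable (L : PeriodPair)

/-! ### Orders and values of translates of ℘ - e -/

lemma meromorphic_weierstrassP_add_sub (a e : ℂ) :
    Meromorphic fun z => L.weierstrassP (z + a) - e := by
  have h := L.meromorphic_weierstrassP
  intro x
  have h1 : MeromorphicAt (fun z => L.weierstrassP (z + a)) x :=
    (h (x + a)).comp_analyticAt (g := fun z => z + a) (by fun_prop)
  fun_prop

lemma meromorphicOrderAt_weierstrassP_sub (a e x : ℂ) (h : x + a ∈ L.lattice) :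
    meromorphicOrderAt (fun z => L.weierstrassP (z + a) - e) x = -2 := by
  have h1 := meromorphicOrderAt_comp_add_const_eq_meromorphicOrderAt (𝕜 := ℂ) (x := x) (c := a)
    (f := fun z => L.weierstrassP z - e)
  refine h1.trans ?_
  have h2 : (fun z => L.weierstrassP z - e) = L.weierstrassP + fun _ => -e := by
    ext z; simp [sub_eq_add_neg]
  rw [h2, meromorphicOrderAt_add_eq_left_of_lt (by fun_prop), L.order_weierstrassP _ h]
  rw [L.order_weierstrassP _ h]
  have h3 : (0 : WithTop ℤ) ≤ meromorphicOrderAt (fun _ => -e) (x + a) :=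
    (analyticAt_const).meromorphicOrderAt_nonneg
  exact lt_of_lt_of_le (by decide) h3

lemma analyticAt_weierstrassP_add (a x : ℂ) (h : x + a ∉ L.lattice) :
    AnalyticAt ℂ (fun z => L.weierstrassP (z + a)) x :=
  (L.analyticOnNhd_weierstrassP (x + a) h).comp_of_eq (g := L.weierstrassP)
    (f := fun z => z + a) (by fun_prop) rfl

lemma analyticAt_weierstrassP_add_sub (a e x : ℂ) (h : x + a ∉ L.lattice) :
    AnalyticAt ℂ (fun z => L.weierstrassP (z + a) - e) x :=
  (analyticAt_weierstrassP_add L a x h).sub analyticAt_const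

lemma hasDerivAt_weierstrassP (x : ℂ) (h : x ∉ L.lattice) :
    HasDerivAt L.weierstrassP (L.derivWeierstrassP x) x := by
  have := (L.analyticOnNhd_weierstrassP x h).differentiableAt.hasDerivAt
  rwa [L.deriv_weierstrassP] at this

lemma deriv_weierstrassP_add_sub (a e x : ℂ) :
    deriv (fun z => L.weierstrassP (z + a) - e) x = L.derivWeierstrassP (x + a) := by
  rw [deriv_sub_const, deriv_comp_add_const, L.deriv_weierstrassP]

lemma one_le_meromorphicOrderAt_weierstrassP_sub (a e x : ℂ) (h : x + a ∉ L.lattice)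
    (h0 : L.weierstrassP (x + a) = e) :
    1 ≤ meromorphicOrderAt (fun z => L.weierstrassP (z + a) - e) x := by
  have hA := analyticAt_weierstrassP_add_sub L a e x h
  rw [hA.meromorphicOrderAt_eq]
  refine ENat.monotone_map_iff.mpr Nat.mono_cast
    ((natCast_le_analyticOrderAt_iff_iteratedDeriv_eq_zero (n := 1) hA).mpr fun i hi => ?_)
  interval_cases i
  simp [h0]

lemma two_le_meromorphicOrderAt_weierstrassP_sub (a e x : ℂ) (h : x + a ∉ L.lattice)
    (h0 : L.weierstrassP (x + a) = e) (h1 : L.derivWeierstrassP (x + a) = 0) :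
    2 ≤ meromorphicOrderAt (fun z => L.weierstrassP (z + a) - e) x := by
  have hA := analyticAt_weierstrassP_add_sub L a e x h
  rw [hA.meromorphicOrderAt_eq]
  refine ENat.monotone_map_iff.mpr Nat.mono_cast
    ((natCast_le_analyticOrderAt_iff_iteratedDeriv_eq_zero (n := 2) hA).mpr fun i hi => ?_)
  interval_cases i
  · simp [h0]
  · rw [iteratedDeriv_one, deriv_weierstrassP_add_sub, h1]

lemma meromorphicOrderAt_weierstrassP_sub_ne_top (a e x : ℂ) :
    meromorphicOrderAt (fun z => L.weierstrassP (z + a) - e) x ≠ ⊤ := by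
  refine (meromorphic_weierstrassP_add_sub L a e).exists_meromorphicOrderAt_ne_top_iff_forall.1
    ⟨-a, ?_⟩ x
  rw [meromorphicOrderAt_weierstrassP_sub L a e (-a) (by simp)]
  decide

lemma weierstrassP_add_mem {l : ℂ} (hl : l ∈ L.lattice) (z : ℂ) :
    L.weierstrassP (z + l) = L.weierstrassP z := L.weierstrassP_add_coe z ⟨l, hl⟩

lemma derivWeierstrassP_add_mem {l : ℂ} (hl : l ∈ L.lattice) (z : ℂ) :
    L.derivWeierstrassP (z + l) = L.derivWeierstrassP z := L.derivWeierstrassP_add_coe z ⟨l, hl⟩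

lemma weierstrassP_congr {x y : ℂ} (h : x - y ∈ L.lattice) :
    L.weierstrassP x = L.weierstrassP y := by
  have := weierstrassP_add_mem L h y
  rwa [add_sub_cancel] at this

lemma derivWeierstrassP_congr {x y : ℂ} (h : x - y ∈ L.lattice) :
    L.derivWeierstrassP x = L.derivWeierstrassP y := by
  have := derivWeierstrassP_add_mem L h y
  rwa [add_sub_cancel] at this

/-- If a product of translates of `℘ - e` has no poles, it has no zeros. -/
lemma weierstrassP_ne_of_prod {ι : Type*} (s : Finset ι) (a : ι → ℂ) (e : ℂ)
    (hord : ∀ x, 0 ≤ ∑ i ∈ s, meromorphicOrderAt (fun z => L.weierstrassP (z + a i) - e) x)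
    (b : ℂ) (hb : ∀ i ∈ s, b + a i ∉ L.lattice) (i : ι) (hi : i ∈ s) :
    L.weierstrassP (b + a i) ≠ e := by
  intro h0
  set f : ℂ → ℂ := ∏ i ∈ s, fun z => L.weierstrassP (z + a i) - e with hf
  have hm : Meromorphic f := fun x =>
    MeromorphicAt.prod fun i _ => meromorphic_weierstrassP_add_sub L (a i) e x
  have ho : ∀ x, meromorphicOrderAt f x =
      ∑ i ∈ s, meromorphicOrderAt (fun z => L.weierstrassP (z + a i) - e) x := fun x =>
    meromorphicOrderAt_prod fun i _ => meromorphic_weierstrassP_add_sub L (a i) e x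
  obtain ⟨K, hK, hK'⟩ := exists_const_of_periodic L hm
    (fun z l hl => by
      simp only [hf, Finset.prod_apply]
      refine Finset.prod_congr rfl fun i _ => ?_
      rw [add_right_comm, weierstrassP_add_mem L hl]) (fun x => (ho x).symm ▸ hord x)
  have hfb : f b = 0 := by
    simp only [hf, Finset.prod_apply]
    exact Finset.prod_eq_zero hi (by simp [h0])
  have hc : ContinuousAt f b := by
    have : AnalyticAt ℂ f b := Finset.analyticAt_prod _ fun i hi =>
      analyticAt_weierstrassP_add_sub L (a i) e b (hb i hi)
    exact this.continuousAt
  rw [hK' b hc] at hfb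
  -- The constant is zero, so f has infinite order at b, although every factor has finite order.
  have h2 : meromorphicOrderAt f b = ⊤ := by
    rw [meromorphicOrderAt_eq_top_iff]
    simpa [hfb, EventuallyEq] using hK b
  rw [ho b, WithTop.sum_eq_top] at h2
  obtain ⟨i, _, h3⟩ := h2
  exact meromorphicOrderAt_weierstrassP_sub_ne_top L (a i) e b h3

/-- If ℘ omitted c, then 1/(℘ - c) would have no poles and hence be constant, yet it vanishes to
order two on the lattice. -/
lemma exists_weierstrassP_eq (c : ℂ) : ∃ q, q ∉ L.lattice ∧ L.weierstrassP q = c := by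
  classical
  by_contra! h
  set f : ℂ → ℂ := fun z => (L.weierstrassP (z + 0) - c) with hf
  have hm : Meromorphic f := meromorphic_weierstrassP_add_sub L 0 c
  have hord : ∀ x, meromorphicOrderAt f⁻¹ x = if x ∈ L.lattice then 2 else 0 := by
    intro x
    rw [meromorphicOrderAt_inv]
    split_ifs with hx
    · rw [meromorphicOrderAt_weierstrassP_sub L 0 c x (by simpa using hx)]; rfl
    · have hA := analyticAt_weierstrassP_add_sub L 0 c x (by simpa using hx)
      have : analyticOrderAt f x = 0 := by
        rw [hA.analyticOrderAt_eq_zero]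
        simpa [sub_eq_zero] using h x hx
      rw [hA.meromorphicOrderAt_eq, this]; rfl
  obtain ⟨K, hK, -⟩ := exists_const_of_periodic L (f := f⁻¹) hm.inv
    (fun z l hl => by
      simp only [hf, Pi.inv_apply, add_zero]
      rw [weierstrassP_add_mem L hl]) (fun x => by rw [hord]; split_ifs <;> decide)
  have h1 := hord 0
  rw [meromorphicOrderAt_congr (hK 0), meromorphicOrderAt_const] at h1
  simp at h1
  split_ifs at h1
  all_goals exact absurd h1 (by decide)

variable (L : PeriodPair)

/-! ### Half-periods and the cubic -/

lemma derivWeierstrassP_eq_zero_of_two_mul_mem {a : ℂ} (h2 : 2 * a ∈ L.lattice) :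
    L.derivWeierstrassP a = 0 := by
  have h1 : L.derivWeierstrassP (-a) = L.derivWeierstrassP a :=
    derivWeierstrassP_congr L (by
      have := neg_mem h2
      rwa [show -(2 * a) = -a - a by ring] at this)
  rw [L.derivWeierstrassP_neg] at h1
  exact CharZero.eq_neg_self_iff.1 h1.symm

/-- `℘` takes its value at a half-period only there. -/
lemma sub_mem_of_weierstrassP_eq {a b : ℂ} (ha : a ∉ L.lattice) (h2 : 2 * a ∈ L.lattice)
    (hb : b ∉ L.lattice) (hab : L.weierstrassP b = L.weierstrassP a) : b - a ∈ L.lattice := by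
  by_contra hba
  have key : ∀ x, x + a ∈ L.lattice ↔ x - a ∈ L.lattice := fun x => by
    rw [show x + a = x - a + 2 * a by ring]
    exact Submodule.add_mem_iff_left _ h2
  have h1 := derivWeierstrassP_eq_zero_of_two_mul_mem L h2
  -- In (℘(z) - ℘(a))(℘(z + a) - ℘(a)) the double pole of each factor is cancelled by a double zero
  -- of the other, because ℘'(a) = 0. A further zero b is then impossible.
  refine weierstrassP_ne_of_prod L Finset.univ ![0, a] (L.weierstrassP a) (fun x => ?_) b
    (fun i _ => ?_) 0 (Finset.mem_univ _) (by simpa using hab)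
  · simp only [Fin.sum_univ_two, Matrix.cons_val_zero, Matrix.cons_val_one]
    by_cases hx : x ∈ L.lattice
    · rw [meromorphicOrderAt_weierstrassP_sub L 0 _ x (by simpa using hx)]
      have hxa : L.weierstrassP (x + a) = L.weierstrassP a :=
        weierstrassP_congr L (by simpa using hx)
      have hxa' : L.derivWeierstrassP (x + a) = 0 := by
        rw [← h1]; exact derivWeierstrassP_congr L (by simpa using hx)
      have := two_le_meromorphicOrderAt_weierstrassP_sub L a (L.weierstrassP a) x
        (fun h => ha ((Submodule.add_mem_iff_right _ hx).1 h)) hxa hxa'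
      calc (0 : WithTop ℤ) = -2 + 2 := rfl
        _ ≤ _ := by gcongr
    by_cases hx' : x + a ∈ L.lattice
    · rw [meromorphicOrderAt_weierstrassP_sub L a _ x hx']
      have hxa : L.weierstrassP (x + 0) = L.weierstrassP a :=
        weierstrassP_congr L (by simpa using (key x).1 hx')
      have hxa' : L.derivWeierstrassP (x + 0) = 0 :=
        (derivWeierstrassP_congr L (by simpa using (key x).1 hx')).trans h1
      have := two_le_meromorphicOrderAt_weierstrassP_sub L 0 (L.weierstrassP a) x
        (by simpa using hx) hxa hxa'
      calc (0 : WithTop ℤ) = 2 + -2 := rfl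
        _ ≤ _ := by gcongr
    · exact add_nonneg
        (analyticAt_weierstrassP_add_sub L 0 _ x (by simpa using hx)).meromorphicOrderAt_nonneg
        (analyticAt_weierstrassP_add_sub L a _ x hx').meromorphicOrderAt_nonneg
  · fin_cases i
    · simpa using hb
    · simpa [key] using hba

/-- The half-periods `ω₁, ω₂, ω₃`. -/
lemma half_facts : (L.ω₁ / 2 ∉ L.lattice ∧ L.ω₂ / 2 ∉ L.lattice ∧ (L.ω₁ + L.ω₂) / 2 ∉ L.lattice) ∧
    2 * (L.ω₁ / 2) ∈ L.lattice ∧ 2 * (L.ω₂ / 2) ∈ L.lattice ∧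
      2 * ((L.ω₁ + L.ω₂) / 2) ∈ L.lattice := by
  refine ⟨⟨L.ω₁_div_two_notMem_lattice, L.ω₂_div_two_notMem_lattice, ?_⟩, ?_, ?_, ?_⟩
  · have := (L.mul_ω₁_add_mul_ω₂_mem_lattice (α := 1 / 2) (β := 1 / 2)).not.mpr (by norm_num)
    convert this using 2
    push_cast; ring
  · rw [mul_div_cancel₀ _ two_ne_zero]; exact L.ω₁_mem_lattice
  · rw [mul_div_cancel₀ _ two_ne_zero]; exact L.ω₂_mem_lattice
  · rw [mul_div_cancel₀ _ two_ne_zero]; exact add_mem L.ω₁_mem_lattice L.ω₂_mem_lattice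

lemma weierstrassP_half_ne : L.weierstrassP (L.ω₁ / 2) ≠ L.weierstrassP (L.ω₂ / 2) ∧
    L.weierstrassP (L.ω₁ / 2) ≠ L.weierstrassP ((L.ω₁ + L.ω₂) / 2) ∧
    L.weierstrassP (L.ω₂ / 2) ≠ L.weierstrassP ((L.ω₁ + L.ω₂) / 2) := by
  obtain ⟨⟨h1, h2, h3⟩, k1, k2, k3⟩ := half_facts L
  refine ⟨fun h => ?_, fun h => ?_, fun h => ?_⟩
  · have := add_mem (sub_mem_of_weierstrassP_eq L h2 k2 h1 h) k2
    refine h3 ?_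
    convert this using 1; ring
  · have := sub_mem_of_weierstrassP_eq L h3 k3 h1 h
    refine h2 (neg_mem_iff.1 ?_)
    convert this using 1; ring
  · have := sub_mem_of_weierstrassP_eq L h3 k3 h2 h
    refine h1 (neg_mem_iff.1 ?_)
    convert this using 1; ring

lemma cubic_root {a : ℂ} (ha : a ∉ L.lattice) (h2 : 2 * a ∈ L.lattice) :
    4 * L.weierstrassP a ^ 3 - L.g₂ * L.weierstrassP a - L.g₃ = 0 := by
  rw [← L.derivWeierstrassP_sq a ha, derivWeierstrassP_eq_zero_of_two_mul_mem L h2]; simp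

/-- The half-period values are three distinct roots of the cubic. First and second divided
differences of the root equations give the relations between roots and coefficients. -/
lemma cubic_factor (t : ℂ) : 4 * t ^ 3 - L.g₂ * t - L.g₃ =
    4 * ((t - L.weierstrassP (L.ω₁ / 2)) * (t - L.weierstrassP (L.ω₂ / 2)) *
      (t - L.weierstrassP ((L.ω₁ + L.ω₂) / 2))) := by
  obtain ⟨⟨h1, h2, h3⟩, k1, k2, k3⟩ := half_facts L
  obtain ⟨n1, n2, n3⟩ := weierstrassP_half_ne L
  have r1 := cubic_root L h1 k1
  have r2 := cubic_root L h2 k2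
  have r3 := cubic_root L h3 k3
  generalize L.weierstrassP (L.ω₁ / 2) = a at *
  generalize L.weierstrassP (L.ω₂ / 2) = b at *
  generalize L.weierstrassP ((L.ω₁ + L.ω₂) / 2) = c at *
  have e1 : 4 * (a ^ 2 + a * b + b ^ 2) - L.g₂ = 0 := by
    apply mul_left_cancel₀ (sub_ne_zero.2 n1); linear_combination r1 - r2
  have e2 : 4 * (a ^ 2 + a * c + c ^ 2) - L.g₂ = 0 := by
    apply mul_left_cancel₀ (sub_ne_zero.2 n2); linear_combination r1 - r3
  have e3 : a + b + c = 0 := by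
    apply mul_left_cancel₀ (sub_ne_zero.2 n3); linear_combination (e1 - e2) / 4
  have hc : c = -a - b := by linear_combination e3
  subst hc
  linear_combination t * e1 + r1 - a * e1

lemma derivWeierstrassP_sq_factor {q : ℂ} (hq : q ∉ L.lattice) : L.derivWeierstrassP q ^ 2 =
    4 * ((L.weierstrassP q - L.weierstrassP (L.ω₁ / 2)) *
      (L.weierstrassP q - L.weierstrassP (L.ω₂ / 2)) *
      (L.weierstrassP q - L.weierstrassP ((L.ω₁ + L.ω₂) / 2))) := by
  rw [L.derivWeierstrassP_sq q hq, cubic_factor]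

lemma two_mul_mem_of_derivWeierstrassP_eq_zero {q : ℂ} (hq : q ∉ L.lattice)
    (h : L.derivWeierstrassP q = 0) : 2 * q ∈ L.lattice := by
  have h1 := derivWeierstrassP_sq_factor L hq
  obtain ⟨⟨h1', h2, h3⟩, k1, k2, k3⟩ := half_facts L
  have aux : ∀ a, a ∉ L.lattice → 2 * a ∈ L.lattice → L.weierstrassP q - L.weierstrassP a = 0 →
      2 * q ∈ L.lattice := fun a ha ha2 h0 => by
    have := sub_mem_of_weierstrassP_eq L ha ha2 hq (sub_eq_zero.1 h0)
    have := add_mem (add_mem this this) ha2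
    convert this using 1; ring
  rw [h] at h1
  simp only [ne_eq, OfNat.ofNat_ne_zero, not_false_eq_true, zero_pow, zero_eq_mul, false_or,
    or_assoc, mul_eq_zero] at h1
  rcases h1 with h1 | h1 | h1
  exacts [aux _ h1' k1 h1, aux _ h2 k2 h1, aux _ h3 k3 h1]

/-! ### Derivatives of ℘ -/

lemma isOpen_compl_lattice : IsOpen (L.lattice : Set ℂ)ᶜ := L.isClosed_lattice.isOpen_compl

lemma eventually_notMem_lattice {q : ℂ} (hq : q ∉ L.lattice) : ∀ᶠ z in 𝓝 q, z ∉ L.lattice :=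
  (isOpen_compl_lattice L).mem_nhds hq

/-- Differentiating the equation for ℘'² and dividing by 2℘' proves this where ℘' ≠ 0. The zeros of
℘' are isolated, so continuity gives the remaining points. -/
lemma deriv_derivWeierstrassP {q : ℂ} (hq : q ∉ L.lattice) :
    deriv L.derivWeierstrassP q = 6 * L.weierstrassP q ^ 2 - L.g₂ / 2 := by
  have hne : ∀ z, z ∉ L.lattice → L.derivWeierstrassP z ≠ 0 →
      deriv L.derivWeierstrassP z = 6 * L.weierstrassP z ^ 2 - L.g₂ / 2 := by
    intro z hz h0
    have h1 : (fun z => L.derivWeierstrassP z ^ 2) =ᶠ[𝓝 z]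
        fun z => 4 * L.weierstrassP z ^ 3 - L.g₂ * L.weierstrassP z - L.g₃ := by
      filter_upwards [eventually_notMem_lattice L hz] with w hw using L.derivWeierstrassP_sq w hw
    have h2 := (L.analyticOnNhd_derivWeierstrassP z hz).differentiableAt.hasDerivAt
    have h3 := hasDerivAt_weierstrassP L z hz
    have h4 := (h2.pow 2).unique (HasDerivAt.congr_of_eventuallyEq
      ((((h3.pow 3).const_mul 4).sub (h3.const_mul L.g₂)).sub_const L.g₃) h1)
    apply mul_left_cancel₀ (mul_ne_zero two_ne_zero h0)
    simp only [Nat.cast_ofNat, Nat.add_one_sub_one, pow_one] at h4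
    linear_combination h4
  have hA := L.analyticOnNhd_derivWeierstrassP q hq
  have hev : ∀ᶠ z in 𝓝[≠] q, L.derivWeierstrassP z ≠ 0 := by
    rcases hA.eventually_eq_zero_or_eventually_ne_zero with h | h
    · exfalso
      have h1 : ∀ᶠ z in 𝓝 q, z - q ∈ L.lattice → z = q := by
        have : ∀ᶠ z in 𝓝 q, z - q ∈ ((L.lattice : Set ℂ) \ {0})ᶜ := by
          have := L.compl_lattice_sdiff_singleton_mem_nhds 0
          rw [← sub_self q] at this
          have hc : ContinuousAt (fun z => z - q) q := by fun_prop
          exact hc.preimage_mem_nhds (by simpa using this)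
        filter_upwards [this] with z hz hz'
        simpa [hz', sub_eq_zero] using hz
      have h2 : ∀ᶠ z in 𝓝 q, 2 * z ∈ L.lattice := by
        filter_upwards [h, eventually_notMem_lattice L hq] with z hz hz'
        exact two_mul_mem_of_derivWeierstrassP_eq_zero L hz' hz
      -- If ℘' vanished near q, all nearby points would be half-lattice points. Applied to the
      -- midpoint of q and z, this makes z - q a small lattice vector, hence zero.
      have h3 : Tendsto (fun z => q + (z - q) / 2) (𝓝 q) (𝓝 q) := by
        have : Continuous fun z => q + (z - q) / 2 := by fun_prop
        simpa using this.tendsto q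
      have h4 : ∀ᶠ z in 𝓝 q, z = q := by
        filter_upwards [h1, h3.eventually h2] with z hz hz'
        refine hz ?_
        have := sub_mem hz' h2.self_of_nhds
        convert this using 1; ring
      have h5 : ∀ᶠ z in 𝓝[≠] q, False := by
        filter_upwards [h4.filter_mono nhdsWithin_le_nhds, self_mem_nhdsWithin] with z hz hz'
        exact hz' hz
      rw [eventually_false_iff_eq_bot] at h5
      exact (NeBot.ne inferInstance h5).elim
    · exact h
  have hP := L.analyticOnNhd_weierstrassP q hq
  have hc : ContinuousAt (fun z => 6 * L.weierstrassP z ^ 2 - L.g₂ / 2) q := by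
    have := hP.continuousAt; fun_prop
  refine tendsto_nhds_unique (hA.deriv.continuousAt.tendsto.mono_left nhdsWithin_le_nhds)
    ((hc.tendsto.mono_left (nhdsWithin_le_nhds (s := {q}ᶜ))).congr' ?_)
  filter_upwards [hev, (eventually_notMem_lattice L hq).filter_mono nhdsWithin_le_nhds]
    with z hz hz' using (hne z hz' hz).symm

lemma hasDerivAt_derivWeierstrassP {q : ℂ} (hq : q ∉ L.lattice) :
    HasDerivAt L.derivWeierstrassP (6 * L.weierstrassP q ^ 2 - L.g₂ / 2) q := by
  rw [← deriv_derivWeierstrassP L hq]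
  exact (L.analyticOnNhd_derivWeierstrassP q hq).differentiableAt.hasDerivAt

/-- The hamiltonian contains ℘^(i-2) with i ≤ 6, so derivatives up to the fourth are needed. -/
lemma iteratedDeriv_weierstrassP {q : ℂ} (hq : q ∉ L.lattice) :
    iteratedDeriv 0 L.weierstrassP q = L.weierstrassP q ∧
    iteratedDeriv 1 L.weierstrassP q = L.derivWeierstrassP q ∧
    iteratedDeriv 2 L.weierstrassP q = 6 * L.weierstrassP q ^ 2 - L.g₂ / 2 ∧
    iteratedDeriv 3 L.weierstrassP q = 12 * L.weierstrassP q * L.derivWeierstrassP q ∧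
    iteratedDeriv 4 L.weierstrassP q = 12 * L.derivWeierstrassP q ^ 2 +
      12 * L.weierstrassP q * (6 * L.weierstrassP q ^ 2 - L.g₂ / 2) := by
  have h2 : ∀ q, q ∉ L.lattice →
      iteratedDeriv 2 L.weierstrassP q = 6 * L.weierstrassP q ^ 2 - L.g₂ / 2 := fun q hq => by
    rw [iteratedDeriv_succ, iteratedDeriv_one, L.deriv_weierstrassP, deriv_derivWeierstrassP L hq]
  have h3 : ∀ q, q ∉ L.lattice →
      iteratedDeriv 3 L.weierstrassP q = 12 * L.weierstrassP q * L.derivWeierstrassP q := by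
    intro q hq
    rw [iteratedDeriv_succ]
    have : iteratedDeriv 2 L.weierstrassP =ᶠ[𝓝 q] fun q => 6 * L.weierstrassP q ^ 2 - L.g₂ / 2 := by
      filter_upwards [eventually_notMem_lattice L hq] with z hz using h2 z hz
    rw [this.deriv_eq]
    have hd := hasDerivAt_weierstrassP L q hq
    have := (((hd.pow 2).const_mul 6).sub_const (L.g₂ / 2)).deriv
    refine this.trans ?_
    simp only [Nat.cast_ofNat, Nat.add_one_sub_one, pow_one]; ring
  refine ⟨by simp, by rw [iteratedDeriv_one, L.deriv_weierstrassP], h2 q hq, h3 q hq, ?_⟩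
  rw [iteratedDeriv_succ]
  have : iteratedDeriv 3 L.weierstrassP =ᶠ[𝓝 q]
      fun q => 12 * L.weierstrassP q * L.derivWeierstrassP q := by
    filter_upwards [eventually_notMem_lattice L hq] with z hz using h3 z hz
  rw [this.deriv_eq]
  refine (((hasDerivAt_weierstrassP L q hq).const_mul 12).mul
    (hasDerivAt_derivWeierstrassP L hq)).deriv.trans ?_
  ring

variable (L : PeriodPair)

/-! ### Lattices with complex multiplication -/

/-- `ζ Λ = Λ`. -/
def Preserves (ζ : ℂ) : Prop := ζ ≠ 0 ∧ ∀ l, ζ * l ∈ L.lattice ↔ l ∈ L.lattice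

variable {L}

lemma Preserves.pow {ζ : ℂ} (h : Preserves L ζ) (n : ℕ) : Preserves L (ζ ^ n) := by
  refine ⟨pow_ne_zero n h.1, fun l => ?_⟩
  induction n with
  | zero => simp
  | succ n ih => rw [pow_succ', mul_assoc, h.2, ih]

/-- Multiplication by `ζ` as a permutation of the lattice. -/
def Preserves.equiv {ζ : ℂ} (h : Preserves L ζ) : L.lattice ≃ L.lattice where
  toFun l := ⟨ζ * l, (h.2 l).2 l.2⟩
  invFun l := ⟨ζ⁻¹ * l, (h.2 _).1 (by rw [mul_inv_cancel_left₀ h.1]; exact l.2)⟩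
  left_inv l := by ext; simp [h.1]
  right_inv l := by ext; simp [h.1]

/-- Multiplication by ζ permutes the lattice, so the defining series can be reindexed, and its terms
are homogeneous of degree -2. The same argument gives the weights of ℘' and of the Eisenstein
series. -/
lemma Preserves.weierstrassP {ζ : ℂ} (h : Preserves L ζ) (z : ℂ) :
    ζ ^ 2 * L.weierstrassP (ζ * z) = L.weierstrassP z := by
  simp only [PeriodPair.weierstrassP]
  rw [← h.equiv.tsum_eq, ← tsum_mul_left]
  refine tsum_congr fun l => ?_
  have := h.1
  change ζ ^ 2 * (1 / (ζ * z - ζ * l) ^ 2 - 1 / (ζ * l) ^ 2) = _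
  have key : ∀ a : ℂ, ζ ^ 2 * (1 / (ζ ^ 2 * a)) = 1 / a := fun a => by
    rw [mul_one_div, div_mul_eq_div_div, div_self (pow_ne_zero 2 this)]
  rw [← mul_sub, mul_pow, mul_pow, mul_sub, key, key]

lemma Preserves.derivWeierstrassP {ζ : ℂ} (h : Preserves L ζ) (z : ℂ) :
    ζ ^ 3 * L.derivWeierstrassP (ζ * z) = L.derivWeierstrassP z := by
  simp only [PeriodPair.derivWeierstrassP]
  rw [← h.equiv.tsum_eq, mul_neg, ← tsum_mul_left]
  congr 1
  refine tsum_congr fun l => ?_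
  have := h.1
  change ζ ^ 3 * (2 / (ζ * z - ζ * l) ^ 3) = _
  rw [← mul_sub, mul_pow, mul_div_assoc', mul_div_mul_left _ _ (pow_ne_zero 3 this)]

lemma Preserves.G {ζ : ℂ} (h : Preserves L ζ) (n : ℕ) : ζ ^ n * L.G n = L.G n := by
  conv_lhs => rw [PeriodPair.G, ← h.equiv.tsum_eq, ← tsum_mul_left]
  refine tsum_congr fun l => ?_
  change ζ ^ n * ((ζ * l) ^ n)⁻¹ = _
  rw [mul_pow, mul_inv, mul_inv_cancel_left₀ (pow_ne_zero n h.1)]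

lemma preserves_of_omega {ζ : ℂ} {a b c d : ℤ} {n : ℕ} (hζ : ζ ^ (n + 1) = 1)
    (h1 : ζ * L.ω₁ = a * L.ω₁ + b * L.ω₂) (h2 : ζ * L.ω₂ = c * L.ω₁ + d * L.ω₂) :
    Preserves L ζ := by
  have h0 : ζ ≠ 0 := by rintro rfl; simp at hζ
  have key : ∀ l ∈ L.lattice, ζ * l ∈ L.lattice := by
    intro l hl
    obtain ⟨p, q, rfl⟩ := PeriodPair.mem_lattice.1 hl
    refine PeriodPair.mem_lattice.2 ⟨p * a + q * c, p * b + q * d, ?_⟩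
    push_cast
    linear_combination (-(p : ℂ)) * h1 - q * h2
  refine ⟨h0, fun l => ⟨fun hl => ?_, key l⟩⟩
  -- As ζ has finite order, ζ⁻¹ is a power of ζ, so stability under ζ already gives the converse
  -- inclusion.
  have hpow : ∀ k : ℕ, ζ ^ k * (ζ * l) ∈ L.lattice := by
    intro k
    induction k with
    | zero => simpa using hl
    | succ k ih => rw [pow_succ', mul_assoc]; exact key _ ih
  have := hpow n
  rwa [← mul_assoc, ← pow_succ, hζ, one_mul] at this

lemma omega_ne_zero : L.ω₁ ≠ 0 := by
  simpa using L.indep.ne_zero 0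

/-! #### Roots of unity -/

lemma root_pow (m : ℕ) (hm : m ≠ 0) : root m ^ m = 1 :=
  (Complex.isPrimitiveRoot_exp m hm).pow_eq_one

lemma root_two : root 2 = -1 := by
  rw [root, show (2 * Real.pi * Complex.I / (2 : ℕ) : ℂ) = Real.pi * Complex.I by push_cast; ring,
    Complex.exp_pi_mul_I]

lemma root_four : root 4 = Complex.I := by
  rw [root, show (2 * Real.pi * Complex.I / (4 : ℕ) : ℂ) = Real.pi / 2 * Complex.I by
    push_cast; ring, Complex.exp_pi_div_two_mul_I]

lemma root_six : root 6 = Complex.exp (Real.pi * Complex.I / 3) := by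
  rw [root]; congr 1; push_cast; ring

lemma root_three : root 3 = root 6 ^ 2 := by
  rw [root, root, ← Complex.exp_nat_mul]; congr 1; push_cast; ring

lemma root_six_sq : root 6 ^ 2 = root 6 - 1 := by
  have hp := Complex.isPrimitiveRoot_exp 6 (by norm_num)
  change IsPrimitiveRoot (root 6) 6 at hp
  have h6 := hp.pow_eq_one
  have h3 : root 6 ^ 3 ≠ 1 := hp.pow_ne_one_of_pos_of_lt (by norm_num) (by norm_num)
  have h2 : root 6 ^ 2 ≠ 1 := hp.pow_ne_one_of_pos_of_lt (by norm_num) (by norm_num)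
  have h3' : root 6 ^ 3 = -1 := by
    have : (root 6 ^ 3 - 1) * (root 6 ^ 3 + 1) = 0 := by linear_combination h6
    rcases mul_eq_zero.1 this with h | h
    · exact absurd (sub_eq_zero.1 h) h3
    · linear_combination h
  have h1 : root 6 + 1 ≠ 0 := fun h => h2 (by linear_combination (root 6 - 1) * h)
  apply mul_left_cancel₀ h1
  linear_combination h3'

variable {m : ℕ}

lemma square_omega (hL : IsSymmetricLattice 4 L) : L.ω₂ = Complex.I * L.ω₁ := by
  have := hL.1 rfl
  rwa [div_eq_iff omega_ne_zero] at this

lemma hex_omega (hm : m = 3 ∨ m = 6) (hL : IsSymmetricLattice m L) : L.ω₂ = root 6 * L.ω₁ := by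
  have := hL.2 hm
  rwa [div_eq_iff omega_ne_zero, ← root_six] at this

lemma preserves_I (hL : IsSymmetricLattice 4 L) : Preserves L Complex.I := by
  refine preserves_of_omega (n := 3) (a := 0) (b := 1) (c := -1) (d := 0) Complex.I_pow_four ?_ ?_
  · rw [square_omega hL]; push_cast; ring
  · rw [square_omega hL]; push_cast; linear_combination L.ω₁ * Complex.I_sq

lemma preserves_root_six (hm : m = 3 ∨ m = 6) (hL : IsSymmetricLattice m L) :
    Preserves L (root 6) := by
  refine preserves_of_omega (n := 5) (a := 0) (b := 1) (c := -1) (d := 1)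
    (root_pow 6 (by norm_num)) ?_ ?_
  · rw [hex_omega hm hL]; push_cast; ring
  · rw [hex_omega hm hL]; push_cast; linear_combination L.ω₁ * root_six_sq

lemma preserves_root (hm : m = 2 ∨ m = 3 ∨ m = 4 ∨ m = 6) (hL : IsSymmetricLattice m L) :
    Preserves L (root m) := by
  rcases hm with rfl | rfl | rfl | rfl
  · rw [root_two]
    exact ⟨by norm_num, fun l => by rw [neg_one_mul, neg_mem_iff]⟩
  · rw [root_three]; exact (preserves_root_six (Or.inl rfl) hL).pow 2
  · rw [root_four]; exact preserves_I hL
  · exact preserves_root_six (Or.inr rfl) hL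

/-! #### The hexagonal lattice -/

lemma hex_g₂ (h6 : Preserves L (root 6)) : L.g₂ = 0 := by
  have h := h6.G 4
  have h4 : root 6 ^ 4 ≠ 1 := (Complex.isPrimitiveRoot_exp 6
    (by norm_num)).pow_ne_one_of_pos_of_lt (by norm_num) (by norm_num)
  have : (root 6 ^ 4 - 1) * L.G 4 = 0 := by linear_combination h
  rcases mul_eq_zero.1 this with h | h
  · exact absurd (sub_eq_zero.1 h) h4
  · rw [PeriodPair.g₂, h, mul_zero]

lemma eta_notMem : (L.ω₁ + L.ω₂) / 3 ∉ L.lattice := by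
  have := (L.mul_ω₁_add_mul_ω₂_mem_lattice (α := 1 / 3) (β := 1 / 3)).not.mpr (by norm_num)
  convert this using 2
  push_cast; ring

lemma three_eta_mem : 3 * ((L.ω₁ + L.ω₂) / 3) ∈ L.lattice := by
  rw [mul_div_cancel₀ _ three_ne_zero]; exact add_mem L.ω₁_mem_lattice L.ω₂_mem_lattice

lemma root_six_mul_eta (hm : m = 3 ∨ m = 6) (hL : IsSymmetricLattice m L) :
    root 6 * ((L.ω₁ + L.ω₂) / 3) + (L.ω₁ + L.ω₂) / 3 ∈ L.lattice := by
  refine PeriodPair.mem_lattice.2 ⟨0, 1, ?_⟩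
  rw [hex_omega hm hL]; push_cast
  linear_combination -(L.ω₁ / 3) * root_six_sq

/-- With ζ = e^{πi/3} one has ζη ≡ -η modulo the lattice. Evenness and the weight of ℘ then give
ζ²℘(η) = ℘(η), while ζ² ≠ 1. -/
lemma weierstrassP_eta (hm : m = 3 ∨ m = 6) (hL : IsSymmetricLattice m L) :
    L.weierstrassP ((L.ω₁ + L.ω₂) / 3) = 0 := by
  have h6 := preserves_root_six hm hL
  have h := h6.weierstrassP ((L.ω₁ + L.ω₂) / 3)
  have h1 : L.weierstrassP (root 6 * ((L.ω₁ + L.ω₂) / 3)) = L.weierstrassP ((L.ω₁ + L.ω₂) / 3) := by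
    rw [← L.weierstrassP_neg ((L.ω₁ + L.ω₂) / 3)]
    refine weierstrassP_congr L ?_
    simpa using root_six_mul_eta hm hL
  rw [h1, root_six_sq] at h
  have h2 : root 6 - 2 ≠ 0 := fun h => by
    have h2 := root_six_sq
    rw [sub_eq_zero.1 h] at h2
    norm_num at h2
  apply mul_left_cancel₀ h2
  linear_combination h

lemma weierstrassP_two_eta (hm : m = 3 ∨ m = 6) (hL : IsSymmetricLattice m L) :
    L.weierstrassP (2 * ((L.ω₁ + L.ω₂) / 3)) = 0 := by
  rw [← weierstrassP_eta hm hL, ← L.weierstrassP_neg ((L.ω₁ + L.ω₂) / 3)]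
  refine weierstrassP_congr L ?_
  convert three_eta_mem (L := L) using 1; ring

lemma derivWeierstrassP_two_eta : L.derivWeierstrassP (2 * ((L.ω₁ + L.ω₂) / 3)) =
    -L.derivWeierstrassP ((L.ω₁ + L.ω₂) / 3) := by
  rw [← L.derivWeierstrassP_neg ((L.ω₁ + L.ω₂) / 3)]
  refine derivWeierstrassP_congr L ?_
  convert three_eta_mem (L := L) using 1; ring

lemma two_eta_notMem : 2 * ((L.ω₁ + L.ω₂) / 3) ∉ L.lattice := fun h => by
  refine eta_notMem (L := L) ?_
  convert sub_mem (three_eta_mem (L := L)) h using 1; ring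

/-- On a hexagonal lattice, the zeros of `℘` are the points of order three fixed by `ℤ₃`. -/
lemma mem_of_weierstrassP_eq_zero (hm : m = 3 ∨ m = 6) (hL : IsSymmetricLattice m L) {b : ℂ}
    (hb : b ∉ L.lattice) (h0 : L.weierstrassP b = 0) :
    b + (L.ω₁ + L.ω₂) / 3 ∈ L.lattice ∨ b + 2 * ((L.ω₁ + L.ω₂) / 3) ∈ L.lattice := by
  by_contra! hba
  have h1 := weierstrassP_eta hm hL
  have h2 := weierstrassP_two_eta hm hL
  have n1 := eta_notMem (L := L)
  have n2 := two_eta_notMem (L := L)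
  have h3 := three_eta_mem (L := L)
  set a := (L.ω₁ + L.ω₂) / 3 with ha
  have hz : ∀ x t, x + t - a ∈ L.lattice ∨ x + t - 2 * a ∈ L.lattice →
      1 ≤ meromorphicOrderAt (fun z => L.weierstrassP (z + t) - 0) x := by
    intro x t ht
    refine one_le_meromorphicOrderAt_weierstrassP_sub L t 0 x (fun h => ?_) ?_
    · rcases ht with ht | ht
      · exact n1 (by convert sub_mem h ht using 1; ring)
      · exact n2 (by convert sub_mem h ht using 1; ring)
    · rcases ht with ht | ht
      · rw [weierstrassP_congr L ht, h1]
      · rw [weierstrassP_congr L ht, h2]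
  have hn : ∀ x t, x + t ∉ L.lattice →
      0 ≤ meromorphicOrderAt (fun z => L.weierstrassP (z + t) - 0) x := fun x t ht =>
    (analyticAt_weierstrassP_add_sub L t _ x ht).meromorphicOrderAt_nonneg
  have hp := meromorphicOrderAt_weierstrassP_sub L
  -- In ℘(z)℘(z + η)℘(z + 2η) the double pole of each factor meets zeros of the other two, so the
  -- product has no poles.
  refine weierstrassP_ne_of_prod L Finset.univ ![0, a, 2 * a] 0 (fun x => ?_) b
    (fun i _ => ?_) 0 (Finset.mem_univ _) (by simpa using h0)
  · simp only [Fin.sum_univ_three, Matrix.cons_val_zero, Matrix.cons_val_one, Matrix.cons_val]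
    by_cases hx : x + 0 ∈ L.lattice
    · rw [hp 0 _ x hx]
      have A := hz x a (Or.inl (by simpa using hx))
      have B := hz x (2 * a) (Or.inr (by simpa using hx))
      calc (0 : WithTop ℤ) = -2 + 1 + 1 := rfl
        _ ≤ _ := by gcongr
    by_cases hx1 : x + a ∈ L.lattice
    · rw [hp a _ x hx1]
      have A := hz x (2 * a) (Or.inl (by convert hx1 using 1; ring))
      have B := hz x 0 (Or.inr (by convert sub_mem hx1 h3 using 1; ring))
      calc (0 : WithTop ℤ) = 1 + -2 + 1 := rfl
        _ ≤ _ := by gcongr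
    by_cases hx2 : x + 2 * a ∈ L.lattice
    · rw [hp (2 * a) _ x hx2]
      have A := hz x 0 (Or.inl (by convert sub_mem hx2 h3 using 1; ring))
      have B := hz x a (Or.inr (by convert sub_mem hx2 h3 using 1; ring))
      calc (0 : WithTop ℤ) = 1 + 1 + -2 := rfl
        _ ≤ _ := by gcongr
    · exact add_nonneg (add_nonneg (hn x 0 hx) (hn x a hx1)) (hn x _ hx2)
  · fin_cases i
    · simpa using hb
    · exact hba.1
    · exact hba.2

/-! #### The square lattice -/

lemma square_g₃ (hL : IsSymmetricLattice 4 L) : L.g₃ = 0 := by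
  have h := (preserves_I hL).G 6
  have : Complex.I ^ 6 = -1 := by
    rw [show Complex.I ^ 6 = Complex.I ^ 4 * Complex.I ^ 2 by ring, Complex.I_pow_four,
      Complex.I_sq]; ring
  rw [this] at h
  rw [PeriodPair.g₃]
  linear_combination -70 * h

/-- Multiplication by i fixes ω₃ modulo the lattice and changes the sign of ℘. -/
lemma weierstrassP_omega_three (hL : IsSymmetricLattice 4 L) :
    L.weierstrassP ((L.ω₁ + L.ω₂) / 2) = 0 := by
  have h := (preserves_I hL).weierstrassP ((L.ω₁ + L.ω₂) / 2)
  have h1 : L.weierstrassP (Complex.I * ((L.ω₁ + L.ω₂) / 2)) =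
      L.weierstrassP ((L.ω₁ + L.ω₂) / 2) := by
    refine weierstrassP_congr L (PeriodPair.mem_lattice.2 ⟨-1, 0, ?_⟩)
    rw [square_omega hL]; push_cast; linear_combination (-L.ω₁ / 2) * Complex.I_sq
  rw [h1, Complex.I_sq] at h
  linear_combination (-1 / 2) * h

lemma weierstrassP_omega_two (hL : IsSymmetricLattice 4 L) :
    L.weierstrassP (L.ω₂ / 2) = -L.weierstrassP (L.ω₁ / 2) := by
  have h := (preserves_I hL).weierstrassP (L.ω₁ / 2)
  rw [show Complex.I * (L.ω₁ / 2) = L.ω₂ / 2 by rw [square_omega hL]; ring, Complex.I_sq] at h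
  linear_combination -h

lemma cubic_symm (L : PeriodPair) :
    L.weierstrassP (L.ω₁ / 2) + L.weierstrassP (L.ω₂ / 2) +
      L.weierstrassP ((L.ω₁ + L.ω₂) / 2) = 0 ∧
    L.weierstrassP (L.ω₁ / 2) * L.weierstrassP (L.ω₂ / 2) +
      L.weierstrassP (L.ω₁ / 2) * L.weierstrassP ((L.ω₁ + L.ω₂) / 2) +
      L.weierstrassP (L.ω₂ / 2) * L.weierstrassP ((L.ω₁ + L.ω₂) / 2) = -L.g₂ / 4 ∧
    L.weierstrassP (L.ω₁ / 2) * L.weierstrassP (L.ω₂ / 2) *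
      L.weierstrassP ((L.ω₁ + L.ω₂) / 2) = L.g₃ / 4 := by
  have h0 := cubic_factor L 0
  have h1 := cubic_factor L 1
  have h2 := cubic_factor L (-1)
  refine ⟨?_, ?_, ?_⟩
  · linear_combination (1 / 8) * h1 + (1 / 8) * h2 - (1 / 4) * h0
  · linear_combination (-1 / 8) * h1 + (1 / 8) * h2
  · linear_combination (1 / 4) * h0

/-! ### The functions `u` and `v` -/

/-- ℘ and ℘' have weights -2 and -3, and for each m the weight of `v` is congruent to 1 modulo m:
-3, -2, -3, -5 for m = 2, 3, 4, 6. -/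
lemma v_root (hm : m = 2 ∨ m = 3 ∨ m = 4 ∨ m = 6) (hL : IsSymmetricLattice m L) (q : ℂ) :
    v m L (root m * q) = root m * v m L q := by
  have hp := preserves_root hm hL
  have h2 := hp.weierstrassP q
  have h3 := hp.derivWeierstrassP q
  have hr := root_pow m (by omega)
  rcases hm with rfl | rfl | rfl | rfl <;> simp only [v]
  · rw [← h3]; linear_combination (-(root 2) ^ 2 - 1) / 2 *
      L.derivWeierstrassP (root 2 * q) * hr
  · rw [← h2]; linear_combination -L.weierstrassP (root 3 * q) * hr
  · rw [← h3]; linear_combination -L.derivWeierstrassP (root 4 * q) / 2 * hr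
  · rw [← h3, ← h2]
    linear_combination -L.weierstrassP (root 6 * q) * L.derivWeierstrassP (root 6 * q) / 2 * hr

lemma v_congr {x y : ℂ} (h : x - y ∈ L.lattice) : v m L x = v m L y := by
  unfold v
  rw [weierstrassP_congr L h, derivWeierstrassP_congr L h]

/-- At a point fixed by ω^l, equivariance gives v = ω^l v with ω^l ≠ 1. -/
lemma v_eq_zero_of_isFixedPoint (hm : m = 2 ∨ m = 3 ∨ m = 4 ∨ m = 6)
    (hL : IsSymmetricLattice m L) {q : ℂ} (h : IsFixedPoint m L q) : v m L q = 0 := by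
  obtain ⟨l, h1, h2, h3⟩ := h
  have hpow : ∀ l : ℕ, v m L (root m ^ l * q) = root m ^ l * v m L q := by
    intro l
    induction l with
    | zero => simp
    | succ l ih => rw [pow_succ', mul_assoc, v_root hm hL, ih, mul_assoc]
  have h4 := hpow l
  rw [v_congr h3] at h4
  have h5 : root m ^ l ≠ 1 :=
    (Complex.isPrimitiveRoot_exp m (by omega)).pow_ne_one_of_pos_of_lt (by omega) h2
  have : (root m ^ l - 1) * v m L q = 0 := by linear_combination -h4
  rcases mul_eq_zero.1 this with h | h
  · exact absurd (sub_eq_zero.1 h) h5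
  · exact h

lemma isFixedPoint_of_mem (hm : m = 2 ∨ m = 3 ∨ m = 4 ∨ m = 6) (hL : IsSymmetricLattice m L) {q : ℂ}
    (h : q ∈ L.lattice) : IsFixedPoint m L q :=
  ⟨1, le_rfl, by omega, sub_mem (by rw [pow_one]; exact ((preserves_root hm hL).2 q).2 h) h⟩

lemma root_six_sq_fixed (hm : m = 3 ∨ m = 6) (hL : IsSymmetricLattice m L) {q : ℂ}
    (hq : q ∉ L.lattice) (h : L.weierstrassP q = 0) : root 6 ^ 2 * q - q ∈ L.lattice := by
  have h6 := preserves_root_six hm hL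
  have he := root_six_mul_eta hm hL
  have hadd : ∀ x y, root 6 ^ 2 * x - x ∈ L.lattice → root 6 ^ 2 * y - y ∈ L.lattice →
      root 6 ^ 2 * (x - y) - (x - y) ∈ L.lattice := fun x y hx hy => by
    convert sub_mem hx hy using 1; ring
  have hl : ∀ x ∈ L.lattice, root 6 ^ 2 * x - x ∈ L.lattice := fun x hx =>
    sub_mem (((h6.pow 2).2 x).2 hx) hx
  have heta : root 6 ^ 2 * ((L.ω₁ + L.ω₂) / 3) - (L.ω₁ + L.ω₂) / 3 ∈ L.lattice := by
    convert sub_mem ((h6.2 _).2 he) he using 1; ring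
  rcases mem_of_weierstrassP_eq_zero hm hL hq h with h | h
  · convert hadd _ _ (hl _ h) heta using 1; ring
  · convert hadd _ _ (hadd _ _ (hl _ h) heta) heta using 1; ring

/-- Zeros of ℘' are half-periods, fixed by -1. Zeros of ℘ on a hexagonal lattice are the points of
order three fixed by e^{2πi/3}. -/
lemma isFixedPoint_of_v_eq_zero (hm : m = 2 ∨ m = 3 ∨ m = 4 ∨ m = 6)
    (hL : IsSymmetricLattice m L) {q : ℂ} (hq : q ∉ L.lattice) (h : v m L q = 0) :
    IsFixedPoint m L q := by
  have hneg : L.derivWeierstrassP q = 0 → (-1) * q - q ∈ L.lattice := fun h => by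
    have := neg_mem (two_mul_mem_of_derivWeierstrassP_eq_zero L hq h)
    convert this using 1; ring
  rcases hm with rfl | rfl | rfl | rfl
  · refine ⟨1, le_rfl, by norm_num, ?_⟩
    rw [root_two, pow_one]
    exact hneg (by simpa [v] using h)
  · refine ⟨1, le_rfl, by norm_num, ?_⟩
    rw [root_three, pow_one]
    exact root_six_sq_fixed (Or.inl rfl) hL hq (by simpa [v] using h)
  · refine ⟨2, by norm_num, by norm_num, ?_⟩
    rw [root_four, Complex.I_sq]
    exact hneg (by simpa [v] using h)
  · simp only [v, div_eq_zero_iff, mul_eq_zero, OfNat.ofNat_ne_zero, or_false] at h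
    rcases h with h | h
    · exact ⟨2, by norm_num, by norm_num, root_six_sq_fixed (Or.inr rfl) hL hq h⟩
    · refine ⟨3, by norm_num, by norm_num, ?_⟩
      have h3 : root 6 ^ 3 = -1 := by linear_combination (root 6 + 1) * root_six_sq
      rw [h3]
      exact hneg h

lemma not_isFixedPoint_iff (hm : m = 2 ∨ m = 3 ∨ m = 4 ∨ m = 6)
    (hL : IsSymmetricLattice m L) {q : ℂ} :
    ¬ IsFixedPoint m L q ↔ q ∉ L.lattice ∧ v m L q ≠ 0 :=
  ⟨fun h => ⟨fun h' => h (isFixedPoint_of_mem hm hL h'), fun h0 =>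
    h (isFixedPoint_of_v_eq_zero hm hL (fun h' => h (isFixedPoint_of_mem hm hL h')) h0)⟩,
    fun h h' => h.2 (v_eq_zero_of_isFixedPoint hm hL h')⟩

lemma v_pow_eq (hm : m = 2 ∨ m = 3 ∨ m = 4 ∨ m = 6) (hL : IsSymmetricLattice m L) {q : ℂ}
    (hq : q ∉ L.lattice) : v m L q ^ m = tableP m L (u m L q) := by
  have h := L.derivWeierstrassP_sq q hq
  rcases hm with rfl | rfl | rfl | rfl
  · simp only [u, v, tableP]; linear_combination h / 4
  · rw [hex_g₂ (preserves_root_six (Or.inl rfl) hL)] at h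
    simp only [u, v, tableP]; linear_combination -h / 4
  · rw [square_g₃ hL] at h
    simp only [u, v, tableP]
    rw [show (L.derivWeierstrassP q / 2) ^ 4 = (L.derivWeierstrassP q ^ 2) ^ 2 / 16 by ring, h]
    ring
  · rw [hex_g₂ (preserves_root_six (Or.inr rfl) hL)] at h
    simp only [u, v, tableP]
    rw [show (L.weierstrassP q * L.derivWeierstrassP q / 2) ^ 6 =
      L.weierstrassP q ^ 6 * (L.derivWeierstrassP q ^ 2) ^ 3 / 64 by ring, h]
    ring

/-- This follows from the surjectivity of ℘ by extracting a root. For m = 3 the choice of ℘(q) fixes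
℘'(q)/2 up to sign, and the sign is adjusted by replacing q with -q. -/
lemma exists_u_eq (hm : m = 2 ∨ m = 3 ∨ m = 4 ∨ m = 6) (hL : IsSymmetricLattice m L) (t : ℂ) :
    ∃ q, q ∉ L.lattice ∧ u m L q = t := by
  rcases hm with rfl | rfl | rfl | rfl
  · exact exists_weierstrassP_eq L t
  · obtain ⟨s, hs⟩ := IsAlgClosed.exists_pow_nat_eq (t ^ 2 + L.g₃ / 4) (n := 3) (by norm_num)
    obtain ⟨q, hq, hq'⟩ := exists_weierstrassP_eq L s
    have h := L.derivWeierstrassP_sq q hq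
    rw [hex_g₂ (preserves_root_six (Or.inl rfl) hL), hq', hs] at h
    have h1 : (L.derivWeierstrassP q / 2 - t) * (L.derivWeierstrassP q / 2 + t) = 0 := by
      linear_combination h / 4
    rcases mul_eq_zero.1 h1 with h2 | h2
    · exact ⟨q, hq, sub_eq_zero.1 h2⟩
    · refine ⟨-q, by simpa using hq, ?_⟩
      simp only [u, L.derivWeierstrassP_neg]
      linear_combination -h2
  · obtain ⟨s, hs⟩ := IsAlgClosed.exists_pow_nat_eq t (n := 2) (by norm_num)
    obtain ⟨q, hq, hq'⟩ := exists_weierstrassP_eq L s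
    exact ⟨q, hq, by simp only [u, hq', hs]⟩
  · obtain ⟨s, hs⟩ := IsAlgClosed.exists_pow_nat_eq t (n := 3) (by norm_num)
    obtain ⟨q, hq, hq'⟩ := exists_weierstrassP_eq L s
    exact ⟨q, hq, by simp only [u, hq', hs]⟩

/-! ### The branch points -/

/-- The `e_i` for each `m`. -/
lemma e_two (L : PeriodPair) : e 2 L = (![L.weierstrassP (L.ω₁ / 2), L.weierstrassP (L.ω₂ / 2),
    L.weierstrassP ((L.ω₁ + L.ω₂) / 2)] : Fin 3 → ℂ) := by
  funext i
  change Fin 3 at i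
  fin_cases i <;> rfl

lemma e_three (L : PeriodPair) : e 3 L = (![L.derivWeierstrassP ((L.ω₁ + L.ω₂) / 3) / 2,
    -(L.derivWeierstrassP ((L.ω₁ + L.ω₂) / 3) / 2)] : Fin 2 → ℂ) := by
  funext i
  change Fin 2 at i
  fin_cases i
  · rfl
  · change L.derivWeierstrassP (2 * ((L.ω₁ + L.ω₂) / 3)) / 2 = _
    rw [derivWeierstrassP_two_eta]
    simp [neg_div]

lemma e_three_sq (hL : IsSymmetricLattice 3 L) :
    (L.derivWeierstrassP ((L.ω₁ + L.ω₂) / 3) / 2) ^ 2 = -L.g₃ / 4 := by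
  have h := L.derivWeierstrassP_sq _ (eta_notMem (L := L))
  rw [weierstrassP_eta (Or.inl rfl) hL] at h
  linear_combination h / 4

lemma half_sq_of_square (hL : IsSymmetricLattice 4 L) :
    L.weierstrassP (L.ω₁ / 2) ^ 2 = L.g₂ / 4 := by
  have h := (cubic_symm L).2.1
  rw [weierstrassP_omega_three hL, weierstrassP_omega_two hL] at h
  linear_combination -h

lemma half_cube_of_hex (hm : m = 3 ∨ m = 6) (hL : IsSymmetricLattice m L) :
    L.weierstrassP (L.ω₁ / 2) ^ 3 = L.g₃ / 4 := by
  obtain ⟨⟨h1, -, -⟩, k1, -, -⟩ := half_facts L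
  have h := cubic_root L h1 k1
  rw [hex_g₂ (preserves_root_six hm hL)] at h
  linear_combination h / 4

/-- If g₃ = 0, the cubic would be 4t³, whereas ℘ takes distinct values at the half-periods. -/
lemma g₃_ne_zero_of_hex (hm : m = 3 ∨ m = 6) (hL : IsSymmetricLattice m L) : L.g₃ ≠ 0 := by
  intro h0
  obtain ⟨⟨h1, h2, -⟩, k1, k2, -⟩ := half_facts L
  have r1 := cubic_root L h1 k1
  have r2 := cubic_root L h2 k2
  rw [hex_g₂ (preserves_root_six hm hL), h0] at r1 r2
  refine (weierstrassP_half_ne L).1 ?_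
  rw [eq_zero_of_pow_eq_zero (n := 3) (x := L.weierstrassP (L.ω₁ / 2)) (by linear_combination r1 / 4),
    eq_zero_of_pow_eq_zero (n := 3) (x := L.weierstrassP (L.ω₂ / 2)) (by linear_combination r2 / 4)]

lemma g₂_ne_zero_of_square (hL : IsSymmetricLattice 4 L) : L.g₂ ≠ 0 := by
  intro h0
  have h := half_sq_of_square hL
  have h1 : L.weierstrassP (L.ω₁ / 2) = 0 := eq_zero_of_pow_eq_zero (n := 2) (by rw [h, h0]; simp)
  refine (weierstrassP_half_ne L).1 ?_
  rw [weierstrassP_omega_two hL, h1, neg_zero]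

lemma e_four (hL : IsSymmetricLattice 4 L) : e 4 L = (![0, L.g₂ / 4] : Fin 2 → ℂ) := by
  funext i
  change Fin 2 at i
  fin_cases i
  · change L.weierstrassP ((L.ω₁ + L.ω₂) / 2) ^ 2 = _
    rw [weierstrassP_omega_three hL]; simp
  · exact half_sq_of_square hL

lemma e_six (hL : IsSymmetricLattice 6 L) : e 6 L = (![0, L.g₃ / 4] : Fin 2 → ℂ) := by
  funext i
  change Fin 2 at i
  fin_cases i
  · change L.weierstrassP ((L.ω₁ + L.ω₂) / 3) ^ 3 = _
    rw [weierstrassP_eta (Or.inr rfl) hL]; simp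
  · exact half_cube_of_hex (Or.inr rfl) hL

lemma e_injective (hm : m = 2 ∨ m = 3 ∨ m = 4 ∨ m = 6) (hL : IsSymmetricLattice m L) :
    Function.Injective (e m L) := by
  have aux : ∀ a b : ℂ, a ≠ b → Function.Injective (![a, b] : Fin 2 → ℂ) := by
    intro a b hab i j hij
    fin_cases i <;> fin_cases j <;> simp_all [eq_comm]
  rcases hm with rfl | rfl | rfl | rfl
  · rw [e_two]
    obtain ⟨n1, n2, n3⟩ := weierstrassP_half_ne L
    have : Function.Injective (![L.weierstrassP (L.ω₁ / 2), L.weierstrassP (L.ω₂ / 2),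
      L.weierstrassP ((L.ω₁ + L.ω₂) / 2)] : Fin 3 → ℂ) := by
      intro i j hij
      fin_cases i <;> fin_cases j <;> simp_all [eq_comm]
    exact this
  · rw [e_three]
    refine aux _ _ fun h => g₃_ne_zero_of_hex (Or.inl rfl) hL ?_
    have h1 := e_three_sq hL
    have h2 : L.derivWeierstrassP ((L.ω₁ + L.ω₂) / 3) / 2 = 0 := CharZero.eq_neg_self_iff.1 h
    rw [h2] at h1
    linear_combination 4 * h1
  · rw [e_four hL]
    exact aux _ _ (div_ne_zero (g₂_ne_zero_of_square hL) (by norm_num)).symm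
  · rw [e_six hL]
    exact aux _ _ (div_ne_zero (g₃_ne_zero_of_hex (Or.inr rfl) hL) (by norm_num)).symm

lemma prod_sub_e_pow (hm : m = 2 ∨ m = 3 ∨ m = 4 ∨ m = 6) (hL : IsSymmetricLattice m L) (t : ℂ) :
    ∏ i, (t - e m L i) ^ mult m i = tableP m L t := by
  rcases hm with rfl | rfl | rfl | rfl
  · rw [e_two]
    refine (Fin.prod_univ_three (M := ℂ) _).trans ?_
    change (t - _) ^ 1 * (t - _) ^ 1 * (t - _) ^ 1 = t ^ 3 - L.g₂ / 4 * t - L.g₃ / 4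
    simp only [Matrix.cons_val_zero, Matrix.cons_val_one, Matrix.cons_val]
    linear_combination (-1 / 4) * cubic_factor L t
  · rw [e_three]
    refine (Fin.prod_univ_two (M := ℂ) _).trans ?_
    change (t - _) ^ 1 * (t - _) ^ 1 = t ^ 2 + L.g₃ / 4
    simp only [Matrix.cons_val_zero, Matrix.cons_val_one]
    linear_combination -e_three_sq hL
  · rw [e_four hL]
    refine (Fin.prod_univ_two (M := ℂ) _).trans ?_
    change (t - 0) ^ 1 * (t - _) ^ 2 = t * (t - L.g₂ / 4) ^ 2
    simp
  · rw [e_six hL]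
    refine (Fin.prod_univ_two (M := ℂ) _).trans ?_
    change (t - 0) ^ 2 * (t - _) ^ 3 = t ^ 2 * (t - L.g₃ / 4) ^ 3
    simp

/-! ### Linear masses -/

lemma Couplings.mu_congr (c : Couplings m L) {x y : ℂ} (h : x - y ∈ L.lattice) (j : ℕ) :
    c.mu j x = c.mu j y := by
  unfold Couplings.mu
  refine Finset.sum_congr rfl fun l _ => ?_
  rw [← c.periodic l y _ h, add_sub_cancel]

lemma Couplings.mu_root (c : Couplings m L) (x : ℂ) (j : ℕ) :
    c.mu j (root m * x) = c.mu j x := by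
  unfold Couplings.mu
  exact Finset.sum_congr rfl fun l _ => by rw [c.invariant]

/-- The points ω₁ and ω₂ = iω₁ form one orbit, so the coupling data agree there. Orbits of size n_i
are the source of the factors n_i. -/
lemma Couplings.mu_four (hL : IsSymmetricLattice 4 L) (c : Couplings 4 L) (j : ℕ) :
    c.mu j (L.ω₂ / 2) = c.mu j (L.ω₁ / 2) := by
  rw [← c.mu_root (L.ω₁ / 2), root_four, square_omega hL]
  congr 1; ring

lemma Couplings.mu_six (hL : IsSymmetricLattice 6 L) (c : Couplings 6 L) (j : ℕ) :
    c.mu j (L.ω₂ / 2) = c.mu j (L.ω₁ / 2) ∧ c.mu j ((L.ω₁ + L.ω₂) / 2) = c.mu j (L.ω₁ / 2) ∧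
      c.mu j (2 * ((L.ω₁ + L.ω₂) / 3)) = c.mu j ((L.ω₁ + L.ω₂) / 3) := by
  have h1 : c.mu j (L.ω₂ / 2) = c.mu j (L.ω₁ / 2) := by
    rw [← c.mu_root (L.ω₁ / 2), hex_omega (Or.inr rfl) hL]
    congr 1; ring
  refine ⟨h1, ?_, ?_⟩
  · rw [← h1, ← c.mu_root (L.ω₂ / 2)]
    refine c.mu_congr (PeriodPair.mem_lattice.2 ⟨1, 0, ?_⟩) j
    rw [hex_omega (Or.inr rfl) hL]; push_cast
    linear_combination (L.ω₁ / 2) * root_six_sq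
  · rw [← c.mu_root ((L.ω₁ + L.ω₂) / 3)]
    refine c.mu_congr ?_ j
    convert sub_mem (three_eta_mem (L := L)) (root_six_mul_eta (Or.inr rfl) hL) using 1
    ring

/-- `∑_j ω^{-jl} = 0`. -/
lemma Couplings.sum_mu (hm : m ≠ 0) (c : Couplings m L) (x : ℂ) :
    ∑ j ∈ Finset.range m, c.mu j x = 0 := by
  unfold Couplings.mu
  rw [Finset.sum_comm]
  refine Finset.sum_eq_zero fun l hl => ?_
  rw [← Finset.sum_mul]
  have hp : IsPrimitiveRoot (root m)⁻¹ m := (Complex.isPrimitiveRoot_exp m hm).inv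
  rw [Finset.mem_Ico] at hl
  have h1 : (root m)⁻¹ ^ l ≠ 1 := hp.pow_ne_one_of_pos_of_lt (by omega) hl.2
  have h2 : ∑ j ∈ Finset.range m, (root m)⁻¹ ^ (j * l) = 0 := by
    have h3 := mul_neg_geom_sum ((root m)⁻¹ ^ l) m
    simp only [← pow_mul] at h3
    rw [mul_comm l m, pow_mul, hp.pow_eq_one, one_pow, sub_self] at h3
    rcases mul_eq_zero.1 h3 with h | h
    · exact absurd (sub_eq_zero.1 h).symm h1
    · rw [← h]; exact Finset.sum_congr rfl fun j _ => by rw [mul_comm]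
  rw [h2, zero_mul]

lemma mult_mul_stabOrder (hm : m = 2 ∨ m = 3 ∨ m = 4 ∨ m = 6) (i : Fin (numBranch m)) :
    mult m i * stabOrder m i = m := by
  rcases hm with rfl | rfl | rfl | rfl
  · change Fin 3 at i; fin_cases i <;> rfl
  · change Fin 2 at i; fin_cases i <;> rfl
  · change Fin 2 at i; fin_cases i <;> rfl
  · change Fin 2 at i; fin_cases i <;> rfl

lemma mult_pos (hm : m = 2 ∨ m = 3 ∨ m = 4 ∨ m = 6) (i : Fin (numBranch m)) : 0 < mult m i := by
  have := mult_mul_stabOrder hm i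
  exact Nat.pos_of_ne_zero fun h => by rw [h, zero_mul] at this; omega

lemma stabOrder_pos (hm : m = 2 ∨ m = 3 ∨ m = 4 ∨ m = 6) (i : Fin (numBranch m)) :
    0 < stabOrder m i := by
  have := mult_mul_stabOrder hm i
  exact Nat.pos_of_ne_zero fun h => by rw [h, mul_zero] at this; omega

/-- Degree count for P: the summand 1 comes from the factor w, the others from the forms x - e_i w.
-/
lemma sum_mult (hm : m = 2 ∨ m = 3 ∨ m = 4 ∨ m = 6) :
    ∑ i, mult m i + 1 = yWeight m * m := by
  rcases hm with rfl | rfl | rfl | rfl <;> decide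

lemma numBranch_eq (hm : m = 2 ∨ m = 3 ∨ m = 4 ∨ m = 6) : numBranch m = yWeight m + 1 := by
  rcases hm with rfl | rfl | rfl | rfl <;> rfl

/-- A point of `E` fixed by `s^l` only if `n ∣ l` has masses periodic with period `m / n`. -/
lemma Couplings.mu_add_stabOrder (hm : m = 2 ∨ m = 3 ∨ m = 4 ∨ m = 6)
    (hL : IsSymmetricLattice m L) (c : Couplings m L) (i : Fin (numBranch m)) (j : ℕ) :
    c.mu (j + stabOrder m i) (branchPt m L i) = c.mu j (branchPt m L i) := by
  unfold Couplings.mu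
  refine Finset.sum_congr rfl fun l hl => ?_
  rw [Finset.mem_Ico] at hl
  have hr : (root m)⁻¹ ^ m = 1 := by rw [inv_pow, root_pow m (by omega), inv_one]
  -- If n_i divides l, shifting j by m_i changes the exponent by a multiple of m. Otherwise s^l does
  -- not fix x_i, so the coupling vanishes; a fixed point would put one of the special points into
  -- the lattice.
  by_cases hd : mult m i ∣ l
  · congr 1
    obtain ⟨k, rfl⟩ := hd
    have h : (j + stabOrder m i) * (mult m i * k) = j * (mult m i * k) + m * k :=
      calc _ = j * (mult m i * k) + mult m i * stabOrder m i * k := by ring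
        _ = _ := by rw [mult_mul_stabOrder hm]
    rw [h, pow_add, pow_mul _ m, hr, one_pow, mul_one]
  · rw [c.vanish l, mul_zero, mul_zero]
    intro hmem
    rcases hm with rfl | rfl | rfl | rfl
    · change Fin 3 at i
      fin_cases i <;> exact hd (one_dvd _)
    · change Fin 2 at i
      fin_cases i <;> exact hd (one_dvd _)
    · change Fin 2 at i
      fin_cases i
      · exact hd (one_dvd _)
      · change root 4 ^ l * (L.ω₁ / 2) - L.ω₁ / 2 ∈ L.lattice at hmem
        change ¬ 2 ∣ l at hd
        obtain ⟨⟨-, -, h3⟩, k1, -, -⟩ := half_facts L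
        rw [root_four] at hmem
        have hl' : l = 1 ∨ l = 3 := by omega
        rcases hl' with rfl | rfl
        · refine h3 ?_
          convert add_mem hmem k1 using 1
          rw [square_omega hL]; ring
        · refine h3 ?_
          convert neg_mem hmem using 1
          rw [square_omega hL, show Complex.I ^ 3 = -Complex.I by
            rw [pow_succ, Complex.I_sq]; ring]; ring
    · have hh := hex_omega (Or.inr rfl) hL
      change Fin 2 at i
      fin_cases i
      · change root 6 ^ l * ((L.ω₁ + L.ω₂) / 3) - (L.ω₁ + L.ω₂) / 3 ∈ L.lattice at hmem
        change ¬ 2 ∣ l at hd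
        have he := eta_notMem (L := L)
        have h3 := three_eta_mem (L := L)
        have hs := root_six_mul_eta (Or.inr rfl) hL
        set a := (L.ω₁ + L.ω₂) / 3
        have hodd : root 6 ^ l * a + a ∈ L.lattice := by
          have hl' : l = 1 ∨ l = 3 ∨ l = 5 := by omega
          have hr3 : root 6 ^ 3 = -1 := by linear_combination (root 6 + 1) * root_six_sq
          rcases hl' with rfl | rfl | rfl
          · simpa using hs
          · rw [hr3]; simp
          · have : root 6 ^ 5 = 1 - root 6 := by
              rw [show root 6 ^ 5 = root 6 ^ 3 * root 6 ^ 2 by ring, hr3, root_six_sq]; ring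
            rw [this]
            convert sub_mem h3 hs using 1
            ring
        refine he ?_
        convert sub_mem h3 (sub_mem hodd hmem) using 1
        ring
      · change root 6 ^ l * (L.ω₁ / 2) - L.ω₁ / 2 ∈ L.lattice at hmem
        change ¬ 3 ∣ l at hd
        obtain ⟨⟨h1, h2, h3⟩, k1, -, -⟩ := half_facts L
        have hl' : l = 1 ∨ l = 2 ∨ l = 4 ∨ l = 5 := by omega
        have h3 : root 6 ^ 3 = -1 := by linear_combination (root 6 + 1) * root_six_sq
        have h4 : root 6 ^ 4 = -root 6 := by linear_combination root 6 * h3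
        have h5 : root 6 ^ 5 = 1 - root 6 := by
          linear_combination root 6 ^ 2 * h3 - root_six_sq
        rcases hl' with rfl | rfl | rfl | rfl
        · refine ‹(L.ω₁ + L.ω₂) / 2 ∉ L.lattice› ?_
          convert add_mem hmem k1 using 1
          rw [hh]; ring
        · refine h2 ?_
          rw [root_six_sq] at hmem
          convert add_mem hmem k1 using 1
          rw [hh]; ring
        · refine ‹(L.ω₁ + L.ω₂) / 2 ∉ L.lattice› ?_
          rw [h4] at hmem
          convert neg_mem hmem using 1
          rw [hh]; ring
        · refine h2 ?_
          rw [h5] at hmem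
          convert neg_mem hmem using 1
          rw [hh]; ring

/-! ### The coefficients of the pencil -/

/-- The linear form `x - e_i w`. -/
def lineForm (m : ℕ) (L : PeriodPair) (i : Fin (numBranch m)) : MvPolynomial (Fin 2) ℂ :=
  MvPolynomial.X 0 - MvPolynomial.C (e m L i) * MvPolynomial.X 1

/-- The form `A_j` with `v f_j = A_j(u, 1)`. -/
def Couplings.aForm (c : Couplings m L) (j : ℕ) : MvPolynomial (Fin 2) ℂ :=
  ∑ i, MvPolynomial.C (mult m i * c.mu j (branchPt m L i)) *
    ∏ k ∈ Finset.univ.erase i, lineForm m L k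

/-- The last zero of the form of `v^m ℘^{(m-2)}`. -/
def lastZero (m : ℕ) (L : PeriodPair) : ℂ :=
  match m with
  -- For m = 4, u = ℘² and ℘'' = 6(u - g₂/12). For m = 6, g₂ = 0, u = ℘³ and ℘'''' = 120(u - g₃/10).
  -- For m = 2 and 3 the derivatives are u and 2u.
  | 4 => L.g₂ / 12
  | 6 => L.g₃ / 10
  | _ => 0

/-- The form `B_k` with `v^k ℘^{(k-2)} = B_k(u, 1)`, for `2 ≤ k ≤ m`. -/
def bForm (m : ℕ) (L : PeriodPair) (k : ℕ) : MvPolynomial (Fin 2) ℂ :=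
  MvPolynomial.C ((k - 1).factorial : ℂ) *
    -- With floor division the exponent equals ⌈k/m_i⌉. It complements the ⌊(m-k)/m_i⌋ factors
    -- guaranteed to vanish at a base point among the y - A_j with j < m - k.
    (∏ i, lineForm m L i ^ (mult m i - (m - k) / stabOrder m i)) *
      if k = m then MvPolynomial.X 0 - MvPolynomial.C (lastZero m L) * MvPolynomial.X 1 else 1

@[simp] lemma eval_lineForm (i : Fin (numBranch m)) (a : Fin 2 → ℂ) :
    MvPolynomial.eval a (lineForm m L i) = a 0 - e m L i * a 1 := by
  simp [lineForm]

lemma Couplings.eval_aForm (c : Couplings m L) (j : ℕ) (a : Fin 2 → ℂ) :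
    MvPolynomial.eval a (c.aForm j) = ∑ i, mult m i * c.mu j (branchPt m L i) *
      ∏ k ∈ Finset.univ.erase i, (a 0 - e m L k * a 1) := by
  simp [aForm, map_sum, map_prod]

lemma eval_bForm (k : ℕ) (a : Fin 2 → ℂ) :
    MvPolynomial.eval a (bForm m L k) = ((k - 1).factorial : ℂ) *
      (∏ i, (a 0 - e m L i * a 1) ^ (mult m i - (m - k) / stabOrder m i)) *
        if k = m then a 0 - lastZero m L * a 1 else 1 := by
  simp only [bForm, map_mul, map_prod, map_pow, eval_lineForm, MvPolynomial.eval_C]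
  split_ifs <;> simp

lemma erase_fin_two : (Finset.univ.erase (0 : Fin 2) = {1}) ∧ (Finset.univ.erase (1 : Fin 2) = {0}) :=
  by decide

lemma erase_fin_three : (Finset.univ.erase (0 : Fin 3) = {1, 2}) ∧
    (Finset.univ.erase (1 : Fin 3) = {0, 2}) ∧ (Finset.univ.erase (2 : Fin 3) = {0, 1}) := by decide

/-- The set 𝒮 is the disjoint union of the orbits of the x_i, of sizes n_i, and the masses are
constant on orbits. -/
lemma Couplings.muTotal_eq (hm : m = 2 ∨ m = 3 ∨ m = 4 ∨ m = 6) (hL : IsSymmetricLattice m L)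
    (c : Couplings m L) (j : ℕ) :
    c.muTotal j = ∑ i, mult m i * c.mu j (branchPt m L i) := by
  rcases hm with rfl | rfl | rfl | rfl
  · refine Eq.trans ?_ (Fin.sum_univ_three (M := ℂ) _).symm
    change _ = ((1 : ℕ) : ℂ) * c.mu j (L.ω₁ / 2) + ((1 : ℕ) : ℂ) * c.mu j (L.ω₂ / 2) +
      ((1 : ℕ) : ℂ) * c.mu j ((L.ω₁ + L.ω₂) / 2)
    simp [muTotal, nonzeroFixedPoints, add_assoc]
  · refine Eq.trans ?_ (Fin.sum_univ_two (M := ℂ) _).symm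
    change _ = ((1 : ℕ) : ℂ) * c.mu j ((L.ω₁ + L.ω₂) / 3) +
      ((1 : ℕ) : ℂ) * c.mu j (2 * ((L.ω₁ + L.ω₂) / 3))
    simp [muTotal, nonzeroFixedPoints]
  · refine Eq.trans ?_ (Fin.sum_univ_two (M := ℂ) _).symm
    change _ = ((1 : ℕ) : ℂ) * c.mu j ((L.ω₁ + L.ω₂) / 2) + ((2 : ℕ) : ℂ) * c.mu j (L.ω₁ / 2)
    simp [muTotal, nonzeroFixedPoints, c.mu_four hL]
    ring
  · refine Eq.trans ?_ (Fin.sum_univ_two (M := ℂ) _).symm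
    change _ = ((2 : ℕ) : ℂ) * c.mu j ((L.ω₁ + L.ω₂) / 3) + ((3 : ℕ) : ℂ) * c.mu j (L.ω₁ / 2)
    simp [muTotal, nonzeroFixedPoints, c.mu_six hL]
    ring

/-- `½℘' f(q, a)` for half-periods `a, b, c`. -/
lemma half_mul_kernelF {q a : ℂ} {B C : ℂ}
    (ha : L.derivWeierstrassP a = 0) (h0 : L.derivWeierstrassP q ≠ 0)
    (h : L.derivWeierstrassP q ^ 2 = 4 * ((L.weierstrassP q - L.weierstrassP a) * B * C)) :
    L.derivWeierstrassP q / 2 * kernelF L q a = B * C := by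
  have hne : L.weierstrassP q - L.weierstrassP a ≠ 0 := fun h1 => by
    rw [h1] at h
    exact h0 (eq_zero_of_pow_eq_zero (n := 2) (by rw [h]; ring))
  rw [kernelF, ha, add_zero]
  field_simp
  linear_combination h

lemma half_mul_kernelF_half {q : ℂ} (hq : q ∉ L.lattice) (h0 : L.derivWeierstrassP q ≠ 0) :
    L.derivWeierstrassP q / 2 * kernelF L q (L.ω₁ / 2) =
      (L.weierstrassP q - L.weierstrassP (L.ω₂ / 2)) *
        (L.weierstrassP q - L.weierstrassP ((L.ω₁ + L.ω₂) / 2)) ∧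
    L.derivWeierstrassP q / 2 * kernelF L q (L.ω₂ / 2) =
      (L.weierstrassP q - L.weierstrassP (L.ω₁ / 2)) *
        (L.weierstrassP q - L.weierstrassP ((L.ω₁ + L.ω₂) / 2)) ∧
    L.derivWeierstrassP q / 2 * kernelF L q ((L.ω₁ + L.ω₂) / 2) =
      (L.weierstrassP q - L.weierstrassP (L.ω₁ / 2)) *
        (L.weierstrassP q - L.weierstrassP (L.ω₂ / 2)) := by
  obtain ⟨-, k1, k2, k3⟩ := half_facts L
  have h := derivWeierstrassP_sq_factor L hq
  refine ⟨half_mul_kernelF (derivWeierstrassP_eq_zero_of_two_mul_mem L k1) h0 ?_,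
    half_mul_kernelF (derivWeierstrassP_eq_zero_of_two_mul_mem L k2) h0 ?_,
    half_mul_kernelF (derivWeierstrassP_eq_zero_of_two_mul_mem L k3) h0 ?_⟩
  · rw [h]
  · rw [h]; ring
  · rw [h]; ring

/-- At a half-period a, ℘'(a) = 0, and the factorisation of ℘'² turns ½℘' f(q, a) into the product
of the two other factors. Summing over an orbit gives n_i times the product of the forms x - e_k w
with k ≠ i, at (u, 1). -/
lemma Couplings.v_mul_f (hm : m = 2 ∨ m = 3 ∨ m = 4 ∨ m = 6) (hL : IsSymmetricLattice m L)
    (c : Couplings m L) (j : ℕ) {q : ℂ} (hq : ¬ IsFixedPoint m L q) :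
    v m L q * c.f j q = MvPolynomial.eval ![u m L q, 1] (c.aForm j) := by
  obtain ⟨hq', hv⟩ := (not_isFixedPoint_iff hm hL).1 hq
  rw [eval_aForm]
  rcases hm with rfl | rfl | rfl | rfl
  · refine Eq.trans ?_ (Fin.sum_univ_three (M := ℂ) _).symm
    rw [e_two]
    change _ = ((1 : ℕ) : ℂ) * c.mu j (L.ω₁ / 2) * (∏ k ∈ Finset.univ.erase (0 : Fin 3), _) +
      ((1 : ℕ) : ℂ) * c.mu j (L.ω₂ / 2) * (∏ k ∈ Finset.univ.erase (1 : Fin 3), _) +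
      ((1 : ℕ) : ℂ) * c.mu j ((L.ω₁ + L.ω₂) / 2) * (∏ k ∈ Finset.univ.erase (2 : Fin 3), _)
    rw [erase_fin_three.1, erase_fin_three.2.1, erase_fin_three.2.2]
    have h0 : L.derivWeierstrassP q ≠ 0 := fun h => hv (by simp [v, h])
    obtain ⟨h1, h2, h3⟩ := half_mul_kernelF_half hq' h0
    rw [Finset.prod_pair (by decide), Finset.prod_pair (by decide), Finset.prod_pair (by decide)]
    simp [Couplings.f, nonzeroFixedPoints, v, u]
    linear_combination c.mu j (L.ω₁ / 2) * h1 + c.mu j (L.ω₂ / 2) * h2 +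
      c.mu j ((L.ω₁ + L.ω₂) / 2) * h3
  · refine Eq.trans ?_ (Fin.sum_univ_two (M := ℂ) _).symm
    rw [e_three]
    change _ = ((1 : ℕ) : ℂ) * c.mu j ((L.ω₁ + L.ω₂) / 3) *
        (∏ k ∈ Finset.univ.erase (0 : Fin 2), _) +
      ((1 : ℕ) : ℂ) * c.mu j (2 * ((L.ω₁ + L.ω₂) / 3)) * (∏ k ∈ Finset.univ.erase (1 : Fin 2), _)
    rw [erase_fin_two.1, erase_fin_two.2]
    simp only [v] at hv
    simp [Couplings.f, nonzeroFixedPoints, v, u, kernelF, weierstrassP_eta (Or.inl rfl) hL,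
      weierstrassP_two_eta (Or.inl rfl) hL, derivWeierstrassP_two_eta]
    field_simp
    ring
  · refine Eq.trans ?_ (Fin.sum_univ_two (M := ℂ) _).symm
    rw [e_four hL]
    change _ = ((1 : ℕ) : ℂ) * c.mu j ((L.ω₁ + L.ω₂) / 2) *
        (∏ k ∈ Finset.univ.erase (0 : Fin 2), _) +
      ((2 : ℕ) : ℂ) * c.mu j (L.ω₁ / 2) * (∏ k ∈ Finset.univ.erase (1 : Fin 2), _)
    rw [erase_fin_two.1, erase_fin_two.2]
    have h0 : L.derivWeierstrassP q ≠ 0 := fun h => hv (by simp [v, h])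
    obtain ⟨h1, h2, h3⟩ := half_mul_kernelF_half hq' h0
    rw [weierstrassP_omega_three hL, weierstrassP_omega_two hL] at *
    have hs := half_sq_of_square hL
    simp [Couplings.f, nonzeroFixedPoints, v, u, c.mu_four hL]
    linear_combination c.mu j (L.ω₁ / 2) * h1 + c.mu j (L.ω₁ / 2) * h2 +
      c.mu j ((L.ω₁ + L.ω₂) / 2) * (h3 - hs)
  · refine Eq.trans ?_ (Fin.sum_univ_two (M := ℂ) _).symm
    rw [e_six hL]
    change _ = ((2 : ℕ) : ℂ) * c.mu j ((L.ω₁ + L.ω₂) / 3) *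
        (∏ k ∈ Finset.univ.erase (0 : Fin 2), _) +
      ((3 : ℕ) : ℂ) * c.mu j (L.ω₁ / 2) * (∏ k ∈ Finset.univ.erase (1 : Fin 2), _)
    rw [erase_fin_two.1, erase_fin_two.2]
    have h0 : L.derivWeierstrassP q ≠ 0 := fun h => hv (by simp [v, h])
    have hp0 : L.weierstrassP q ≠ 0 := fun h => hv (by simp [v, h])
    obtain ⟨h1, h2, h3⟩ := half_mul_kernelF_half hq' h0
    obtain ⟨s1, s2, -⟩ := cubic_symm L
    have hsq := L.derivWeierstrassP_sq q hq'
    rw [hex_g₂ (preserves_root_six (Or.inr rfl) hL)] at s2 hsq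
    -- The values ℘'(η₁) and ℘'(η₂) are opposite, so the two kernels add up to ℘'/℘, and ½℘'² is a
    -- polynomial in ℘³.
    have heta : L.derivWeierstrassP q / 2 * L.weierstrassP q *
        (kernelF L q ((L.ω₁ + L.ω₂) / 3) + kernelF L q (2 * ((L.ω₁ + L.ω₂) / 3))) =
        2 * (L.weierstrassP q ^ 3 - L.g₃ / 4) := by
      simp only [kernelF, weierstrassP_eta (Or.inr rfl) hL, weierstrassP_two_eta (Or.inr rfl) hL,
        derivWeierstrassP_two_eta]
      field_simp
      linear_combination 8 * L.weierstrassP q * hsq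
    simp [Couplings.f, nonzeroFixedPoints, v, u, c.mu_six hL]
    linear_combination c.mu j (L.ω₁ / 2) * L.weierstrassP q * (h1 + h2 + h3) +
      c.mu j ((L.ω₁ + L.ω₂) / 3) * heta -
      c.mu j (L.ω₁ / 2) * L.weierstrassP q * (2 * L.weierstrassP q * s1 - s2)

/-- The weights k and -k cancel, so the left side is invariant. In each case the equation for ℘'²
removes the remaining powers of ℘' and leaves a polynomial in u. -/
lemma v_pow_mul_iteratedDeriv (hm : m = 2 ∨ m = 3 ∨ m = 4 ∨ m = 6) (hL : IsSymmetricLattice m L)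
    {q : ℂ} (hq : q ∉ L.lattice) (i : ℕ) (hi : i + 2 ≤ m) :
    v m L q ^ (i + 2) * iteratedDeriv i L.weierstrassP q =
      MvPolynomial.eval ![u m L q, 1] (bForm m L (i + 2)) := by
  obtain ⟨i0, i1, i2, i3, i4⟩ := iteratedDeriv_weierstrassP L hq
  have hsq := L.derivWeierstrassP_sq q hq
  rw [eval_bForm]
  rcases hm with rfl | rfl | rfl | rfl
  · obtain rfl : i = 0 := by omega
    rw [e_two, i0]
    refine Eq.trans ?_ (congrArg (fun z : ℂ => _ * z * _) (Fin.prod_univ_three (M := ℂ) _).symm)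
    change _ = _ * ((_ ^ 1 * _ ^ 1 * _ ^ 1 : ℂ)) * _
    have h := cubic_factor L (L.weierstrassP q)
    simp [v, u, lastZero]
    left
    linear_combination (hsq + h) / 4
  · rw [hex_g₂ (preserves_root_six (Or.inl rfl) hL)] at *
    have h := e_three_sq hL
    have hi' : i = 0 ∨ i = 1 := by omega
    rw [e_three]
    rcases hi' with rfl | rfl
    · rw [i0]
      refine Eq.trans ?_ (congrArg (fun z : ℂ => _ * z * _) (Fin.prod_univ_two (M := ℂ) _).symm)
      change _ = _ * ((_ ^ 1 * _ ^ 1 : ℂ)) * _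
      simp [v, u]
      linear_combination -1 / 4 * hsq + h
    · rw [i1]
      refine Eq.trans ?_ (congrArg (fun z : ℂ => _ * z * _) (Fin.prod_univ_two (M := ℂ) _).symm)
      change _ = _ * ((_ ^ 1 * _ ^ 1 : ℂ)) * _
      simp [v, u, lastZero]
      linear_combination L.derivWeierstrassP q * (-1 / 4 * hsq + h)
  · rw [square_g₃ hL] at *
    have hi' : i = 0 ∨ i = 1 ∨ i = 2 := by omega
    have hv : v 4 L q ^ 2 = L.weierstrassP q ^ 3 - L.g₂ / 4 * L.weierstrassP q := by
      simp only [v]; linear_combination hsq / 4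
    rw [e_four hL]
    rcases hi' with rfl | rfl | rfl
    · rw [i0]
      refine Eq.trans ?_ (congrArg (fun z : ℂ => _ * z * _) (Fin.prod_univ_two (M := ℂ) _).symm)
      change _ = _ * ((_ ^ 1 * _ ^ 1 : ℂ)) * _
      simp [u, hv]
      ring
    · rw [i1]
      refine Eq.trans ?_ (congrArg (fun z : ℂ => _ * z * _) (Fin.prod_univ_two (M := ℂ) _).symm)
      change _ = _ * ((_ ^ 1 * _ ^ 2 : ℂ)) * _
      have hv' : L.derivWeierstrassP q = 2 * v 4 L q := by simp only [v]; ring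
      rw [hv']
      simp [u]
      linear_combination 2 * (v 4 L q ^ 2 + L.weierstrassP q ^ 3 - L.g₂ / 4 * L.weierstrassP q) * hv
    · rw [i2]
      refine Eq.trans ?_ (congrArg (fun z : ℂ => _ * z * _) (Fin.prod_univ_two (M := ℂ) _).symm)
      change _ = _ * ((_ ^ 1 * _ ^ 2 : ℂ)) * _
      simp [u, lastZero, Nat.factorial]
      rw [show v 4 L q ^ 4 = (v 4 L q ^ 2) ^ 2 by ring, hv]
      ring
  · rw [hex_g₂ (preserves_root_six (Or.inr rfl) hL)] at *
    have hi' : i = 0 ∨ i = 1 ∨ i = 2 ∨ i = 3 ∨ i = 4 := by omega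
    have hv : v 6 L q = L.weierstrassP q * L.derivWeierstrassP q / 2 := rfl
    rw [e_six hL]
    generalize L.derivWeierstrassP q = y at *
    rcases hi' with rfl | rfl | rfl | rfl | rfl
    · rw [i0]
      refine Eq.trans ?_ (congrArg (fun z : ℂ => _ * z * _) (Fin.prod_univ_two (M := ℂ) _).symm)
      change _ = _ * ((_ ^ 1 * _ ^ 1 : ℂ)) * _
      simp [u, hv]
      linear_combination L.weierstrassP q ^ 3 / 4 * hsq
    · rw [i1]
      refine Eq.trans ?_ (congrArg (fun z : ℂ => _ * z * _) (Fin.prod_univ_two (M := ℂ) _).symm)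
      change _ = _ * ((_ ^ 1 * _ ^ 2 : ℂ)) * _
      simp [u, hv]
      rw [show (L.weierstrassP q * y / 2) ^ 3 * y = L.weierstrassP q ^ 3 / 8 * (y ^ 2) ^ 2 by ring,
        hsq]
      ring
    · rw [i2]
      refine Eq.trans ?_ (congrArg (fun z : ℂ => _ * z * _) (Fin.prod_univ_two (M := ℂ) _).symm)
      change _ = _ * ((_ ^ 2 * _ ^ 2 : ℂ)) * _
      simp [u, hv, Nat.factorial]
      rw [show (L.weierstrassP q * y / 2) ^ 4 = L.weierstrassP q ^ 4 / 16 * (y ^ 2) ^ 2 by ring,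
        hsq]
      ring
    · rw [i3]
      refine Eq.trans ?_ (congrArg (fun z : ℂ => _ * z * _) (Fin.prod_univ_two (M := ℂ) _).symm)
      change _ = _ * ((_ ^ 2 * _ ^ 3 : ℂ)) * _
      simp [u, hv, Nat.factorial]
      rw [show (L.weierstrassP q * y / 2) ^ 5 * (12 * L.weierstrassP q * y) =
        3 * L.weierstrassP q ^ 6 / 8 * (y ^ 2) ^ 3 by ring, hsq]
      ring
    · rw [i4]
      refine Eq.trans ?_ (congrArg (fun z : ℂ => _ * z * _) (Fin.prod_univ_two (M := ℂ) _).symm)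
      change _ = _ * ((_ ^ 2 * _ ^ 3 : ℂ)) * _
      simp [u, hv, lastZero, Nat.factorial]
      rw [show (L.weierstrassP q * y / 2) ^ 6 = L.weierstrassP q ^ 6 / 64 * (y ^ 2) ^ 3 by ring,
        hsq]
      ring

/-! ### Polynomials in `y` with coefficients in `ℂ[x, w]` -/

/-- `ℂ[x, w][y] → ℂ[x, y, w]`. -/
def toPlane : Polynomial (MvPolynomial (Fin 2) ℂ) →+* MvPolynomial (Fin 3) ℂ :=
  Polynomial.eval₂RingHom (MvPolynomial.rename ![0, 2]).toRingHom (MvPolynomial.X 1)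

@[simp] lemma toPlane_X : toPlane Polynomial.X = MvPolynomial.X 1 := by simp [toPlane]

@[simp] lemma toPlane_C (p : MvPolynomial (Fin 2) ℂ) :
    toPlane (Polynomial.C p) = MvPolynomial.rename ![0, 2] p := by simp [toPlane]

lemma eval_rename_zero_two (a : Fin 3 → ℂ) (p : MvPolynomial (Fin 2) ℂ) :
    MvPolynomial.eval a (MvPolynomial.rename ![0, 2] p) = MvPolynomial.eval ![a 0, a 2] p := by
  rw [MvPolynomial.eval_rename]
  congr 2
  funext i
  fin_cases i <;> rfl

lemma eval_toPlane (a : Fin 3 → ℂ) (p : Polynomial (MvPolynomial (Fin 2) ℂ)) :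
    MvPolynomial.eval a (toPlane p) =
      (p.map (MvPolynomial.eval ![a 0, a 2])).eval (a 1) := by
  have : (MvPolynomial.eval a).comp toPlane =
      (Polynomial.evalRingHom (a 1)).comp (Polynomial.mapRingHom (MvPolynomial.eval ![a 0, a 2])) := by
    refine Polynomial.ringHom_ext (fun p => ?_) ?_
    · simp [eval_rename_zero_two]
    · simp
  exact congrArg (fun f => f p) this

/-- The coefficient of `y^k` is homogeneous of degree `d (n - k)`. -/
def IsGraded (d n : ℕ) (p : Polynomial (MvPolynomial (Fin 2) ℂ)) : Prop :=
  ∀ k, (n < k → p.coeff k = 0) ∧ (k ≤ n → (p.coeff k).IsHomogeneous (d * (n - k)))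

lemma IsGraded.one (d : ℕ) : IsGraded d 0 1 := fun k => by
  refine ⟨fun h => ?_, fun h => ?_⟩
  · rw [Polynomial.coeff_one, if_neg (by omega)]
  · obtain rfl : k = 0 := by omega
    simpa using MvPolynomial.isHomogeneous_one (Fin 2) ℂ

lemma IsGraded.add {d n : ℕ} {p q : Polynomial (MvPolynomial (Fin 2) ℂ)} (hp : IsGraded d n p)
    (hq : IsGraded d n q) : IsGraded d n (p + q) := fun k => by
  refine ⟨fun h => ?_, fun h => ?_⟩
  · rw [Polynomial.coeff_add, (hp k).1 h, (hq k).1 h, add_zero]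
  · rw [Polynomial.coeff_add]; exact ((hp k).2 h).add ((hq k).2 h)

lemma IsGraded.sum {d n : ℕ} {ι : Type*} (s : Finset ι)
    (p : ι → Polynomial (MvPolynomial (Fin 2) ℂ)) (h : ∀ i ∈ s, IsGraded d n (p i)) :
    IsGraded d n (∑ i ∈ s, p i) := fun k => by
  rw [Polynomial.finsetSum_coeff]
  exact ⟨fun hk => Finset.sum_eq_zero fun i hi => (h i hi k).1 hk,
    fun hk => MvPolynomial.IsHomogeneous.sum _ _ _ fun i hi => (h i hi k).2 hk⟩

lemma IsGraded.C_mul {d n i : ℕ} {p : Polynomial (MvPolynomial (Fin 2) ℂ)} (hp : IsGraded d n p)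
    {B : MvPolynomial (Fin 2) ℂ} (hB : B.IsHomogeneous (d * i)) :
    IsGraded d (n + i) (Polynomial.C B * p) := fun k => by
  rw [Polynomial.coeff_C_mul]
  refine ⟨fun h => by rw [(hp k).1 (by omega), mul_zero], fun h => ?_⟩
  by_cases hk : k ≤ n
  · convert hB.mul ((hp k).2 hk) using 1
    rw [← mul_add]; congr 1; omega
  · rw [(hp k).1 (by omega), mul_zero]; exact MvPolynomial.isHomogeneous_zero _ _ _

lemma IsGraded.X_sub_C_mul {d n : ℕ} {p : Polynomial (MvPolynomial (Fin 2) ℂ)}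
    (hp : IsGraded d n p) {A : MvPolynomial (Fin 2) ℂ} (hA : A.IsHomogeneous d) :
    IsGraded d (n + 1) ((Polynomial.X - Polynomial.C A) * p) := by
  have h1 : IsGraded d (n + 1) (Polynomial.X * p) := fun k => by
    cases k with
    | zero =>
      rw [Polynomial.coeff_X_mul_zero]
      exact ⟨fun _ => rfl, fun _ => MvPolynomial.isHomogeneous_zero _ _ _⟩
    | succ k =>
      rw [Polynomial.coeff_X_mul]
      exact ⟨fun h => (hp k).1 (by omega), fun h => by
        have := (hp k).2 (by omega)
        rwa [Nat.add_sub_add_right]⟩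
  have hA' : (-A).IsHomogeneous (d * 1) := by rw [mul_one]; exact hA.neg
  have h2 := hp.C_mul hA'
  have := h1.add h2
  rwa [Polynomial.C_neg, ← add_mul, ← sub_eq_add_neg] at this

lemma isWeightedHomogeneous_rename {d n : ℕ} {p : MvPolynomial (Fin 2) ℂ} (hp : p.IsHomogeneous n) :
    (MvPolynomial.rename (![0, 2] : Fin 2 → Fin 3) p).IsWeightedHomogeneous ![1, d, 1] n := by
  intro u hu
  obtain ⟨v, rfl, hv⟩ := MvPolynomial.coeff_rename_ne_zero _ _ _ hu
  have := hp hv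
  rw [Finsupp.weight_apply] at this ⊢
  rw [Finsupp.sum_mapDomain_index (by simp) (by intros; simp [add_mul])]
  rw [← this]
  refine Finsupp.sum_congr fun i _ => ?_
  fin_cases i <;> rfl

lemma IsGraded.toPlane_eq {d n : ℕ} {p : Polynomial (MvPolynomial (Fin 2) ℂ)}
    (hp : IsGraded d n p) : toPlane p = ∑ k ∈ Finset.range (n + 1),
      MvPolynomial.rename ![0, 2] (p.coeff k) * MvPolynomial.X 1 ^ k := by
  have h : p.natDegree < n + 1 :=
    Nat.lt_succ_of_le (Polynomial.natDegree_le_iff_coeff_eq_zero.2 fun k hk => (hp k).1 hk)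
  rw [toPlane, Polynomial.coe_eval₂RingHom, Polynomial.eval₂_eq_sum_range' _ h]
  rfl

lemma IsGraded.isWeightedHomogeneous {d n : ℕ} {p : Polynomial (MvPolynomial (Fin 2) ℂ)}
    (hp : IsGraded d n p) : (toPlane p).IsWeightedHomogeneous ![1, d, 1] (d * n) := by
  rw [hp.toPlane_eq]
  refine MvPolynomial.IsWeightedHomogeneous.sum _ _ _ fun k hk => ?_
  have hk' : k ≤ n := by rw [Finset.mem_range] at hk; omega
  have h1 := isWeightedHomogeneous_rename (d := d) ((hp k).2 hk')
  have h2 := (MvPolynomial.isWeightedHomogeneous_X ℂ (![1, d, 1] : Fin 3 → ℕ) 1).pow k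
  convert h1.mul h2 using 1
  simp only [Matrix.cons_val_one, Matrix.cons_val_zero, smul_eq_mul]
  rw [mul_comm k, ← mul_add]; congr 1; omega

/-! ### The pencil -/

lemma isHomogeneous_lineForm (i : Fin (numBranch m)) : (lineForm m L i).IsHomogeneous 1 :=
  (MvPolynomial.isHomogeneous_X _ _).sub (by
    simpa using (MvPolynomial.isHomogeneous_C (Fin 2) (e m L i)).mul
      (MvPolynomial.isHomogeneous_X ℂ (1 : Fin 2)))

lemma Couplings.isHomogeneous_aForm (hm : m = 2 ∨ m = 3 ∨ m = 4 ∨ m = 6) (c : Couplings m L)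
    (j : ℕ) : (c.aForm j).IsHomogeneous (yWeight m) := by
  refine MvPolynomial.IsHomogeneous.sum _ _ _ fun i _ => ?_
  have h := MvPolynomial.IsHomogeneous.prod (Finset.univ.erase i) (lineForm m L) (fun _ => 1)
    fun k _ => isHomogeneous_lineForm k
  convert (MvPolynomial.isHomogeneous_C (Fin 2) _).mul h using 1
  simp [numBranch_eq hm]

lemma sum_exponent (hm : m = 2 ∨ m = 3 ∨ m = 4 ∨ m = 6) (k : ℕ) (h2 : 2 ≤ k) (hk : k ≤ m) :
    ∑ i, (mult m i - (m - k) / stabOrder m i) + (if k = m then 1 else 0) = yWeight m * k := by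
  rcases hm with rfl | rfl | rfl | rfl <;> interval_cases k <;> decide

lemma isHomogeneous_bForm (hm : m = 2 ∨ m = 3 ∨ m = 4 ∨ m = 6) (k : ℕ) (h2 : 2 ≤ k) (hk : k ≤ m) :
    (bForm m L k).IsHomogeneous (yWeight m * k) := by
  rw [← sum_exponent hm k h2 hk]
  have h := MvPolynomial.IsHomogeneous.prod Finset.univ
    (fun i => lineForm m L i ^ (mult m i - (m - k) / stabOrder m i)) _
    fun i _ => (isHomogeneous_lineForm i).pow _
  have h' := (MvPolynomial.isHomogeneous_C (Fin 2) ((k - 1).factorial : ℂ)).mul h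
  simp only [one_mul, zero_add] at h'
  refine h'.mul ?_
  split_ifs
  · refine (MvPolynomial.isHomogeneous_X _ _).sub ?_
    simpa using (MvPolynomial.isHomogeneous_C (Fin 2) (lastZero m L)).mul
      (MvPolynomial.isHomogeneous_X ℂ (1 : Fin 2))
  · exact MvPolynomial.isHomogeneous_one _ _

/-- The polynomial `∏ (y - A_j) + ∑ α_k B_k ∏ (y - A_j)` over `ℂ[x, w]`. -/
def Couplings.qPoly (c : Couplings m L) (α : Fin (m - 1) → ℂ) :
    Polynomial (MvPolynomial (Fin 2) ℂ) :=
  ∏ j ∈ Finset.range m, (Polynomial.X - Polynomial.C (c.aForm j)) +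
    ∑ i : Fin (m - 1), Polynomial.C (MvPolynomial.C (α i) * bForm m L (i + 2)) *
      ∏ j ∈ Finset.range (m - (i + 2)), (Polynomial.X - Polynomial.C (c.aForm j))

/-- The polynomial `Q`. -/
def Couplings.bigQ (c : Couplings m L) (α : Fin (m - 1) → ℂ) : MvPolynomial (Fin 3) ℂ :=
  toPlane (c.qPoly α)

lemma Couplings.eval_bigQ (c : Couplings m L) (α : Fin (m - 1) → ℂ) (a : Fin 3 → ℂ) :
    MvPolynomial.eval a (c.bigQ α) =
      ∏ j ∈ Finset.range m, (a 1 - MvPolynomial.eval ![a 0, a 2] (c.aForm j)) +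
      ∑ i : Fin (m - 1), α i * MvPolynomial.eval ![a 0, a 2] (bForm m L (i + 2)) *
        ∏ j ∈ Finset.range (m - (i + 2)), (a 1 - MvPolynomial.eval ![a 0, a 2] (c.aForm j)) := by
  rw [bigQ, eval_toPlane, qPoly]
  simp [Polynomial.eval_prod, Polynomial.map_prod, Polynomial.map_sum, Polynomial.eval_finsetSum]

lemma Couplings.isGraded_prod (hm : m = 2 ∨ m = 3 ∨ m = 4 ∨ m = 6) (c : Couplings m L) (n : ℕ) :
    IsGraded (yWeight m) n
      (∏ j ∈ Finset.range n, (Polynomial.X - Polynomial.C (c.aForm j))) := by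
  induction n with
  | zero => simpa using IsGraded.one _
  | succ n ih =>
    rw [Finset.prod_range_succ, mul_comm]
    exact ih.X_sub_C_mul (c.isHomogeneous_aForm hm n)

lemma Couplings.isGraded_qPoly (hm : m = 2 ∨ m = 3 ∨ m = 4 ∨ m = 6) (c : Couplings m L)
    (α : Fin (m - 1) → ℂ) : IsGraded (yWeight m) m (c.qPoly α) := by
  refine (c.isGraded_prod hm m).add (IsGraded.sum _ _ fun i _ => ?_)
  have hi : (i : ℕ) + 2 ≤ m := by omega
  have hB := (MvPolynomial.isHomogeneous_C (Fin 2) (α i)).mul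
    (isHomogeneous_bForm (L := L) hm (i + 2) (by omega) hi)
  rw [zero_add] at hB
  have := (c.isGraded_prod hm (m - (i + 2))).C_mul hB
  rwa [Nat.sub_add_cancel hi] at this

lemma isWeightedHomogeneous_homP (hm : m = 2 ∨ m = 3 ∨ m = 4 ∨ m = 6) :
    (homP m L).IsWeightedHomogeneous ![1, yWeight m, 1] (yWeight m * m) := by
  rw [← sum_mult hm, add_comm]
  refine MvPolynomial.IsWeightedHomogeneous.mul
    (MvPolynomial.isWeightedHomogeneous_X ℂ (![1, yWeight m, 1] : Fin 3 → ℕ) 2)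
    (MvPolynomial.IsWeightedHomogeneous.prod _ _ _ fun i _ => ?_)
  have h0 := MvPolynomial.isWeightedHomogeneous_X ℂ (![1, yWeight m, 1] : Fin 3 → ℕ) 0
  have h2 := (MvPolynomial.isWeightedHomogeneous_X ℂ (![1, yWeight m, 1] : Fin 3 → ℕ) 2).C_mul
    (e m L i)
  simpa using (h0.sub h2).pow (mult m i)

lemma Couplings.isWeightedHomogeneous_member (hm : m = 2 ∨ m = 3 ∨ m = 4 ∨ m = 6)
    (c : Couplings m L) (α : Fin (m - 1) → ℂ) (z : ℂ) :
    (member m L (c.bigQ α) z).IsWeightedHomogeneous ![1, yWeight m, 1] (yWeight m * m) :=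
  (c.isGraded_qPoly hm α).isWeightedHomogeneous.sub ((isWeightedHomogeneous_homP hm).C_mul z)

lemma eval_homP (a : Fin 3 → ℂ) : MvPolynomial.eval a (homP m L) =
    a 2 * ∏ i, (a 0 - e m L i * a 2) ^ mult m i := by
  simp [homP, map_prod]

lemma eval_member (Q : MvPolynomial (Fin 3) ℂ) (z : ℂ) (a : Fin 3 → ℂ) :
    MvPolynomial.eval a (member m L Q z) =
      MvPolynomial.eval a Q - z * MvPolynomial.eval a (homP m L) := by
  simp [member]

/-- The correction terms have degree at most m - 2 in y. The coefficient of y^{m-1} in ∏(y - A_j) is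
-∑ A_j, which vanishes because the masses at each point sum to zero. -/
lemma Couplings.qPoly_monic (hm : m = 2 ∨ m = 3 ∨ m = 4 ∨ m = 6) (c : Couplings m L)
    (α : Fin (m - 1) → ℂ) : (c.qPoly α).coeff m = 1 ∧ (c.qPoly α).coeff (m - 1) = 0 := by
  set s : Polynomial (MvPolynomial (Fin 2) ℂ) := ∑ i : Fin (m - 1),
    Polynomial.C (MvPolynomial.C (α i) * bForm m L (i + 2)) *
      ∏ j ∈ Finset.range (m - (i + 2)), (Polynomial.X - Polynomial.C (c.aForm j)) with hs
  have hs0 : ∀ k, m - 2 < k → s.coeff k = 0 := by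
    intro k hk
    rw [hs, Polynomial.finsetSum_coeff]
    refine Finset.sum_eq_zero fun i _ => ?_
    rw [Polynomial.coeff_C_mul, ((c.isGraded_prod hm (m - (i + 2))) k).1 (by omega), mul_zero]
  set P : Polynomial (MvPolynomial (Fin 2) ℂ) :=
    ∏ j ∈ Finset.range m, (Polynomial.X - Polynomial.C (c.aForm j)) with hP
  have hmon : P.Monic := Polynomial.monic_prod_of_monic _ _ fun j _ => Polynomial.monic_X_sub_C _
  have hdeg : P.natDegree = m := by
    rw [hP, Polynomial.natDegree_prod_of_monic _ _ fun j _ => Polynomial.monic_X_sub_C _]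
    simp
  have hnext : P.coeff (m - 1) = 0 := by
    have h1 : P.nextCoeff = 0 := by
      rw [hP, Polynomial.Monic.nextCoeff_prod _ _ fun j _ => Polynomial.monic_X_sub_C _]
      simp only [Polynomial.nextCoeff_X_sub_C, Finset.sum_neg_distrib, neg_eq_zero]
      unfold Couplings.aForm
      rw [Finset.sum_comm]
      refine Finset.sum_eq_zero fun i _ => ?_
      rw [← Finset.sum_mul, ← map_sum, ← Finset.mul_sum, c.sum_mu (by omega), mul_zero, map_zero,
        zero_mul]
    rwa [Polynomial.nextCoeff_of_natDegree_pos (by omega), hdeg] at h1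
  change (P + s).coeff m = 1 ∧ (P + s).coeff (m - 1) = 0
  rw [Polynomial.coeff_add, Polynomial.coeff_add, hs0 m (by omega), hs0 (m - 1) (by omega), add_zero,
    add_zero]
  refine ⟨?_, hnext⟩
  have := hmon.coeff_natDegree
  rwa [hdeg] at this

lemma Couplings.bigQ_eq (hm : m = 2 ∨ m = 3 ∨ m = 4 ∨ m = 6) (c : Couplings m L)
    (α : Fin (m - 1) → ℂ) : ∃ R : ℕ → MvPolynomial (Fin 2) ℂ,
      (∀ j, (R j).IsHomogeneous (yWeight m * j)) ∧
      c.bigQ α = MvPolynomial.X 1 ^ m + ∑ j ∈ Finset.Icc 2 m,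
        MvPolynomial.rename ![0, 2] (R j) * MvPolynomial.X 1 ^ (m - j) := by
  -- For j > m truncated subtraction would return the constant coefficient, of degree dm instead of
  -- dj. The value zero is homogeneous of every degree.
  refine ⟨fun j => if j ≤ m then (c.qPoly α).coeff (m - j) else 0, fun j => ?_, ?_⟩
  · dsimp only
    split_ifs with h
    · have := ((c.isGraded_qPoly hm α) (m - j)).2 (by omega)
      rwa [Nat.sub_sub_self h] at this
    · exact MvPolynomial.isHomogeneous_zero _ _ _
  · obtain ⟨h0, h1⟩ := c.qPoly_monic hm α
    rw [bigQ, (c.isGraded_qPoly hm α).toPlane_eq, ← Finset.sum_range_reflect,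
      Finset.range_eq_Ico, Finset.sum_eq_sum_Ico_succ_bot (by omega),
      Finset.sum_eq_sum_Ico_succ_bot (by omega)]
    simp only [Nat.add_sub_cancel, tsub_zero, zero_add]
    rw [h0, h1]
    simp only [map_one, one_mul, map_zero, zero_mul, zero_add]
    congr 1
    refine Finset.sum_congr rfl fun j hj => ?_
    rw [Finset.mem_Icc] at hj
    rw [if_pos hj.2]

/-! ### The coefficients of the hamiltonian -/

lemma degree_prod_range_X_sub_C (a : ℕ → ℂ) (n : ℕ) :
    (∏ j ∈ Finset.range n, (Polynomial.X - Polynomial.C (a j))).Monic ∧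
    (∏ j ∈ Finset.range n, (Polynomial.X - Polynomial.C (a j))).natDegree = n := by
  refine ⟨Polynomial.monic_prod_of_monic _ _ fun j _ => Polynomial.monic_X_sub_C _, ?_⟩
  rw [Polynomial.natDegree_prod_of_monic _ _ fun j _ => Polynomial.monic_X_sub_C _]
  simp

/-- Newton interpolation. -/
lemma existsUnique_newton (a : ℕ → ℂ) (n : ℕ) (r : Polynomial ℂ) (hr : r.degree < n) :
    ∃! c : Fin n → ℂ, r = ∑ i : Fin n, Polynomial.C (c i) *
      ∏ j ∈ Finset.range i, (Polynomial.X - Polynomial.C (a j)) := by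
  induction n generalizing r with
  | zero =>
    refine ⟨Fin.elim0, ?_, fun c _ => Subsingleton.elim _ _⟩
    have : r = 0 := by
      rw [← Polynomial.degree_eq_bot]
      by_contra h
      rw [Polynomial.degree_eq_natDegree (fun h' => h (by simp [h']))] at hr
      exact absurd hr (by simp)
    simp [this]
  | succ n ih =>
    obtain ⟨hmon, hdeg⟩ := degree_prod_range_X_sub_C a n
    set P := ∏ j ∈ Finset.range n, (Polynomial.X - Polynomial.C (a j)) with hP
    have hPn : P.coeff n = 1 := by have := hmon.coeff_natDegree; rwa [hdeg] at this
    -- Only P among the basis polynomials has degree n, so its coefficient must be that of X^n in r.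
    have hr' : (r - Polynomial.C (r.coeff n) * P).degree < n := by
      rw [Polynomial.degree_lt_iff_coeff_zero] at hr ⊢
      intro k hk
      rw [Polynomial.coeff_sub, Polynomial.coeff_C_mul]
      rcases hk.eq_or_lt with rfl | hk
      · rw [hPn]; ring
      · rw [hr k hk, Polynomial.coeff_eq_zero_of_natDegree_lt (p := P) (by omega)]; ring
    obtain ⟨c, hc, hu⟩ := ih _ hr'
    refine ⟨Fin.snoc c (r.coeff n), ?_, fun c' hc' => ?_⟩
    · beta_reduce
      rw [Fin.sum_univ_castSucc]
      simp only [Fin.snoc_castSucc, Fin.snoc_last, Fin.val_castSucc, Fin.val_last]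
      rw [← hc]; ring
    · beta_reduce at hc'
      rw [Fin.sum_univ_castSucc] at hc'
      simp only [Fin.val_castSucc, Fin.val_last] at hc'
      have hcoef : r.coeff n = c' (Fin.last n) := by
        rw [hc', Polynomial.coeff_add, Polynomial.coeff_C_mul, hPn, Polynomial.finsetSum_coeff,
          Finset.sum_eq_zero, zero_add, mul_one]
        intro i _
        rw [Polynomial.coeff_C_mul, Polynomial.coeff_eq_zero_of_natDegree_lt, mul_zero]
        rw [(degree_prod_range_X_sub_C a i).2]; exact i.2
      have h1 := hu (fun i => c' i.castSucc) (by
        beta_reduce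
        rw [hcoef]
        linear_combination hc')
      rw [← h1, hcoef]
      exact (Fin.snoc_init_self c').symm

/-- Both sides are homogeneous in p and 1/q, so nothing is lost by setting q = -1. Conversely, y =
-pq and multiplication by (-1/q)^m recover the general case. -/
lemma Couplings.alphaRelation_iff (hm : 2 ≤ m) (c : Couplings m L) (α : Fin (m - 1) → ℂ) :
    c.AlphaRelation α ↔ ∀ y : ℂ, ∏ j ∈ Finset.range m, (y + c.mu j 0) =
      ∏ j ∈ Finset.range m, (y - c.muTotal j) + ∑ i : Fin (m - 1),
        ((i.val + 1).factorial : ℂ) * α i * ∏ j ∈ Finset.range (m - (i.val + 2)),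
          (y - c.muTotal j) := by
  constructor
  · intro h y
    have := h y (-1) (by norm_num)
    simp only [inv_neg, inv_one, mul_neg, mul_one, sub_neg_eq_add, ← sub_eq_add_neg] at this
    rw [this]
    congr 1
    refine Finset.sum_congr rfl fun i _ => ?_
    have : ((-1 : ℂ) ^ (i.val + 2)) * (-1) ^ (i.val + 2) = 1 := by
      rw [← mul_pow]; simp
    linear_combination ((i.val + 1).factorial : ℂ) * α i *
      (∏ j ∈ Finset.range (m - (i.val + 2)), (y - c.muTotal j)) * this
  · intro h p q hq
    have h1 := h (-(p * q))
    have hpr : ∀ (n : ℕ) (b : ℕ → ℂ), ∏ j ∈ Finset.range n, (p + b j * q⁻¹) =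
        (-q⁻¹) ^ n * ∏ j ∈ Finset.range n, (-(p * q) - b j) := fun n b => by
      rw [← Finset.card_range n, ← Finset.prod_const, Finset.card_range, ← Finset.prod_mul_distrib]
      refine Finset.prod_congr rfl fun j _ => ?_
      field_simp
      ring
    have h2 := hpr m (fun j => -c.mu j 0)
    simp only [neg_mul, sub_neg_eq_add, ← sub_eq_add_neg] at h2
    rw [h2, h1, hpr, mul_add, Finset.mul_sum]
    congr 1
    refine Finset.sum_congr rfl fun i _ => ?_
    rw [hpr]
    have hi : m = (m - (i.val + 2)) + (i.val + 2) := by omega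
    have : (-q⁻¹) ^ m = (-q⁻¹) ^ (m - (i.val + 2)) * ((-1) ^ (i.val + 2) * q⁻¹ ^ (i.val + 2)) := by
      rw [← mul_pow, neg_one_mul, ← pow_add, ← hi]
    rw [this]; ring

/-- Both products are monic with vanishing next coefficient, since the masses sum to zero. Their
difference has degree below m - 1 and expands uniquely in the Newton basis ∏_{j<k}(y - μ̃_j). -/
lemma Couplings.existsUnique_alpha (hm : 2 ≤ m) (c : Couplings m L) :
    ∃! α : Fin (m - 1) → ℂ, c.AlphaRelation α := by
  set a : ℕ → ℂ := c.muTotal with ha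
  have hA := degree_prod_range_X_sub_C (fun j => -c.mu j 0) m
  have hB := degree_prod_range_X_sub_C a m
  have hnext : ∀ b : ℕ → ℂ, (∑ j ∈ Finset.range m, b j = 0) →
      (∏ j ∈ Finset.range m, (Polynomial.X - Polynomial.C (b j))).coeff (m - 1) = 0 := by
    intro b hb
    have h1 := Polynomial.Monic.nextCoeff_prod (Finset.range m)
      (fun j => Polynomial.X - Polynomial.C (b j)) fun j _ => Polynomial.monic_X_sub_C _
    rw [Polynomial.nextCoeff_of_natDegree_pos (by rw [(degree_prod_range_X_sub_C b m).2]; omega),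
      (degree_prod_range_X_sub_C b m).2] at h1
    rw [h1]
    simp only [Polynomial.nextCoeff_X_sub_C, Finset.sum_neg_distrib, hb, neg_zero]
  have hsumA : ∑ j ∈ Finset.range m, -c.mu j 0 = 0 := by
    rw [Finset.sum_neg_distrib, c.sum_mu (by omega), neg_zero]
  have hsumB : ∑ j ∈ Finset.range m, a j = 0 := by
    have : ∀ l : List ℂ, ∑ j ∈ Finset.range m, (l.map fun x => c.mu j x).sum = 0 := by
      intro l
      induction l with
      | nil => simp
      | cons x l ih => simp [Finset.sum_add_distrib, ih, c.sum_mu (show m ≠ 0 by omega)]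
    exact this _
  set r : Polynomial ℂ := ∏ j ∈ Finset.range m, (Polynomial.X - Polynomial.C (-c.mu j 0)) -
    ∏ j ∈ Finset.range m, (Polynomial.X - Polynomial.C (a j)) with hr
  have hdeg : r.degree < (m - 1 : ℕ) := by
    rw [Polynomial.degree_lt_iff_coeff_zero]
    intro k hk
    rw [hr, Polynomial.coeff_sub]
    have : k = m - 1 ∨ k = m ∨ m < k := by omega
    rcases this with rfl | rfl | h
    · rw [hnext _ hsumA, hnext _ hsumB, sub_zero]
    · have h1 := hA.1.coeff_natDegree
      have h2 := hB.1.coeff_natDegree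
      rw [hA.2] at h1
      rw [hB.2] at h2
      rw [h1, h2, sub_self]
    · rw [Polynomial.coeff_eq_zero_of_natDegree_lt (by rw [hA.2]; exact h),
        Polynomial.coeff_eq_zero_of_natDegree_lt (by rw [hB.2]; exact h), sub_zero]
  obtain ⟨b, hb, hu⟩ := existsUnique_newton a (m - 1) r hdeg
  have hfac : ∀ n : ℕ, (n.factorial : ℂ) ≠ 0 := fun n => by exact_mod_cast n.factorial_ne_zero
  -- The coefficient α_k goes with a product of m - k factors, so the Newton index runs in the
  -- opposite direction.
  have key : ∀ α : Fin (m - 1) → ℂ, c.AlphaRelation α ↔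
      r = ∑ i : Fin (m - 1), Polynomial.C (((i.rev.val + 1).factorial : ℂ) * α i.rev) *
        ∏ j ∈ Finset.range i, (Polynomial.X - Polynomial.C (a j)) := by
    intro α
    rw [c.alphaRelation_iff hm]
    have hre : ∀ y : ℂ, Polynomial.eval y (∑ i : Fin (m - 1),
        Polynomial.C (((i.rev.val + 1).factorial : ℂ) * α i.rev) *
        ∏ j ∈ Finset.range i, (Polynomial.X - Polynomial.C (a j))) =
        ∑ i : Fin (m - 1), ((i.val + 1).factorial : ℂ) * α i *
          ∏ j ∈ Finset.range (m - (i.val + 2)), (y - c.muTotal j) := by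
      intro y
      rw [Polynomial.eval_finsetSum, ← Equiv.sum_comp Fin.revPerm]
      refine Finset.sum_congr rfl fun i _ => ?_
      simp only [Fin.revPerm_apply, Fin.rev_rev, Polynomial.eval_mul, Polynomial.eval_C,
        Polynomial.eval_prod, Polynomial.eval_sub, Polynomial.eval_X, Fin.val_rev]
      rw [show m - 1 - (i.val + 1) = m - (i.val + 2) by omega]
    constructor
    · intro h
      refine Polynomial.funext fun y => ?_
      rw [hre, hr]
      simp only [Polynomial.eval_sub, Polynomial.eval_prod, Polynomial.eval_X, Polynomial.eval_C,
        sub_neg_eq_add]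
      rw [h y]; ring
    · intro h y
      have h1 := congrArg (Polynomial.eval y) h
      rw [hre, hr] at h1
      simp only [Polynomial.eval_sub, Polynomial.eval_prod, Polynomial.eval_X, Polynomial.eval_C,
        sub_neg_eq_add] at h1
      rw [← h1]; ring
  refine ⟨fun i => b i.rev / ((i.val + 1).factorial : ℂ), ?_, fun α hα => ?_⟩
  · beta_reduce
    rw [key, hb]
    refine Finset.sum_congr rfl fun i _ => ?_
    rw [Fin.rev_rev, mul_div_cancel₀ _ (hfac _)]
  · have h1 := hu _ ((key α).1 hα)
    funext i
    rw [← h1]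
    beta_reduce
    rw [Fin.rev_rev, mul_div_cancel_left₀ _ (hfac _)]

/-! ### Restriction to the lines -/

lemma Couplings.eval_aForm_inf (hm : m = 2 ∨ m = 3 ∨ m = 4 ∨ m = 6) (hL : IsSymmetricLattice m L)
    (c : Couplings m L) (j : ℕ) :
    MvPolynomial.eval ![1, 0] (c.aForm j) = c.muTotal j := by
  rw [c.eval_aForm, c.muTotal_eq hm hL]
  simp

lemma eval_bForm_inf (k : ℕ) :
    MvPolynomial.eval ![1, 0] (bForm m L k) = ((k - 1).factorial : ℂ) := by
  rw [eval_bForm]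
  simp

lemma Couplings.eval_aForm_e (c : Couplings m L) (i : Fin (numBranch m)) (j : ℕ) :
    MvPolynomial.eval ![e m L i, 1] (c.aForm j) =
      mult m i * c.mu j (branchPt m L i) * eProd m L i := by
  rw [c.eval_aForm, Finset.sum_eq_single i]
  · simp [eProd]
  · intro k _ hk
    rw [Finset.prod_eq_zero (Finset.mem_erase.2 ⟨hk.symm, Finset.mem_univ i⟩) (by simp), mul_zero]
  · simp

lemma exponent_pos (hm : m = 2 ∨ m = 3 ∨ m = 4 ∨ m = 6) (i : Fin (numBranch m)) (k : ℕ)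
    (h2 : 2 ≤ k) : 0 < mult m i - (m - k) / stabOrder m i := by
  have h := mult_mul_stabOrder hm i
  have hs := stabOrder_pos hm i
  have : (m - k) / stabOrder m i < mult m i := by
    rw [Nat.div_lt_iff_lt_mul hs, h]; omega
  omega

/-- At (1, 0) the form A_j has the value μ̃_j, B_k the value (k-1)!, and P vanishes. What remains is
the relation for α at q = -1. -/
lemma Couplings.eval_member_inf (hm : m = 2 ∨ m = 3 ∨ m = 4 ∨ m = 6)
    (hL : IsSymmetricLattice m L) (c : Couplings m L) {α : Fin (m - 1) → ℂ}
    (hα : c.AlphaRelation α) (z y : ℂ) :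
    MvPolynomial.eval ![1, y, 0] (member m L (c.bigQ α) z) =
      ∏ j : Fin m, (y - (c.vecInf j).1 1) := by
  rw [eval_member, eval_homP, c.eval_bigQ]
  simp only [Matrix.cons_val_zero, Matrix.cons_val_one, Matrix.cons_val, c.eval_aForm_inf hm hL,
    eval_bForm_inf, zero_mul, mul_zero, sub_zero, vecInf, sub_neg_eq_add]
  rw [Fin.prod_univ_eq_prod_range (fun j => y + c.mu j 0) m]
  rw [((c.alphaRelation_iff (by omega) α).1 hα y)]
  congr 1
  refine Finset.sum_congr rfl fun i _ => ?_
  rw [mul_comm (α i)]; rfl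

lemma Couplings.mu_mod_stabOrder (hm : m = 2 ∨ m = 3 ∨ m = 4 ∨ m = 6)
    (hL : IsSymmetricLattice m L) (c : Couplings m L) (i : Fin (numBranch m)) (j k : ℕ) :
    c.mu (j + k * stabOrder m i) (branchPt m L i) = c.mu j (branchPt m L i) := by
  induction k with
  | zero => simp
  | succ k ih => rw [add_mul, one_mul, ← add_assoc, c.mu_add_stabOrder hm hL, ih]

lemma prod_range_mul_of_periodic {M : Type*} [CommMonoid M] (f : ℕ → M) (n s : ℕ)
    (hf : ∀ j k, f (j + k * s) = f j) :
    ∏ j ∈ Finset.range (n * s), f j = ∏ j : Fin s, f j ^ n := by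
  rw [Finset.prod_pow, Fin.prod_univ_eq_prod_range]
  induction n with
  | zero => simp
  | succ n ih =>
    rw [add_mul, one_mul, Finset.prod_range_add, ih, pow_succ]
    congr 1
    exact Finset.prod_congr rfl fun j _ => by rw [add_comm, hf]

/-- Every B_k and P contain the factor x - e_i w, and so does every term of A_j except the i-th.
Over j < m each residue class modulo m_i occurs n_i times. -/
lemma Couplings.eval_member_e (hm : m = 2 ∨ m = 3 ∨ m = 4 ∨ m = 6)
    (hL : IsSymmetricLattice m L) (c : Couplings m L) (α : Fin (m - 1) → ℂ) (z : ℂ)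
    (i : Fin (numBranch m)) (y : ℂ) :
    MvPolynomial.eval ![e m L i, y, 1] (member m L (c.bigQ α) z) =
      ∏ j : Fin (stabOrder m i), (y - (c.vec i j).1 1) ^ mult m i := by
  have hB : ∀ k : Fin (m - 1), MvPolynomial.eval ![e m L i, 1] (bForm m L (k + 2)) = 0 := fun k => by
    rw [eval_bForm, Finset.prod_eq_zero (Finset.mem_univ i)]
    · simp
    · simp [(exponent_pos hm i (k + 2) (by omega)).ne']
  have hP : ∏ k, (e m L i - e m L k) ^ mult m k = 0 :=
    Finset.prod_eq_zero (Finset.mem_univ i) (by rw [sub_self]; exact zero_pow (mult_pos hm i).ne')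
  rw [eval_member, eval_homP, c.eval_bigQ]
  simp only [Matrix.cons_val_zero, Matrix.cons_val_one, Matrix.cons_val, c.eval_aForm_e, hB,
    mul_zero, zero_mul, Finset.sum_const_zero, add_zero, mul_one, hP, sub_zero]
  refine Eq.trans ?_ (prod_range_mul_of_periodic
    (fun j => y - mult m i * c.mu j (branchPt m L i) * eProd m L i)
    (mult m i) (stabOrder m i) (fun j k => by rw [c.mu_mod_stabOrder hm hL]))
  rw [mult_mul_stabOrder hm]

/-! ### The hamiltonian -/

/-- The factor v^m = P_m(u) is distributed over h: each p - f_j absorbs one v, and ℘^(k-2) absorbs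
v^k. -/
lemma Couplings.eval_bigQ_uv (hm : m = 2 ∨ m = 3 ∨ m = 4 ∨ m = 6)
    (hL : IsSymmetricLattice m L) (c : Couplings m L) (α : Fin (m - 1) → ℂ) (p q : ℂ)
    (hq : ¬ IsFixedPoint m L q) :
    MvPolynomial.eval ![u m L q, v m L q * p, 1] (c.bigQ α) =
      tableP m L (u m L q) * c.h α p q := by
  obtain ⟨hq', hv⟩ := (not_isFixedPoint_iff hm hL).1 hq
  have hpr : ∀ n : ℕ, ∏ j ∈ Finset.range n,
      (v m L q * p - MvPolynomial.eval ![u m L q, 1] (c.aForm j)) =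
      v m L q ^ n * ∏ j ∈ Finset.range n, (p - c.f j q) := fun n => by
    rw [← Finset.card_range n, ← Finset.prod_const, Finset.card_range, ← Finset.prod_mul_distrib]
    exact Finset.prod_congr rfl fun j _ => by rw [mul_sub, c.v_mul_f hm hL j hq]
  rw [← v_pow_eq hm hL hq', c.eval_bigQ, Couplings.h, mul_add, Finset.mul_sum]
  simp only [Matrix.cons_val_zero, Matrix.cons_val_one, Matrix.cons_val]
  rw [hpr]
  congr 1
  refine Finset.sum_congr rfl fun i _ => ?_
  have hi : (i : ℕ) + 2 ≤ m := by omega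
  have hvm : v m L q ^ m = v m L q ^ (i.val + 2) * v m L q ^ (m - (i.val + 2)) := by
    rw [← pow_add, Nat.add_sub_cancel' hi]
  rw [hpr, ← v_pow_mul_iteratedDeriv hm hL hq' i hi, hvm]
  ring

lemma eval_homP_affine (hm : m = 2 ∨ m = 3 ∨ m = 4 ∨ m = 6) (hL : IsSymmetricLattice m L)
    (t y : ℂ) : MvPolynomial.eval ![t, y, 1] (homP m L) = tableP m L t := by
  rw [eval_homP, ← prod_sub_e_pow hm hL]
  simp

/-- For the converse inclusion, surjectivity of u gives q, P_m(x) ≠ 0 makes v(q) non-zero, and p =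
y/v(q). -/
lemma Couplings.levelSet (hm : m = 2 ∨ m = 3 ∨ m = 4 ∨ m = 6)
    (hL : IsSymmetricLattice m L) (c : Couplings m L) (α : Fin (m - 1) → ℂ) (z : ℂ) :
    {a : ℂ × ℂ | ∃ p q : ℂ, ¬ IsFixedPoint m L q ∧ c.h α p q = z ∧
            a = (u m L q, v m L q * p)} =
          {a : ℂ × ℂ | tableP m L a.1 ≠ 0 ∧
            MvPolynomial.eval ![a.1, a.2, 1] (member m L (c.bigQ α) z) = 0} := by
  ext ⟨x, y⟩
  simp only [Set.mem_ofPred_eq, eval_member, eval_homP_affine hm hL, Prod.mk.injEq]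
  constructor
  · rintro ⟨p, q, hq, hz, rfl, rfl⟩
    obtain ⟨hq', hv⟩ := (not_isFixedPoint_iff hm hL).1 hq
    refine ⟨?_, ?_⟩
    · rw [← v_pow_eq hm hL hq']; exact pow_ne_zero _ hv
    · rw [c.eval_bigQ_uv hm hL α p q hq, hz]; ring
  · rintro ⟨hx, h⟩
    obtain ⟨q, hq', rfl⟩ := exists_u_eq hm hL x
    have hv : v m L q ≠ 0 := fun h0 => hx (by
      rw [← v_pow_eq hm hL hq', h0, zero_pow (by omega)])
    have hq := (not_isFixedPoint_iff hm hL).2 ⟨hq', hv⟩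
    refine ⟨y / v m L q, q, hq, ?_, rfl, (mul_div_cancel₀ _ hv).symm⟩
    have h1 := c.eval_bigQ_uv hm hL α (y / v m L q) q hq
    rw [mul_div_cancel₀ _ hv] at h1
    rw [h1] at h
    apply mul_left_cancel₀ hx
    linear_combination h

/-! ### Points of the weighted projective plane -/

/-- The action of `t` on homogeneous coordinates. -/
def wscale (d : ℕ) (t : ℂ) (a : Fin 3 → ℂ) : Fin 3 → ℂ := ![t * a 0, t ^ d * a 1, t * a 2]

lemma weight_eq (d : ℕ) (σ : Fin 3 →₀ ℕ) :
    Finsupp.weight (![1, d, 1] : Fin 3 → ℕ) σ = σ 0 + σ 1 * d + σ 2 := by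
  rw [Finsupp.weight_apply, Finsupp.sum_fintype _ _ (by simp), Fin.sum_univ_three]
  simp

lemma eval_wscale {d n : ℕ} {F : MvPolynomial (Fin 3) ℂ}
    (hF : F.IsWeightedHomogeneous ![1, d, 1] n) (t : ℂ) (a : Fin 3 → ℂ) :
    MvPolynomial.eval (wscale d t a) F = t ^ n * MvPolynomial.eval a F := by
  rw [MvPolynomial.eval_eq', MvPolynomial.eval_eq', Finset.mul_sum]
  refine Finset.sum_congr rfl fun σ hσ => ?_
  have h := hF (MvPolynomial.mem_support_iff.1 hσ)
  rw [weight_eq] at h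
  rw [← h, Fin.prod_univ_three, Fin.prod_univ_three]
  simp only [wscale, Matrix.cons_val_zero, Matrix.cons_val_one, Matrix.cons_val, mul_pow, pow_add,
    ← pow_mul, mul_comm d]
  ring

lemma WPlane.mk_eq_mk {d : ℕ} {a b : {a : Fin 3 → ℂ // a ≠ 0}} :
    WPlane.mk d a = WPlane.mk d b ↔ ∃ t : ℂ, t ≠ 0 ∧ b.1 = wscale d t a.1 :=
  Quotient.eq (r := wSetoid d)

lemma mk_mem_curve_iff {d n : ℕ} {F : MvPolynomial (Fin 3) ℂ}
    (hF : F.IsWeightedHomogeneous ![1, d, 1] n) (a : {a : Fin 3 → ℂ // a ≠ 0}) :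
    WPlane.mk d a ∈ curve d F ↔ MvPolynomial.eval a.1 F = 0 := by
  refine ⟨?_, fun h => ⟨a, rfl, h⟩⟩
  rintro ⟨b, hb, h⟩
  obtain ⟨t, -, ha⟩ := WPlane.mk_eq_mk.1 hb
  rw [ha, eval_wscale hF, h, mul_zero]

lemma WPlane.exists_mk {d : ℕ} (x : WPlane d) : ∃ a, WPlane.mk d a = x := Quotient.exists_rep x

lemma mk_mem_lineInf_iff (a : {a : Fin 3 → ℂ // a ≠ 0}) :
    WPlane.mk (yWeight m) a ∈ lineInf m ↔ a.1 2 = 0 := by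
  rw [lineInf, mk_mem_curve_iff (MvPolynomial.isWeightedHomogeneous_X ℂ
    (![1, yWeight m, 1] : Fin 3 → ℕ) 2), MvPolynomial.eval_X]

lemma mk_mem_line_iff (i : Fin (numBranch m)) (a : {a : Fin 3 → ℂ // a ≠ 0}) :
    WPlane.mk (yWeight m) a ∈ line m L i ↔ a.1 0 = e m L i * a.1 2 := by
  have h : (MvPolynomial.X 0 - MvPolynomial.C (e m L i) * MvPolynomial.X 2 :
      MvPolynomial (Fin 3) ℂ).IsWeightedHomogeneous ![1, yWeight m, 1] 1 :=
    (MvPolynomial.isWeightedHomogeneous_X ℂ (![1, yWeight m, 1] : Fin 3 → ℕ) 0).sub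
      ((MvPolynomial.isWeightedHomogeneous_X ℂ (![1, yWeight m, 1] : Fin 3 → ℕ) 2).C_mul _)
  rw [line, mk_mem_curve_iff h]
  simp [sub_eq_zero]

lemma eq_vertex {a : Fin 3 → ℂ} (h0 : a 0 = 0) (h2 : a 2 = 0) : a = ![0, a 1, 0] := by
  ext k; fin_cases k <;> simp [h0, h2]

lemma yWeight_pos : 0 < yWeight m := by unfold yWeight; split_ifs <;> omega

lemma numBranch_ge : 2 ≤ numBranch m := by unfold numBranch; split_ifs <;> omega

lemma lines_concurrent :
    (lineInf m ∩ ⋂ i, line m L i) =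
        {WPlane.mk (yWeight m)
          ⟨![0, 1, 0], fun h => one_ne_zero (congrFun h 1)⟩} := by
  ext x
  obtain ⟨a, rfl⟩ := x.exists_mk
  rw [Set.mem_inter_iff, mk_mem_lineInf_iff, Set.mem_iInter, Set.mem_singleton_iff]
  simp only [mk_mem_line_iff]
  constructor
  · rintro ⟨h2, h⟩
    have h0 := h ⟨0, lt_of_lt_of_le (by norm_num) numBranch_ge⟩
    rw [h2, mul_zero] at h0
    have ha := eq_vertex h0 h2
    have h1 : a.1 1 ≠ 0 := fun h1 => a.2 (by rw [ha, h1]; ext k; fin_cases k <;> rfl)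
    -- As y has weight d, a d-th root of the second coordinate is the scalar taking (0, 1, 0) to the
    -- given vector.
    obtain ⟨t, ht⟩ := IsAlgClosed.exists_pow_nat_eq (a.1 1) (yWeight_pos (m := m))
    refine (WPlane.mk_eq_mk.2 ⟨t, fun h => h1 ?_, ?_⟩).symm
    · rw [← ht, h, zero_pow yWeight_pos.ne']
    · rw [ha]; simp [wscale, ht]
  · intro h
    obtain ⟨t, ht, h⟩ := WPlane.mk_eq_mk.1 h.symm
    rw [h]
    simp [wscale]

/-! ### The base points -/

lemma eval_zero_of_isHomogeneous {n : ℕ} {p : MvPolynomial (Fin 2) ℂ} (hp : p.IsHomogeneous n)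
    (hn : n ≠ 0) : MvPolynomial.eval ![0, 0] p = 0 := by
  have : (![0, 0] : Fin 2 → ℂ) = 0 := by ext k; fin_cases k <;> rfl
  rw [this, MvPolynomial.eval_zero, MvPolynomial.constantCoeff_eq]
  exact hp.coeff_eq_zero (by simpa using hn.symm)

/-- All A_j, B_k and P have positive degree in x and w, so only y^m survives. Hence no member passes
through (0:1:0), and points of a curve on a line can be normalised to x = 1 or w = 1. -/
lemma Couplings.eval_member_vertex (hm : m = 2 ∨ m = 3 ∨ m = 4 ∨ m = 6) (c : Couplings m L)
    (α : Fin (m - 1) → ℂ) (z y : ℂ) :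
    MvPolynomial.eval ![0, y, 0] (member m L (c.bigQ α) z) = y ^ m := by
  have hd := yWeight_pos (m := m)
  have hA : ∀ j, MvPolynomial.eval ![0, 0] (c.aForm j) = 0 := fun j =>
    eval_zero_of_isHomogeneous (c.isHomogeneous_aForm hm j) hd.ne'
  have hB : ∀ i : Fin (m - 1), MvPolynomial.eval ![0, 0] (bForm m L (i + 2)) = 0 := fun i =>
    eval_zero_of_isHomogeneous (isHomogeneous_bForm hm (i + 2) (by omega) (by omega))
      (by positivity)
  rw [eval_member, eval_homP, c.eval_bigQ]
  simp [hA, hB]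

lemma Couplings.curve_inter_lineInf (hm : m = 2 ∨ m = 3 ∨ m = 4 ∨ m = 6)
    (hL : IsSymmetricLattice m L) (c : Couplings m L) {α : Fin (m - 1) → ℂ}
    (hα : c.AlphaRelation α) (z : ℂ) :
    curve (yWeight m) (member m L (c.bigQ α) z) ∩ lineInf m =
      Set.range fun j => WPlane.mk (yWeight m) (c.vecInf j) := by
  have hF := c.isWeightedHomogeneous_member hm α z
  ext x
  obtain ⟨a, rfl⟩ := x.exists_mk
  rw [Set.mem_inter_iff, mk_mem_lineInf_iff, mk_mem_curve_iff hF]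
  constructor
  · rintro ⟨h, h2⟩
    have h0 : a.1 0 ≠ 0 := fun h0 => a.2 (by
      have ha := eq_vertex h0 h2
      rw [ha, c.eval_member_vertex hm] at h
      rw [ha, pow_eq_zero_iff (by omega) |>.1 h]
      ext k; fin_cases k <;> rfl)
    have hs : wscale (yWeight m) (a.1 0)⁻¹ a.1 = ![1, (a.1 0)⁻¹ ^ yWeight m * a.1 1, 0] := by
      ext k; fin_cases k <;> simp [wscale, h0, h2]
    have h' := eval_wscale hF (a.1 0)⁻¹ a.1
    rw [h, mul_zero, hs, c.eval_member_inf hm hL hα, Finset.prod_eq_zero_iff] at h'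
    obtain ⟨j, -, hj⟩ := h'
    refine ⟨j, (WPlane.mk_eq_mk.2 ⟨(a.1 0)⁻¹, inv_ne_zero h0, ?_⟩).symm⟩
    rw [hs, sub_eq_zero.1 hj]
    ext k; fin_cases k <;> rfl
  · rintro ⟨j, hj⟩
    obtain ⟨t, -, h⟩ := WPlane.mk_eq_mk.1 hj
    rw [h, eval_wscale hF, vecInf, c.eval_member_inf hm hL hα,
      Finset.prod_eq_zero (Finset.mem_univ j) (by simp [vecInf])]
    simp [wscale]

lemma Couplings.curve_inter_line (hm : m = 2 ∨ m = 3 ∨ m = 4 ∨ m = 6)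
    (hL : IsSymmetricLattice m L) (c : Couplings m L) (α : Fin (m - 1) → ℂ) (z : ℂ)
    (i : Fin (numBranch m)) :
    curve (yWeight m) (member m L (c.bigQ α) z) ∩ line m L i =
      Set.range fun j => WPlane.mk (yWeight m) (c.vec i j) := by
  have hF := c.isWeightedHomogeneous_member hm α z
  ext x
  obtain ⟨a, rfl⟩ := x.exists_mk
  rw [Set.mem_inter_iff, mk_mem_line_iff, mk_mem_curve_iff hF]
  constructor
  · rintro ⟨h, h0⟩
    have h2 : a.1 2 ≠ 0 := fun h2 => a.2 (by
      rw [h2, mul_zero] at h0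
      have ha := eq_vertex h0 h2
      rw [ha, c.eval_member_vertex hm] at h
      rw [ha, pow_eq_zero_iff (by omega) |>.1 h]
      ext k; fin_cases k <;> rfl)
    have hs : wscale (yWeight m) (a.1 2)⁻¹ a.1 =
        ![e m L i, (a.1 2)⁻¹ ^ yWeight m * a.1 1, 1] := by
      ext k; fin_cases k <;> (simp [wscale, h0, h2]; try field_simp)
    have h' := eval_wscale hF (a.1 2)⁻¹ a.1
    rw [h, mul_zero, hs, c.eval_member_e hm hL, Finset.prod_eq_zero_iff] at h'
    obtain ⟨j, -, hj⟩ := h'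
    refine ⟨j, (WPlane.mk_eq_mk.2 ⟨(a.1 2)⁻¹, inv_ne_zero h2, ?_⟩).symm⟩
    rw [hs, sub_eq_zero.1 (pow_eq_zero_iff (mult_pos hm i).ne' |>.1 hj)]
    ext k; fin_cases k <;> rfl
  · rintro ⟨j, hj⟩
    obtain ⟨t, -, h⟩ := WPlane.mk_eq_mk.1 hj
    rw [h, eval_wscale hF, vec, c.eval_member_e hm hL,
      Finset.prod_eq_zero (Finset.mem_univ j) (by simp [vec, (mult_pos hm i).ne'])]
    simp [wscale]; ring

lemma Couplings.basePoints (hm : m = 2 ∨ m = 3 ∨ m = 4 ∨ m = 6)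
    (hL : IsSymmetricLattice m L) (c : Couplings m L) {α : Fin (m - 1) → ℂ}
    (hα : c.AlphaRelation α) :
    (⋂ z : ℂ, curve (yWeight m) (member m L (c.bigQ α) z)) =
      (Set.range fun j => WPlane.mk (yWeight m) (c.vecInf j)) ∪
        ⋃ i, Set.range fun j => WPlane.mk (yWeight m) (c.vec i j) := by
  have hF := c.isWeightedHomogeneous_member hm α
  refine Set.Subset.antisymm (fun x hx => ?_) (Set.union_subset ?_ (Set.iUnion_subset fun i => ?_))
  · obtain ⟨a, rfl⟩ := x.exists_mk
    rw [Set.mem_iInter] at hx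
    have h0 := (mk_mem_curve_iff (hF 0) a).1 (hx 0)
    have h1 := (mk_mem_curve_iff (hF 1) a).1 (hx 1)
    rw [eval_member] at h0 h1
    -- The difference of the members at z = 0 and z = 1 is P, so a base point lies on one of the
    -- lines.
    have hP : MvPolynomial.eval a.1 (homP m L) = 0 := by linear_combination h0 - h1
    rw [eval_homP, mul_eq_zero, Finset.prod_eq_zero_iff] at hP
    rcases hP with h | ⟨i, -, h⟩
    · left
      rw [← c.curve_inter_lineInf hm hL hα 0]
      exact ⟨hx 0, (mk_mem_lineInf_iff a).2 h⟩
    · right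
      rw [Set.mem_iUnion]
      refine ⟨i, ?_⟩
      rw [← c.curve_inter_line hm hL α 0]
      exact ⟨hx 0, (mk_mem_line_iff i a).2
        (sub_eq_zero.1 (pow_eq_zero_iff (mult_pos hm i).ne' |>.1 h))⟩
  · refine Set.subset_iInter fun z => ?_
    rw [← c.curve_inter_lineInf hm hL hα z]
    exact Set.inter_subset_left
  · refine Set.subset_iInter fun z => ?_
    rw [← c.curve_inter_line hm hL α z]
    exact Set.inter_subset_left

/-! ### Residues -/

lemma hasResidue_of_analyticAt {g : ℂ → ℂ} {a : ℂ} (hg : AnalyticAt ℂ g a) :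
    HasResidue (fun t => g t / (t - a)) a (g a) := by
  obtain ⟨r, hr, h⟩ := Metric.eventually_nhds_iff_ball.1 hg.eventually_analyticAt
  filter_upwards [Ioo_mem_nhdsGT hr] with ρ hρ
  have hd : DifferentiableOn ℂ g (Metric.closedBall a ρ) := fun x hx =>
    (h x (Metric.closedBall_subset_ball hρ.2 hx)).differentiableAt.differentiableWithinAt
  have := (hd.diffContOnCl_ball (c := a) (R := ρ) subset_rfl).circleIntegral_sub_inv_smul
    (Metric.mem_ball_self hρ.1)
  rw [← smul_eq_mul (2 * Real.pi * Complex.I : ℂ), ← this]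
  refine circleIntegral.integral_congr hρ.1.le fun t _ => ?_
  rw [smul_eq_mul, div_eq_inv_mul]

lemma HasResidue.congr {f g : ℂ → ℂ} {a r : ℂ} (h : HasResidue f a r)
    (hfg : ∀ᶠ t in 𝓝 a, f t = g t) : HasResidue g a r := by
  obtain ⟨s, hs, hb⟩ := Metric.eventually_nhds_iff_ball.1 hfg
  filter_upwards [h, Ioo_mem_nhdsGT hs] with ρ hρ hρs
  rw [← hρ]
  refine circleIntegral.integral_congr hρs.1.le fun t ht => (hb t ?_).symm
  rw [Metric.mem_ball, Metric.mem_sphere.1 ht]; exact hρs.2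

/-- With x = 1 and w = t the form is -Y dt / (t ∏(1 - e_i t)), and the product is 1 at t = 0. -/
lemma hasResidue_swPullback_inf {Y : ℂ → ℂ} (hY : AnalyticAt ℂ Y 0) :
    HasResidue (swPullback m L (fun _ => 1) Y (fun t => t)) 0 (-Y 0) := by
  have hg : AnalyticAt ℂ (fun t => -Y t / ∏ i, (1 - e m L i * t)) 0 := by
    refine hY.neg.div ?_ (by simp)
    exact Finset.analyticAt_fun_prod _ fun i _ => by fun_prop
  have := hasResidue_of_analyticAt hg
  simp only [mul_zero, sub_zero, Finset.prod_const_one, div_one] at this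
  refine this.congr (Eventually.of_forall fun t => ?_)
  simp only [swPullback, deriv_const, deriv_id'', mul_zero, mul_one, zero_sub]
  rw [div_div, mul_comm t]; ring

lemma eProd_ne_zero (hinj : Function.Injective (e m L)) (i : Fin (numBranch m)) :
    eProd m L i ≠ 0 := Finset.prod_ne_zero_iff.2 fun _ hk =>
  sub_ne_zero.2 fun h => (Finset.mem_erase.1 hk).1 (hinj h).symm

lemma hasResidue_swPullback_e (hinj : Function.Injective (e m L)) (i : Fin (numBranch m))
    {Y : ℂ → ℂ} (hY : AnalyticAt ℂ Y (e m L i)) :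
    HasResidue (swPullback m L (fun t => t) Y (fun _ => 1)) (e m L i)
      (Y (e m L i) / eProd m L i) := by
  have hg : AnalyticAt ℂ (fun t => Y t / ∏ k ∈ Finset.univ.erase i, (t - e m L k)) (e m L i) := by
    refine hY.div ?_ (eProd_ne_zero hinj i)
    exact Finset.analyticAt_fun_prod _ fun i _ => by fun_prop
  refine (hasResidue_of_analyticAt hg).congr (Eventually.of_forall fun t => ?_)
  simp only [swPullback, deriv_const, deriv_id'', mul_zero, mul_one, sub_zero, one_mul]
  rw [div_div, Finset.prod_erase_mul _ _ (Finset.mem_univ i)]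

lemma Couplings.hasResidue_inf (c : Couplings m L) {Y : ℂ → ℂ} (hY : AnalyticAt ℂ Y 0)
    {j : Fin m} (h : Y 0 = (c.vecInf j).1 1) :
    HasResidue (swPullback m L (fun _ => 1) Y (fun t => t)) 0 (c.mu j 0) := by
  have := hasResidue_swPullback_inf (m := m) (L := L) hY
  rw [h] at this
  simpa [vecInf] using this

lemma Couplings.hasResidue_e (hinj : Function.Injective (e m L)) (c : Couplings m L)
    {i : Fin (numBranch m)} {Y : ℂ → ℂ} (hY : AnalyticAt ℂ Y (e m L i)) {j : Fin (stabOrder m i)}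
    (h : Y (e m L i) = (c.vec i j).1 1) :
    HasResidue (swPullback m L (fun t => t) Y (fun _ => 1)) (e m L i)
      (mult m i * c.mu j (branchPt m L i)) := by
  have := hasResidue_swPullback_e hinj i hY
  rw [h] at this
  convert this using 1
  simp [vec, eProd_ne_zero hinj i]

/-! ### Multiplicities -/

lemma eval_taylor (F : MvPolynomial (Fin 3) ℂ) (a x : Fin 3 → ℂ) :
    MvPolynomial.eval x (taylor F a) = MvPolynomial.eval (x + a) F := by
  rw [taylor, ← MvPolynomial.coe_aeval_eq_eval, RingHom.coe_coe,
    MvPolynomial.comp_aeval_apply, ← MvPolynomial.coe_aeval_eq_eval, RingHom.coe_coe]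
  congr 2
  funext i
  simp

lemma taylor_ne_zero {F : MvPolynomial (Fin 3) ℂ} (hF : F ≠ 0) (a : Fin 3 → ℂ) :
    taylor F a ≠ 0 := fun h => hF <| MvPolynomial.funext fun x => by
  have := eval_taylor F a (x - a)
  rw [h, sub_add_cancel] at this
  rw [← this, map_zero]; simp

lemma homogeneousComponent_eq_zero_iff {k : ℕ} {p : MvPolynomial (Fin 3) ℂ} :
    MvPolynomial.homogeneousComponent k p = 0 ↔ ∀ σ : Fin 3 →₀ ℕ, σ.degree = k → p.coeff σ = 0 := by
  classical
  rw [MvPolynomial.ext_iff]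
  refine forall_congr' fun σ => ?_
  rw [MvPolynomial.coeff_homogeneousComponent, MvPolynomial.coeff_zero]
  simp

lemma mem_pow_idealOfVars_iff_component {n : ℕ} {p : MvPolynomial (Fin 3) ℂ} :
    p ∈ MvPolynomial.idealOfVars (Fin 3) ℂ ^ n ↔
      ∀ k < n, MvPolynomial.homogeneousComponent k p = 0 := by
  rw [MvPolynomial.mem_pow_idealOfVars_iff']
  simp only [homogeneousComponent_eq_zero_iff]
  exact ⟨fun h k hk σ hσ => h σ (by omega), fun h σ hσ => h _ hσ σ rfl⟩

lemma exists_component_ne_zero {F : MvPolynomial (Fin 3) ℂ} (hF : F ≠ 0) (a : Fin 3 → ℂ) :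
    ∃ k, MvPolynomial.homogeneousComponent k (taylor F a) ≠ 0 := by
  by_contra! h
  apply taylor_ne_zero hF a
  ext σ
  exact homogeneousComponent_eq_zero_iff.1 (h σ.degree) σ rfl

lemma component_multAt_ne_zero {F : MvPolynomial (Fin 3) ℂ} (hF : F ≠ 0) (a : Fin 3 → ℂ) :
    MvPolynomial.homogeneousComponent (multAt F a) (taylor F a) ≠ 0 :=
  Nat.sInf_mem (exists_component_ne_zero hF a)

lemma component_eq_zero_of_lt_multAt {F : MvPolynomial (Fin 3) ℂ} {a : Fin 3 → ℂ} {k : ℕ}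
    (hk : k < multAt F a) : MvPolynomial.homogeneousComponent k (taylor F a) = 0 := by
  by_contra h
  exact Nat.notMem_of_lt_sInf hk h

lemma multAt_le {F : MvPolynomial (Fin 3) ℂ} {a : Fin 3 → ℂ} {k : ℕ}
    (h : MvPolynomial.homogeneousComponent k (taylor F a) ≠ 0) : multAt F a ≤ k :=
  Nat.sInf_le h

/-- Lower bounds for multiplicities become membership in powers of the maximal ideal at the origin,
which can be checked term by term. -/
lemma le_multAt_iff {F : MvPolynomial (Fin 3) ℂ} (hF : F ≠ 0) (a : Fin 3 → ℂ) (n : ℕ) :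
    n ≤ multAt F a ↔ taylor F a ∈ MvPolynomial.idealOfVars (Fin 3) ℂ ^ n := by
  rw [mem_pow_idealOfVars_iff_component]
  refine ⟨fun h k hk => component_eq_zero_of_lt_multAt (hk.trans_le h), fun h => ?_⟩
  by_contra! hlt
  exact component_multAt_ne_zero hF a (h _ hlt)

lemma mem_idealOfVars_iff {p : MvPolynomial (Fin 3) ℂ} :
    p ∈ MvPolynomial.idealOfVars (Fin 3) ℂ ↔ MvPolynomial.eval 0 p = 0 := by
  rw [← pow_one (MvPolynomial.idealOfVars (Fin 3) ℂ), MvPolynomial.mem_pow_idealOfVars_iff',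
    MvPolynomial.eval_zero, MvPolynomial.constantCoeff_eq]
  constructor
  · intro h; exact h 0 (by simp)
  · intro h σ hσ
    have : σ.degree = 0 := by omega
    rw [Finsupp.degree_eq_zero_iff] at this
    rw [this, h]

lemma taylor_mem_iff {F : MvPolynomial (Fin 3) ℂ} {a : Fin 3 → ℂ} :
    taylor F a ∈ MvPolynomial.idealOfVars (Fin 3) ℂ ↔ MvPolynomial.eval a F = 0 := by
  rw [mem_idealOfVars_iff, eval_taylor, zero_add]

/-! ### Upper bounds for multiplicities by restriction to lines -/

/-- The restriction of `F` to the line through `a` with direction `v`. -/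
def lineRestr (F : MvPolynomial (Fin 3) ℂ) (a v : Fin 3 → ℂ) : Polynomial ℂ :=
  MvPolynomial.aeval (fun i => Polynomial.C (a i) + Polynomial.C (v i) * Polynomial.X) F

lemma lineRestr_mul (F G : MvPolynomial (Fin 3) ℂ) (a v : Fin 3 → ℂ) :
    lineRestr (F * G) a v = lineRestr F a v * lineRestr G a v := map_mul _ _ _

lemma eval_lineRestr (F : MvPolynomial (Fin 3) ℂ) (a v : Fin 3 → ℂ) (t : ℂ) :
    (lineRestr F a v).eval t = MvPolynomial.eval (fun i => a i + v i * t) F := by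
  rw [lineRestr, ← Polynomial.coe_aeval_eq_eval, MvPolynomial.comp_aeval_apply,
    ← MvPolynomial.coe_aeval_eq_eval, RingHom.coe_coe]
  congr 2
  funext i
  simp

lemma lineRestr_eq_sum (F : MvPolynomial (Fin 3) ℂ) (a v : Fin 3 → ℂ) :
    lineRestr F a v = ∑ σ ∈ (taylor F a).support,
      Polynomial.C ((taylor F a).coeff σ * ∏ i, v i ^ σ i) * Polynomial.X ^ σ.degree := by
  refine Polynomial.funext fun t => ?_
  rw [eval_lineRestr, Polynomial.eval_finsetSum]
  have := eval_taylor F a (fun i => v i * t)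
  rw [show (fun i => v i * t) + a = fun i => a i + v i * t from by funext i; simp [add_comm]] at this
  rw [← this, MvPolynomial.eval_eq']
  refine Finset.sum_congr rfl fun σ _ => ?_
  simp only [Polynomial.eval_mul, Polynomial.eval_C, Polynomial.eval_pow, Polynomial.eval_X, mul_pow,
    Finset.prod_mul_distrib, Finset.prod_pow_eq_pow_sum]
  rw [Finsupp.degree_eq_sum]
  ring

/-- A single direction v with a non-zero coefficient of t^k thus bounds the multiplicity by k. -/
lemma coeff_lineRestr (F : MvPolynomial (Fin 3) ℂ) (a v : Fin 3 → ℂ) (k : ℕ) :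
    (lineRestr F a v).coeff k =
      MvPolynomial.eval v (MvPolynomial.homogeneousComponent k (taylor F a)) := by
  classical
  rw [lineRestr_eq_sum, Polynomial.finsetSum_coeff, MvPolynomial.homogeneousComponent_apply,
    map_sum, Finset.sum_filter]
  refine Finset.sum_congr rfl fun σ _ => ?_
  rw [Polynomial.coeff_C_mul, Polynomial.coeff_X_pow]
  by_cases h : σ.degree = k
  · rw [if_pos h, if_pos h.symm, mul_one, MvPolynomial.eval_monomial, Finsupp.prod_fintype _ _ (by simp)]
  · rw [if_neg h, if_neg (Ne.symm h), mul_zero]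

lemma multAt_le_of_coeff_ne_zero {F : MvPolynomial (Fin 3) ℂ} {a v : Fin 3 → ℂ} {k : ℕ}
    (h : (lineRestr F a v).coeff k ≠ 0) : multAt F a ≤ k :=
  multAt_le fun h0 => h (by rw [coeff_lineRestr, h0, map_zero])

lemma coeff_lineRestr_eq_zero {F : MvPolynomial (Fin 3) ℂ} {a : Fin 3 → ℂ} {k : ℕ}
    (hk : k < multAt F a) (v : Fin 3 → ℂ) : (lineRestr F a v).coeff k = 0 := by
  rw [coeff_lineRestr, component_eq_zero_of_lt_multAt hk, map_zero]

/-- The product of the two initial forms is non-zero. Along a direction where it does not vanish,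
both restrictions have their lowest terms exactly at the multiplicities. -/
lemma multAt_mul_le {F G : MvPolynomial (Fin 3) ℂ} (hF : F ≠ 0) (hG : G ≠ 0) (a : Fin 3 → ℂ) :
    multAt (F * G) a ≤ multAt F a + multAt G a := by
  obtain ⟨v, hv⟩ : ∃ v, MvPolynomial.eval v
      (MvPolynomial.homogeneousComponent (multAt F a) (taylor F a) *
        MvPolynomial.homogeneousComponent (multAt G a) (taylor G a)) ≠ 0 := by
    by_contra! h
    exact mul_ne_zero (component_multAt_ne_zero hF a) (component_multAt_ne_zero hG a)
      (MvPolynomial.funext fun v => by rw [h, map_zero])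
  rw [map_mul, ← coeff_lineRestr, ← coeff_lineRestr] at hv
  refine multAt_le_of_coeff_ne_zero (v := v) ?_
  rw [lineRestr_mul, Polynomial.coeff_mul, Finset.sum_eq_single (multAt F a, multAt G a)]
  · exact hv
  · rintro ⟨k, l⟩ hkl hne
    rw [Finset.HasAntidiagonal.mem_antidiagonal] at hkl
    simp only at hkl
    rcases lt_or_ge k (multAt F a) with h | h
    · simp only [coeff_lineRestr_eq_zero h, zero_mul]
    · have : l < multAt G a := by
        by_contra! hl
        exact hne (Prod.ext (show k = _ by omega) (show l = _ by omega))
      simp only [coeff_lineRestr_eq_zero this, mul_zero]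
  · intro h; exact (h (Finset.HasAntidiagonal.mem_antidiagonal.2 rfl)).elim

/-! #### Independence of the representative -/

lemma eval_bind_wscale (d : ℕ) (t : ℂ) (p : MvPolynomial (Fin 3) ℂ) (x : Fin 3 → ℂ) :
    MvPolynomial.eval x (MvPolynomial.bind₁
      ((fun i => MvPolynomial.C ((![t, t ^ d, t] : Fin 3 → ℂ) i) * MvPolynomial.X i)) p) =
      MvPolynomial.eval (wscale d t x) p := by
  rw [← MvPolynomial.coe_aeval_eq_eval, RingHom.coe_coe, MvPolynomial.aeval_bind₁,
    ← MvPolynomial.coe_aeval_eq_eval, RingHom.coe_coe]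
  congr 2
  funext i
  fin_cases i <;> simp [wscale]

/-- Scaling is a linear automorphism preserving the ideal of the origin, and by homogeneity it
carries the Taylor expansion at the scaled point to t^n times the one at a. -/
lemma le_multAt_of_wscale {d n k : ℕ} {F : MvPolynomial (Fin 3) ℂ} (hF0 : F ≠ 0)
    (hF : F.IsWeightedHomogeneous ![1, d, 1] n) {t : ℂ} (ht : t ≠ 0) {a : Fin 3 → ℂ}
    (h : k ≤ multAt F (wscale d t a)) : k ≤ multAt F a := by
  rw [le_multAt_iff hF0] at h ⊢
  set S := MvPolynomial.bind₁ (R := ℂ)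
      ((fun i => MvPolynomial.C ((![t, t ^ d, t] : Fin 3 → ℂ) i) * MvPolynomial.X i) :
        Fin 3 → MvPolynomial (Fin 3) ℂ) with hS
  have h1 : S (taylor F (wscale d t a)) = MvPolynomial.C (t ^ n) * taylor F a := by
    refine MvPolynomial.funext fun x => ?_
    rw [hS, eval_bind_wscale, eval_taylor, map_mul, MvPolynomial.eval_C, eval_taylor,
      ← eval_wscale hF]
    congr 2
    ext i
    fin_cases i <;> simp [wscale, mul_add]
  have h2 : (MvPolynomial.idealOfVars (Fin 3) ℂ ^ k).map S ≤
      MvPolynomial.idealOfVars (Fin 3) ℂ ^ k := by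
    rw [Ideal.map_pow]
    refine Ideal.pow_right_mono (Ideal.map_le_iff_le_comap.2 fun p hp => ?_) _
    rw [Ideal.mem_comap, mem_idealOfVars_iff, hS, eval_bind_wscale]
    rw [mem_idealOfVars_iff] at hp
    rw [← hp]
    congr 2
    ext i
    fin_cases i <;> simp [wscale]
  have h3 := h2 (Ideal.mem_map_of_mem S h)
  rw [h1] at h3
  have h4 := Ideal.mul_mem_left _ (MvPolynomial.C (t ^ n)⁻¹) h3
  rwa [← mul_assoc, ← MvPolynomial.C_mul, inv_mul_cancel₀ (pow_ne_zero _ ht), MvPolynomial.C_1,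
    one_mul] at h4

lemma multAt_wscale {d n : ℕ} {F : MvPolynomial (Fin 3) ℂ} (hF0 : F ≠ 0)
    (hF : F.IsWeightedHomogeneous ![1, d, 1] n) {t : ℂ} (ht : t ≠ 0) (a : Fin 3 → ℂ) :
    multAt F (wscale d t a) = multAt F a := by
  refine le_antisymm (le_multAt_of_wscale hF0 hF ht le_rfl)
    (le_multAt_of_wscale hF0 hF (inv_ne_zero ht) (a := wscale d t a) ?_)
  have : wscale d t⁻¹ (wscale d t a) = a := by
    ext i
    fin_cases i <;> simp [wscale, ht]
  rw [this]

lemma multAt_rep {d n : ℕ} {F : MvPolynomial (Fin 3) ℂ} (hF0 : F ≠ 0)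
    (hF : F.IsWeightedHomogeneous ![1, d, 1] n) (a : {a : Fin 3 → ℂ // a ≠ 0}) :
    multAt F (WPlane.mk d a).rep = multAt F a.1 := by
  have h : WPlane.mk d a = WPlane.mk d (Quotient.out (WPlane.mk d a)) := (Quotient.out_eq _).symm
  obtain ⟨t, ht, h⟩ := WPlane.mk_eq_mk.1 h
  rw [WPlane.rep, h, multAt_wscale hF0 hF ht]

/-! #### Multiplicities at the base points -/

lemma Couplings.member_ne_zero (hm : m = 2 ∨ m = 3 ∨ m = 4 ∨ m = 6) (c : Couplings m L)
    (α : Fin (m - 1) → ℂ) (z : ℂ) : member m L (c.bigQ α) z ≠ 0 := fun h => by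
  have := c.eval_member_vertex hm α z 1
  rw [h, map_zero, one_pow] at this
  exact zero_ne_one this

/-- Each complete block of s consecutive indices contains one congruent to j, which contributes a
factor in I. -/
lemma prod_range_mem_pow {R : Type*} [CommRing R] (I : Ideal R) (f : ℕ → R) {s j : ℕ} (hj : j < s)
    (h : ∀ k, f (j + k * s) ∈ I) (n : ℕ) : ∏ l ∈ Finset.range n, f l ∈ I ^ (n / s) := by
  have key : ∀ q, ∏ l ∈ Finset.range (q * s), f l ∈ I ^ q := by
    intro q
    induction q with
    | zero => simp
    | succ q ih =>
      rw [add_mul, one_mul, Finset.prod_range_add, pow_succ]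
      refine Ideal.mul_mem_mul ih ?_
      rw [← Finset.mul_prod_erase _ _ (Finset.mem_range.2 hj)]
      exact Ideal.mul_mem_right _ _ (by rw [add_comm]; exact h q)
  obtain ⟨r, hr⟩ := Nat.exists_eq_add_of_le (Nat.div_mul_le_self n s)
  have hp : ∏ l ∈ Finset.range n, f l =
      (∏ l ∈ Finset.range (n / s * s), f l) * ∏ l ∈ Finset.range r, f (n / s * s + l) := by
    rw [← Finset.prod_range_add, ← hr]
  rw [hp]
  exact Ideal.mul_mem_right _ _ (key _)

/-- After translation to the base point every term of Q - zP lies in I^{n_i}. The forms y - A_l with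
l ≡ j modulo m_i vanish there, x - e_i w vanishes too, and the exponents in B_k are chosen to make
up the difference. -/
lemma Couplings.mult_le_multAt (hm : m = 2 ∨ m = 3 ∨ m = 4 ∨ m = 6)
    (hL : IsSymmetricLattice m L) (c : Couplings m L) (α : Fin (m - 1) → ℂ) (z : ℂ)
    (i : Fin (numBranch m)) (j : Fin (stabOrder m i)) :
    mult m i ≤ multAt (member m L (c.bigQ α) z) (c.vec i j).1 := by
  rw [le_multAt_iff (c.member_ne_zero hm α z)]
  set a := (c.vec i j).1 with ha
  set I := MvPolynomial.idealOfVars (Fin 3) ℂ with hI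
  set T : MvPolynomial (Fin 3) ℂ →ₐ[ℂ] MvPolynomial (Fin 3) ℂ :=
    MvPolynomial.aeval fun i => MvPolynomial.X i + MvPolynomial.C (a i) with hT
  change T _ ∈ I ^ mult m i
  have hTmem : ∀ G : MvPolynomial (Fin 3) ℂ, MvPolynomial.eval a G = 0 → T G ∈ I := fun G hG =>
    taylor_mem_iff.2 hG
  have hprod : ∀ n, T (toPlane (∏ j ∈ Finset.range n,
      (Polynomial.X - Polynomial.C (c.aForm j)))) ∈ I ^ (n / stabOrder m i) := fun n => by
    rw [map_prod, map_prod]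
    refine prod_range_mem_pow I _ j.2 (fun k => hTmem _ ?_) n
    rw [map_sub, toPlane_X, toPlane_C, map_sub, MvPolynomial.eval_X, eval_rename_zero_two, ha, vec]
    simp only [Matrix.cons_val_zero, Matrix.cons_val_one, Matrix.cons_val, c.eval_aForm_e,
      c.mu_mod_stabOrder hm hL, sub_self]
  have hline : T (MvPolynomial.rename ![0, 2] (lineForm m L i)) ∈ I := hTmem _ (by
    rw [eval_rename_zero_two, eval_lineForm, ha, vec]; simp)
  have hB : ∀ k, T (MvPolynomial.rename ![0, 2] (bForm m L k)) ∈
      I ^ (mult m i - (m - k) / stabOrder m i) := fun k => by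
    have hd : lineForm m L i ^ (mult m i - (m - k) / stabOrder m i) ∣ bForm m L k := by
      rw [bForm]
      exact Dvd.dvd.mul_right (Dvd.dvd.mul_left (Finset.dvd_prod_of_mem
        (fun i => lineForm m L i ^ (mult m i - (m - k) / stabOrder m i)) (Finset.mem_univ i)) _) _
    obtain ⟨g, hg⟩ := hd
    rw [hg, map_mul, map_mul, map_pow, map_pow]
    exact Ideal.mul_mem_right _ _ (Ideal.pow_mem_pow hline _)
  rw [member, map_sub, bigQ, qPoly, map_add, map_add]
  refine Ideal.sub_mem _ (Ideal.add_mem _ ?_ ?_) ?_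
  · exact hprod m
  · rw [map_sum, map_sum]
    refine Ideal.sum_mem _ fun k _ => ?_
    rw [map_mul, map_mul, toPlane_C, map_mul, map_mul, mul_assoc]
    refine Ideal.mul_mem_left _ _ ?_
    -- The order ⌈k/m_i⌉ of B_k and the ⌊(m-k)/m_i⌋ vanishing factors together reach n_i.
    refine Ideal.pow_le_pow_right (show mult m i ≤ mult m i - (m - (k + 2)) / stabOrder m i +
      (m - (k + 2)) / stabOrder m i by omega) ?_
    rw [pow_add]
    exact Ideal.mul_mem_mul (hB _) (hprod _)
  · rw [map_mul]
    refine Ideal.mul_mem_left _ _ ?_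
    rw [homP, map_mul, map_prod, ← Finset.mul_prod_erase _ _ (Finset.mem_univ i), map_pow]
    refine Ideal.mul_mem_left _ _ (Ideal.mul_mem_right _ _ (Ideal.pow_mem_pow (hTmem _ ?_) _))
    rw [ha, vec]; simp

/-! ### Exact multiplicities in the generic case -/

lemma Couplings.Generic.vecInf_injective {c : Couplings m L} (hc : c.Generic) :
    Function.Injective fun j => (c.vecInf j).1 1 := fun _ _ h =>
  hc.1 (neg_injective h)

lemma Couplings.Generic.vec_injective (hm : m = 2 ∨ m = 3 ∨ m = 4 ∨ m = 6)
    (hL : IsSymmetricLattice m L) {c : Couplings m L} (hc : c.Generic) (i : Fin (numBranch m)) :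
    Function.Injective fun j => (c.vec i j).1 1 := fun j k h => by
  refine hc.2 i ?_
  have h1 : (mult m i : ℂ) ≠ 0 := Nat.cast_ne_zero.2 (mult_pos hm i).ne'
  have h2 : (mult m i : ℂ) * c.mu j (branchPt m L i) * eProd m L i =
    mult m i * c.mu k (branchPt m L i) * eProd m L i := h
  exact mul_left_cancel₀ h1 (mul_right_cancel₀ (eProd_ne_zero (e_injective hm hL) i) h2)

lemma Couplings.lineRestr_vecInf (hm : m = 2 ∨ m = 3 ∨ m = 4 ∨ m = 6)
    (hL : IsSymmetricLattice m L) (c : Couplings m L) {α : Fin (m - 1) → ℂ}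
    (hα : c.AlphaRelation α) (z : ℂ) (j : Fin m) :
    lineRestr (member m L (c.bigQ α) z) (c.vecInf j).1 ![0, 1, 0] = Polynomial.X ^ 1 *
      ∏ k ∈ Finset.univ.erase j,
        (Polynomial.X + Polynomial.C ((c.vecInf j).1 1 - (c.vecInf k).1 1)) := by
  refine Polynomial.funext fun t => ?_
  rw [eval_lineRestr, show (fun i => (c.vecInf j).1 i + (![0, 1, 0] : Fin 3 → ℂ) i * t) =
    ![1, (c.vecInf j).1 1 + t, 0] by ext i; fin_cases i <;> simp [vecInf],
    c.eval_member_inf hm hL hα, ← Finset.mul_prod_erase _ _ (Finset.mem_univ j)]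
  simp only [Polynomial.eval_mul, Polynomial.eval_prod, Polynomial.eval_add, Polynomial.eval_X,
    Polynomial.eval_C, pow_one]
  congr 1
  · ring
  · exact Finset.prod_congr rfl fun k _ => by ring

/-- The direction (0, 1, 0) stays inside ℓ_i, where the member is known explicitly. For distinct
points the cofactor of X^{n_i} does not vanish at 0, which bounds the multiplicity from above. -/
lemma Couplings.lineRestr_vec (hm : m = 2 ∨ m = 3 ∨ m = 4 ∨ m = 6)
    (hL : IsSymmetricLattice m L) (c : Couplings m L) (α : Fin (m - 1) → ℂ)
    (z : ℂ) (i : Fin (numBranch m)) (j : Fin (stabOrder m i)) :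
    lineRestr (member m L (c.bigQ α) z) (c.vec i j).1 ![0, 1, 0] = Polynomial.X ^ mult m i *
      ∏ k ∈ Finset.univ.erase j,
        (Polynomial.X + Polynomial.C ((c.vec i j).1 1 - (c.vec i k).1 1)) ^ mult m i := by
  refine Polynomial.funext fun t => ?_
  rw [eval_lineRestr, show (fun k => (c.vec i j).1 k + (![0, 1, 0] : Fin 3 → ℂ) k * t) =
    ![e m L i, (c.vec i j).1 1 + t, 1] by ext k; fin_cases k <;> simp [vec],
    c.eval_member_e hm hL, ← Finset.mul_prod_erase _ _ (Finset.mem_univ j)]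
  simp only [Polynomial.eval_mul, Polynomial.eval_prod, Polynomial.eval_add, Polynomial.eval_X,
    Polynomial.eval_C, Polynomial.eval_pow]
  congr 1
  · ring
  · exact Finset.prod_congr rfl fun k _ => by ring

lemma coeff_X_pow_mul_self (n : ℕ) (p : Polynomial ℂ) :
    (Polynomial.X ^ n * p).coeff n = p.eval 0 := by
  have := Polynomial.coeff_X_pow_mul p n 0
  rw [zero_add] at this
  rw [this, Polynomial.coeff_zero_eq_eval_zero]

lemma Couplings.multAt_vecInf (hm : m = 2 ∨ m = 3 ∨ m = 4 ∨ m = 6)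
    (hL : IsSymmetricLattice m L) (c : Couplings m L) {α : Fin (m - 1) → ℂ}
    (hα : c.AlphaRelation α) (hc : c.Generic) (z : ℂ) (j : Fin m) :
    multAt (member m L (c.bigQ α) z) (c.vecInf j).1 = 1 := by
  refine le_antisymm (multAt_le_of_coeff_ne_zero (v := ![0, 1, 0]) ?_) ?_
  · rw [c.lineRestr_vecInf hm hL hα, coeff_X_pow_mul_self, Polynomial.eval_prod,
      Finset.prod_ne_zero_iff]
    intro k hk
    simpa using sub_ne_zero.2 (hc.vecInf_injective.ne (Finset.ne_of_mem_erase hk).symm)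
  · rw [le_multAt_iff (c.member_ne_zero hm α z), pow_one, taylor_mem_iff, vecInf,
      c.eval_member_inf hm hL hα, Finset.prod_eq_zero (Finset.mem_univ j)]
    simp [vecInf]

/-- The coefficient of `y^n` in the initial form at a base point. -/
lemma Couplings.coeff_lineRestr_vec_ne_zero (hm : m = 2 ∨ m = 3 ∨ m = 4 ∨ m = 6)
    (hL : IsSymmetricLattice m L) (c : Couplings m L) (α : Fin (m - 1) → ℂ)
    (hc : c.Generic) (z : ℂ) (i : Fin (numBranch m)) (j : Fin (stabOrder m i)) :
    (lineRestr (member m L (c.bigQ α) z) (c.vec i j).1 ![0, 1, 0]).coeff (mult m i) ≠ 0 := by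
  rw [c.lineRestr_vec hm hL, coeff_X_pow_mul_self, Polynomial.eval_prod, Finset.prod_ne_zero_iff]
  intro k hk
  simpa using fun h => absurd h
    (sub_ne_zero.2 ((hc.vec_injective hm hL i).ne (Finset.ne_of_mem_erase hk).symm))

lemma Couplings.multAt_vec (hm : m = 2 ∨ m = 3 ∨ m = 4 ∨ m = 6)
    (hL : IsSymmetricLattice m L) (c : Couplings m L) (α : Fin (m - 1) → ℂ)
    (hc : c.Generic) (z : ℂ) (i : Fin (numBranch m)) (j : Fin (stabOrder m i)) :
    multAt (member m L (c.bigQ α) z) (c.vec i j).1 = mult m i :=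
  le_antisymm (multAt_le_of_coeff_ne_zero (c.coeff_lineRestr_vec_ne_zero hm hL α hc z i j))
    (c.mult_le_multAt hm hL α z i j)

/-! ### Initial forms -/

/-- The restriction of the degree `k` part of the Taylor expansion to the line `x = 1, w = 0`. -/
def slice (F : MvPolynomial (Fin 3) ℂ) (a : Fin 3 → ℂ) (k : ℕ) : Polynomial ℂ :=
  MvPolynomial.aeval ![1, Polynomial.X, 0] (MvPolynomial.homogeneousComponent k (taylor F a))

lemma eval_slice (F : MvPolynomial (Fin 3) ℂ) (a : Fin 3 → ℂ) (k : ℕ) (s : ℂ) :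
    (slice F a k).eval s =
      MvPolynomial.eval ![1, s, 0] (MvPolynomial.homogeneousComponent k (taylor F a)) := by
  rw [slice, ← Polynomial.coe_aeval_eq_eval, MvPolynomial.comp_aeval_apply,
    ← MvPolynomial.coe_aeval_eq_eval, RingHom.coe_coe]
  congr 2
  funext i
  fin_cases i <;> simp

lemma eval_slice_eq_coeff (F : MvPolynomial (Fin 3) ℂ) (a : Fin 3 → ℂ) (k : ℕ) (s : ℂ) :
    (slice F a k).eval s = (lineRestr F a ![1, s, 0]).coeff k := by
  rw [eval_slice, coeff_lineRestr]

/-- A form restricted to an affine line: degree and leading coefficient. -/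
lemma aeval_slice_facts {n : ℕ} {p : MvPolynomial (Fin 3) ℂ} (hp : p.IsHomogeneous n) :
    (MvPolynomial.aeval (![1, Polynomial.X, 0] : Fin 3 → Polynomial ℂ) p).natDegree ≤ n ∧
    (MvPolynomial.aeval (![1, Polynomial.X, 0] : Fin 3 → Polynomial ℂ) p).coeff n =
      MvPolynomial.eval ![0, 1, 0] p := by
  have hsum : ∀ σ ∈ p.support, σ 0 + σ 1 + σ 2 = n := fun σ hσ => by
    have := hp (MvPolynomial.mem_support_iff.1 hσ)
    rw [Finsupp.weight_apply, Finsupp.sum_fintype _ _ (by simp), Fin.sum_univ_three] at this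
    simpa using this
  have hterm : MvPolynomial.aeval (![1, Polynomial.X, 0] : Fin 3 → Polynomial ℂ) p =
      ∑ σ ∈ p.support, Polynomial.C (p.coeff σ * 0 ^ σ 2) * Polynomial.X ^ σ 1 := by
    rw [MvPolynomial.aeval_def, MvPolynomial.eval₂_eq']
    refine Finset.sum_congr rfl fun σ _ => ?_
    simp [Fin.prod_univ_three, mul_assoc, mul_comm]
  constructor
  · rw [hterm]
    refine Polynomial.natDegree_sum_le_of_forall_le _ _ fun σ hσ => ?_
    refine (Polynomial.natDegree_C_mul_X_pow_le _ _).trans ?_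
    have := hsum σ hσ
    omega
  · rw [hterm, Polynomial.finsetSum_coeff, MvPolynomial.eval_eq']
    refine Finset.sum_congr rfl fun σ hσ => ?_
    have h := hsum σ hσ
    rw [Polynomial.coeff_C_mul, Polynomial.coeff_X_pow, Fin.prod_univ_three]
    simp only [Matrix.cons_val_zero, Matrix.cons_val_one, Matrix.cons_val, one_pow, mul_one]
    by_cases h1 : n = σ 1
    · have h0 : σ 0 = 0 := by omega
      have h2 : σ 2 = 0 := by omega
      simp [h0, h1, h2]
    · rw [if_neg h1]
      by_cases h0 : σ 0 = 0
      · have h2 : σ 2 ≠ 0 := by omega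
        simp [h2]
      · simp [h0]

lemma natDegree_slice_le (F : MvPolynomial (Fin 3) ℂ) (a : Fin 3 → ℂ) (k : ℕ) :
    (slice F a k).natDegree ≤ k :=
  (aeval_slice_facts (MvPolynomial.homogeneousComponent_isHomogeneous _ _)).1

lemma coeff_slice_self (F : MvPolynomial (Fin 3) ℂ) (a : Fin 3 → ℂ) (k : ℕ) :
    (slice F a k).coeff k = (lineRestr F a ![0, 1, 0]).coeff k := by
  rw [coeff_lineRestr]
  exact (aeval_slice_facts (MvPolynomial.homogeneousComponent_isHomogeneous _ _)).2

/-- The value does not depend on s, so a change of z moves the sliced initial form only by a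
constant. -/
lemma coeff_lineRestr_homP (i : Fin (numBranch m)) (b s : ℂ) :
    (lineRestr (homP m L) ![e m L i, b, 1] ![1, s, 0]).coeff (mult m i) =
      ∏ k ∈ Finset.univ.erase i, (e m L i - e m L k) ^ mult m k := by
  have : lineRestr (homP m L) ![e m L i, b, 1] ![1, s, 0] = Polynomial.X ^ mult m i *
      ∏ k ∈ Finset.univ.erase i,
        (Polynomial.X + Polynomial.C (e m L i - e m L k)) ^ mult m k := by
    refine Polynomial.funext fun t => ?_
    rw [eval_lineRestr, eval_homP, ← Finset.mul_prod_erase _ _ (Finset.mem_univ i)]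
    simp only [Matrix.cons_val_zero, Matrix.cons_val, Polynomial.eval_mul,
      Polynomial.eval_prod, Polynomial.eval_add, Polynomial.eval_X, Polynomial.eval_C,
      Polynomial.eval_pow, one_mul, mul_one, zero_mul, add_zero]
    congr 1
    · ring
    · exact Finset.prod_congr rfl fun k _ => by ring
  rw [this, coeff_X_pow_mul_self, Polynomial.eval_prod]
  simp

/-- The initial forms of the members of the pencil at a base point. -/
lemma Couplings.slice_member (c : Couplings m L) (α : Fin (m - 1) → ℂ)
    (z : ℂ) (i : Fin (numBranch m)) (j : Fin (stabOrder m i)) :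
    slice (member m L (c.bigQ α) z) (c.vec i j).1 (mult m i) =
      slice (member m L (c.bigQ α) 0) (c.vec i j).1 (mult m i) -
        Polynomial.C (z * ∏ k ∈ Finset.univ.erase i, (e m L i - e m L k) ^ mult m k) := by
  refine Polynomial.funext fun s => ?_
  have h : ∀ z, lineRestr (member m L (c.bigQ α) z) (c.vec i j).1 ![1, s, 0] =
      lineRestr (c.bigQ α) (c.vec i j).1 ![1, s, 0] -
        Polynomial.C z * lineRestr (homP m L) (c.vec i j).1 ![1, s, 0] := fun z => by
    refine Polynomial.funext fun t => ?_
    simp only [Polynomial.eval_sub, Polynomial.eval_mul, Polynomial.eval_C, eval_lineRestr,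
      eval_member]
  rw [Polynomial.eval_sub, Polynomial.eval_C, eval_slice_eq_coeff, eval_slice_eq_coeff, h z, h 0]
  simp only [Polynomial.coeff_sub, Polynomial.coeff_C_mul, zero_mul, sub_zero]
  rw [vec, coeff_lineRestr_homP]

/-- A polynomial of degree `n` translated by all but finitely many constants has `n` distinct
roots. -/
lemma exists_finite_roots {n : ℕ} (hn : 0 < n) {p : Polynomial ℂ} (hp : p.natDegree ≤ n)
    (hlead : p.coeff n ≠ 0) {γ : ℂ} (hγ : γ ≠ 0) :
    ∃ Z : Set ℂ, Z.Finite ∧ ∀ z ∉ Z, ∃ r : Fin n → ℂ, Function.Injective r ∧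
      (∀ k, (p - Polynomial.C (z * γ)).eval (r k) = 0 ∧
        (p - Polynomial.C (z * γ)).derivative.eval (r k) ≠ 0) ∧
      p - Polynomial.C (z * γ) =
        Polynomial.C (p.coeff n) * ∏ k, (Polynomial.X - Polynomial.C (r k)) := by
  have hdeg : p.natDegree = n := le_antisymm hp (Polynomial.le_natDegree_of_ne_zero hlead)
  have hp' : p.derivative ≠ 0 := fun h => by
    have := Polynomial.derivative_eq_zero.1 h
    omega
  -- A multiple root of p - zγ is a critical point of p with value zγ, and p' has finitely many
  -- roots.
  refine ⟨(fun s => p.eval s / γ) '' {s | p.derivative.IsRoot s},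
    (Polynomial.finite_setOfPred_isRoot hp').image _, fun z hz => ?_⟩
  set q := p - Polynomial.C (z * γ) with hq
  have hqd : q.derivative = p.derivative := by simp [hq]
  have hqn : q.natDegree = n := by rw [hq, Polynomial.natDegree_sub_C, hdeg]
  have hql : q.leadingCoeff = p.coeff n := by
    rw [Polynomial.leadingCoeff, hqn, hq, Polynomial.coeff_sub, Polynomial.coeff_C,
      if_neg hn.ne', sub_zero]
  have hq0 : q ≠ 0 := fun h => by rw [h] at hqn; simp at hqn; omega
  have hsimple : ∀ s, q.eval s = 0 → q.derivative.eval s ≠ 0 := fun s hs hs' => hz ⟨s, by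
    rw [hqd] at hs'; exact hs', by
    rw [hq, Polynomial.eval_sub, Polynomial.eval_C, sub_eq_zero] at hs
    change p.eval s / γ = z
    rw [hs, mul_div_cancel_right₀ _ hγ]⟩
  have hnodup : q.roots.Nodup := by
    rw [Multiset.nodup_iff_count_le_one]
    intro s
    rw [Polynomial.count_roots]
    by_contra! h
    have := (Polynomial.one_lt_rootMultiplicity_iff_isRoot hq0).1 h
    exact hsimple s this.1 this.2
  have hsplit := IsAlgClosed.splits q
  have hcard : q.roots.toFinset.card = n := by
    rw [Multiset.toFinset_card_of_nodup hnodup, ← hsplit.natDegree_eq_card_roots, hqn]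
  let r : Fin n ≃ q.roots.toFinset := (finCongr hcard.symm).trans q.roots.toFinset.equivFin.symm
  have hroot : ∀ k, q.eval (r k : ℂ) = 0 := fun k => by
    have := (r k).2
    rw [Multiset.mem_toFinset, Polynomial.mem_roots hq0] at this
    exact this
  refine ⟨fun k => r k, fun k l h => r.injective (Subtype.ext h), fun k =>
    ⟨hroot k, hsimple _ (hroot k)⟩, ?_⟩
  rw [r.prod_comp (fun x => Polynomial.X - Polynomial.C (x : ℂ)), ← hql,
    Finset.prod_coe_sort q.roots.toFinset fun x => Polynomial.X - Polynomial.C x]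
  conv_lhs => rw [hsplit.eq_prod_roots]
  congr 1
  rw [Finset.prod, Multiset.toFinset_val, hnodup.dedup]

/-- Along a curved arc X·h the lowest coefficient sees only the tangent vector h(0). This is applied
to arcs bent by the scaling action. -/
lemma coeff_aeval_X_mul {k : ℕ} {T : MvPolynomial (Fin 3) ℂ}
    (hT : ∀ l < k, MvPolynomial.homogeneousComponent l T = 0) (h : Fin 3 → Polynomial ℂ) :
    (MvPolynomial.aeval (fun i => Polynomial.X * h i) T).coeff k =
      MvPolynomial.eval (fun i => (h i).eval 0) (MvPolynomial.homogeneousComponent k T) := by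
  classical
  rw [MvPolynomial.aeval_def, MvPolynomial.eval₂_eq', MvPolynomial.homogeneousComponent_apply,
    map_sum, Finset.sum_filter, Polynomial.finsetSum_coeff]
  refine Finset.sum_congr rfl fun σ hσ => ?_
  have hp : ∏ i, (Polynomial.X * h i) ^ σ i = Polynomial.X ^ σ.degree * ∏ i, h i ^ σ i := by
    simp only [mul_pow, Finset.prod_mul_distrib, Finset.prod_pow_eq_pow_sum]
    rw [Finsupp.degree_eq_sum]
  rw [hp, ← Polynomial.C_eq_algebraMap, Polynomial.coeff_C_mul]
  rcases lt_trichotomy σ.degree k with hlt | rfl | hlt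
  · exact absurd (homogeneousComponent_eq_zero_iff.1 (hT _ hlt) σ rfl)
      (MvPolynomial.mem_support_iff.1 hσ)
  · rw [coeff_X_pow_mul_self, if_pos rfl, MvPolynomial.eval_monomial,
      Finsupp.prod_fintype _ _ (by simp), Polynomial.eval_prod]
    simp only [Polynomial.eval_pow]
  · rw [if_neg hlt.ne', Polynomial.coeff_X_pow_mul', if_neg (by omega), mul_zero]

/-- The initial form at `a` is invariant under translations along the orbit of `a`. -/
lemma eval_initial_add {d n k : ℕ} {F : MvPolynomial (Fin 3) ℂ}
    (hF : F.IsWeightedHomogeneous ![1, d, 1] n) {a : Fin 3 → ℂ} (hk : k ≤ multAt F a)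
    (x : Fin 3 → ℂ) :
    MvPolynomial.eval (x + ![a 0, d * a 1, a 2])
      (MvPolynomial.homogeneousComponent k (taylor F a)) =
    MvPolynomial.eval x (MvPolynomial.homogeneousComponent k (taylor F a)) := by
  have hTk : ∀ l < k, MvPolynomial.homogeneousComponent l (taylor F a) = 0 := fun l hl =>
    component_eq_zero_of_lt_multAt (hl.trans_le hk)
  -- The choice makes a + X h equal to the scalar 1 + X acting on a + X x; the geometric sum is ((1
  -- + X)^d - 1)/X. Its tangent vector at X = 0 is x plus the orbit direction.
  set h : Fin 3 → Polynomial ℂ := ![Polynomial.C (a 0) + (1 + Polynomial.X) * Polynomial.C (x 0),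
    (∑ j ∈ Finset.range d, (1 + Polynomial.X) ^ j) * Polynomial.C (a 1) +
      (1 + Polynomial.X) ^ d * Polynomial.C (x 1),
    Polynomial.C (a 2) + (1 + Polynomial.X) * Polynomial.C (x 2)] with hh
  have h0 : (fun i => (h i).eval 0) = x + ![a 0, d * a 1, a 2] := by
    ext i
    fin_cases i <;> simp [hh, Polynomial.eval_finsetSum] <;> ring
  have key : MvPolynomial.aeval (fun i => Polynomial.X * h i) (taylor F a) =
      (1 + Polynomial.X) ^ n * MvPolynomial.aeval (fun i => Polynomial.X * Polynomial.C (x i))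
        (taylor F a) := by
    have hev : ∀ (g : Fin 3 → Polynomial ℂ) (t : ℂ),
        (MvPolynomial.aeval (fun i => Polynomial.X * g i) (taylor F a)).eval t =
          MvPolynomial.eval (fun i => t * (g i).eval t + a i) F := fun g t => by
      rw [← Polynomial.coe_aeval_eq_eval, MvPolynomial.comp_aeval_apply]
      have := eval_taylor F a (fun i => t * (g i).eval t)
      rw [← MvPolynomial.coe_aeval_eq_eval, RingHom.coe_coe] at this
      simp only [Polynomial.aeval_mul, Polynomial.aeval_X, Polynomial.coe_aeval_eq_eval]
      exact this
    refine Polynomial.funext fun t => ?_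
    rw [Polynomial.eval_mul, hev, hev]
    simp only [Polynomial.eval_pow, Polynomial.eval_add, Polynomial.eval_one, Polynomial.eval_X,
      Polynomial.eval_C]
    rw [← eval_wscale hF]
    congr 2
    have hg := mul_geom_sum (1 + t) d
    rw [add_sub_cancel_left] at hg
    ext i
    fin_cases i <;> simp [hh, wscale, Polynomial.eval_finsetSum]
    · ring
    · linear_combination a 1 * hg
    · ring
  have h1 := coeff_aeval_X_mul hTk h
  rw [h0] at h1
  rw [← h1, key]
  obtain ⟨p, hp⟩ : Polynomial.X ^ k ∣
      MvPolynomial.aeval (fun i => Polynomial.X * Polynomial.C (x i)) (taylor F a) := by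
    rw [Polynomial.X_pow_dvd_iff]
    intro l hl
    rw [coeff_aeval_X_mul (fun l' hl' => hTk l' (hl'.trans hl)), hTk l hl, map_zero]
  have h2 := coeff_aeval_X_mul hTk (fun i => Polynomial.C (x i))
  simp only [Polynomial.eval_C] at h2
  rw [← h2, hp, mul_left_comm, coeff_X_pow_mul_self, coeff_X_pow_mul_self, Polynomial.eval_mul]
  simp

lemma eval_smul_of_isHomogeneous {k : ℕ} {p : MvPolynomial (Fin 3) ℂ} (hp : p.IsHomogeneous k)
    (t : ℂ) (x : Fin 3 → ℂ) :
    MvPolynomial.eval (t • x) p = t ^ k * MvPolynomial.eval x p := by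
  rw [MvPolynomial.eval_eq', MvPolynomial.eval_eq', Finset.mul_sum]
  refine Finset.sum_congr rfl fun σ hσ => ?_
  have h : σ.degree = k := by
    rw [Finsupp.degree_eq_weight_one]
    exact hp (MvPolynomial.mem_support_iff.1 hσ)
  simp only [← h, Pi.smul_apply, smul_eq_mul, mul_pow, Finset.prod_mul_distrib,
    Finset.prod_pow_eq_pow_sum, ← Finsupp.degree_eq_sum]
  ring

lemma eval_initial_add_smul {d n k : ℕ} {F : MvPolynomial (Fin 3) ℂ}
    (hF : F.IsWeightedHomogeneous ![1, d, 1] n) {a : Fin 3 → ℂ} (hk : k ≤ multAt F a)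
    (x : Fin 3 → ℂ) (t : ℂ) :
    MvPolynomial.eval (x + t • ![a 0, d * a 1, a 2])
      (MvPolynomial.homogeneousComponent k (taylor F a)) =
    MvPolynomial.eval x (MvPolynomial.homogeneousComponent k (taylor F a)) := by
  rcases eq_or_ne t 0 with rfl | ht
  · simp
  · have hh := MvPolynomial.homogeneousComponent_isHomogeneous k (taylor F a)
    have h1 : x + t • ![a 0, d * a 1, a 2] = t • (t⁻¹ • x + ![a 0, d * a 1, a 2]) := by
      rw [smul_add, smul_inv_smul₀ ht]
    rw [h1, eval_smul_of_isHomogeneous hh, eval_initial_add hF hk, ← eval_smul_of_isHomogeneous hh,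
      smul_inv_smul₀ ht]

/-- At a point of the chart `w = 1`, the initial form is determined by its restriction to the line
`x = 1, w = 0`. -/
lemma eval_initial_eq {d n k : ℕ} {F : MvPolynomial (Fin 3) ℂ}
    (hF : F.IsWeightedHomogeneous ![1, d, 1] n) {e b : ℂ} (hk : k ≤ multAt F ![e, b, 1])
    {δ : ℂ} {r : Fin k → ℂ}
    (hs : slice F ![e, b, 1] k = Polynomial.C (δ ^ k) * ∏ l, (Polynomial.X - Polynomial.C (r l))) :
    MvPolynomial.homogeneousComponent k (taylor F ![e, b, 1]) =
      ∏ l, ∑ i, MvPolynomial.C ((![-(δ * r l), δ, δ * (r l * e - d * b)] : Fin 3 → ℂ) i) *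
        MvPolynomial.X i := by
  have hh := MvPolynomial.homogeneousComponent_isHomogeneous k (taylor F ![e, b, 1])
  refine MvPolynomial.funext fun x => ?_
  -- Subtracting x₂ times the orbit direction (e, db, 1) moves the argument into w = 0, where the
  -- slice gives the value.
  have h1 := eval_initial_add_smul hF hk x (-x 2)
  have h2 : x + -x 2 • ![(![e, b, 1] : Fin 3 → ℂ) 0, d * (![e, b, 1] : Fin 3 → ℂ) 1,
      (![e, b, 1] : Fin 3 → ℂ) 2] = ![x 0 - e * x 2, x 1 - d * b * x 2, 0] := by
    ext i
    fin_cases i <;> simp <;> ring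
  rw [h2] at h1
  rw [← h1]
  have hR : MvPolynomial.eval x (∏ l, ∑ i,
      MvPolynomial.C ((![-(δ * r l), δ, δ * (r l * e - d * b)] : Fin 3 → ℂ) i) *
        MvPolynomial.X i) =
      δ ^ k * ∏ l, ((x 1 - d * b * x 2) - r l * (x 0 - e * x 2)) := by
    have hc : δ ^ k = ∏ _l : Fin k, δ := by simp
    rw [hc, ← Finset.prod_mul_distrib, map_prod]
    refine Finset.prod_congr rfl fun l _ => ?_
    rw [Fin.sum_univ_three]
    simp
    ring
  rw [hR]
  generalize x 0 - e * x 2 = ξ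
  generalize x 1 - d * b * x 2 = η
  rcases eq_or_ne ξ 0 with rfl | hξ
  · have h3 : (![0, η, 0] : Fin 3 → ℂ) = η • ![0, 1, 0] := by
      ext i; fin_cases i <;> simp
    have h4 := coeff_slice_self F ![e, b, 1] k
    rw [coeff_lineRestr] at h4
    have h5 : (∏ l, (Polynomial.X - Polynomial.C (r l))).coeff k = 1 := by
      have hm := Polynomial.monic_prod_of_monic Finset.univ
        (fun l => Polynomial.X - Polynomial.C (r l)) fun l _ => Polynomial.monic_X_sub_C _
      have := hm.coeff_natDegree
      rwa [Polynomial.natDegree_prod_of_monic _ _ fun l _ => Polynomial.monic_X_sub_C _,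
        Finset.sum_congr rfl fun l _ => Polynomial.natDegree_X_sub_C (r l), Finset.sum_const,
        Finset.card_univ, Fintype.card_fin, smul_eq_mul, mul_one] at this
    rw [h3, eval_smul_of_isHomogeneous hh, ← h4, hs, Polynomial.coeff_C_mul, h5]
    simp; ring
  · have h3 : (![ξ, η, 0] : Fin 3 → ℂ) = ξ • ![1, η / ξ, 0] := by
      ext i; fin_cases i <;> simp [mul_div_cancel₀ _ hξ]
    rw [h3, eval_smul_of_isHomogeneous hh, ← eval_slice, hs, Polynomial.eval_mul,
      Polynomial.eval_prod, Polynomial.eval_C]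
    simp only [Polynomial.eval_sub, Polynomial.eval_X, Polynomial.eval_C]
    have hc : ξ ^ k = ∏ _l : Fin k, ξ := by simp
    rw [mul_left_comm, hc, ← Finset.prod_mul_distrib]
    congr 1
    refine Finset.prod_congr rfl fun l _ => ?_
    field_simp

lemma isOrdinaryAt_of_slice {d n : ℕ} {F : MvPolynomial (Fin 3) ℂ}
    (hF : F.IsWeightedHomogeneous ![1, d, 1] n) {e b : ℂ} {k : ℕ} (hk : multAt F ![e, b, 1] = k)
    (hk0 : 0 < k) {c : ℂ} (hc : c ≠ 0) {r : Fin k → ℂ} (hr : Function.Injective r)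
    (hs : slice F ![e, b, 1] k = Polynomial.C c * ∏ l, (Polynomial.X - Polynomial.C (r l))) :
    IsOrdinaryAt F ![e, b, 1] := by
  subst hk
  -- A k-th root of the leading coefficient is distributed over the k linear factors.
  obtain ⟨δ, rfl⟩ := IsAlgClosed.exists_pow_nat_eq c hk0
  have hδ : δ ≠ 0 := fun h => hc (by rw [h, zero_pow hk0.ne'])
  refine ⟨fun l => ![-(δ * r l), δ, δ * (r l * e - d * b)], fun k l hkl => ?_,
    eval_initial_eq hF le_rfl hs⟩
  rw [LinearIndependent.pair_iff]
  intro s t hst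
  have h0 := congrFun hst 0
  have h1 := congrFun hst 1
  simp only [Pi.add_apply, Pi.smul_apply, Matrix.cons_val_zero, Matrix.cons_val_one,
    smul_eq_mul, Pi.zero_apply] at h0 h1
  have h2 : s + t = 0 := mul_right_cancel₀ hδ (by linear_combination h1)
  have h3 : s * (r k - r l) = 0 := mul_right_cancel₀ hδ (by
    linear_combination -h0 - r l * δ * h2)
  have h4 := (mul_eq_zero.1 h3).resolve_right (sub_ne_zero.2 (hr.ne hkl))
  exact ⟨h4, by linear_combination h2 - h4⟩

/-! ### Branches -/

/-- The implicit function theorem at a simple root of the fibre over `0`. -/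
lemma exists_analytic_root (H : MvPolynomial (Fin 2) ℂ) (q : Polynomial ℂ)
    (hq : ∀ s, MvPolynomial.eval ![0, s] H = q.eval s) {r : ℂ} (h0 : q.eval r = 0)
    (h1 : q.derivative.eval r ≠ 0) :
    ∃ ψ : ℂ → ℂ, AnalyticAt ℂ ψ 0 ∧ ψ 0 = r ∧
      ∀ᶠ t in 𝓝 (0 : ℂ), MvPolynomial.eval ![t, ψ t] H = 0 := by
  set f : ℂ × ℂ → ℂ := fun x => MvPolynomial.eval ![x.1, x.2] H with hf
  have hfa : AnalyticAt ℂ f (0, r) := by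
    have : f = fun x : ℂ × ℂ => MvPolynomial.aeval (![x.1, x.2] : Fin 2 → ℂ) H := by
      funext x; simp only [hf]; rw [← MvPolynomial.coe_aeval_eq_eval, RingHom.coe_coe]
    rw [this]
    refine AnalyticAt.aeval_mvPolynomial (fun i => ?_) H
    fin_cases i
    · exact analyticAt_fst
    · exact analyticAt_snd
  have hc : ContDiffAt ℂ ⊤ f (0, r) := hfa.contDiffAt
  have hd : HasFDerivAt (fun s => f (0, s)) (fderiv ℂ f (0, r) ∘L .inr ℂ ℂ ℂ) r :=
    (hfa.differentiableAt.hasFDerivAt (x := (0, r))).comp r (hasFDerivAt_prodMk_right (0 : ℂ) r)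
  have hd' : HasFDerivAt (fun s => f (0, s))
      (ContinuousLinearMap.toSpanSingleton ℂ (q.derivative.eval r)) r := by
    have : (fun s => f (0, s)) = fun s => q.eval s := by funext s; exact hq s
    rw [this]
    exact (q.hasDerivAt r).hasFDerivAt
  -- The partial derivative in the second variable is multiplication by q'(r), which is non-zero.
  have hinv : (fderiv ℂ f (0, r) ∘L .inr ℂ ℂ ℂ).IsInvertible := by
    rw [hd.unique hd']
    refine ⟨ContinuousLinearEquiv.unitsEquivAut ℂ (Units.mk0 _ h1), ?_⟩
    ext
    simp
  refine ⟨hc.implicitFunction (by simp) hinv,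
    (hc.contDiffAt_implicitFunction (by simp) hinv).analyticAt,
    hc.implicitFunction_apply_self (by simp) hinv, ?_⟩
  filter_upwards [hc.eventually_apply_implicitFunction (by simp) hinv] with t ht
  rw [show f (0, r) = 0 from (hq r).trans h0] at ht
  exact ht

lemma derivative_eval_ne_zero_of_prod {ι : Type*} [Fintype ι] {r : ι → ℂ}
    (hr : Function.Injective r) (k : ι) :
    (∏ l, (Polynomial.X - Polynomial.C (r l))).derivative.eval (r k) ≠ 0 := by
  have hs : (∏ l, (Polynomial.X - Polynomial.C (r l))).Separable :=
    Polynomial.separable_prod_X_sub_C_iff.2 hr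
  refine hs.eval₂_derivative_ne_zero (RingHom.id ℂ) (x := r k) ?_
  rw [← Polynomial.eval, Polynomial.eval_prod]
  exact Finset.prod_eq_zero (Finset.mem_univ k) (by simp)

/-- A monic polynomial with as many distinct roots as its degree. -/
lemma eval_eq_prod_of_roots {ι : Type*} [Fintype ι] {p : Polynomial ℂ} (hp : p.Monic)
    (hd : p.natDegree = Fintype.card ι) {r : ι → ℂ} (hr : Function.Injective r)
    (h : ∀ k, p.eval (r k) = 0) : p = ∏ k, (Polynomial.X - Polynomial.C (r k)) := by
  have hm : (∏ k, (Polynomial.X - Polynomial.C (r k))).Monic :=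
    Polynomial.monic_prod_of_monic _ _ fun k _ => Polynomial.monic_X_sub_C _
  refine (Polynomial.eq_of_monic_of_dvd_of_natDegree_le hm hp ?_ ?_)
  · refine Finset.prod_dvd_of_coprime (fun k _ l _ hkl => ?_) fun k _ =>
      Polynomial.dvd_iff_isRoot.2 (h k)
    exact Polynomial.pairwise_coprime_X_sub_C hr hkl
  · rw [hd, Polynomial.natDegree_prod_of_monic _ _ fun k _ => Polynomial.monic_X_sub_C _]
    simp

/-- The restriction of a member of the pencil to a line through `(0 : 1 : 0)`. -/
def Couplings.fibre (c : Couplings m L) (α : Fin (m - 1) → ℂ) (z x w : ℂ) : Polynomial ℂ :=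
  (c.qPoly α).map (MvPolynomial.eval ![x, w]) -
    Polynomial.C (z * MvPolynomial.eval ![x, 0, w] (homP m L))

lemma Couplings.eval_fibre (c : Couplings m L) (α : Fin (m - 1) → ℂ) (z x w y : ℂ) :
    (c.fibre α z x w).eval y = MvPolynomial.eval ![x, y, w] (member m L (c.bigQ α) z) := by
  rw [fibre, eval_member, bigQ, eval_toPlane, eval_homP, eval_homP]
  simp [Polynomial.eval_prod]

lemma Couplings.fibre_monic (hm : m = 2 ∨ m = 3 ∨ m = 4 ∨ m = 6) (c : Couplings m L)
    (α : Fin (m - 1) → ℂ) (z x w : ℂ) :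
    (c.fibre α z x w).Monic ∧ (c.fibre α z x w).natDegree = m := by
  have h1 : (c.fibre α z x w).coeff m = 1 := by
    rw [fibre, Polynomial.coeff_sub, Polynomial.coeff_map, (c.qPoly_monic hm α).1,
      Polynomial.coeff_C, if_neg (by omega), map_one, sub_zero]
  have h2 : (c.fibre α z x w).natDegree ≤ m := by
    rw [Polynomial.natDegree_le_iff_coeff_eq_zero]
    intro k hk
    rw [fibre, Polynomial.coeff_sub, Polynomial.coeff_map, (c.isGraded_qPoly hm α k).1 hk,
      Polynomial.coeff_C, if_neg (by omega), map_zero, sub_zero]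
  exact ⟨Polynomial.monic_of_natDegree_le_of_coeff_eq_one m h2 h1,
    le_antisymm h2 (Polynomial.le_natDegree_of_ne_zero (by rw [h1]; exact one_ne_zero))⟩

lemma eventually_injective {ι : Type*} [Finite ι] {x₀ : ℂ} {Y : ι → ℂ → ℂ}
    (hY : ∀ i, ContinuousAt (Y i) x₀) (h : Function.Injective fun i => Y i x₀) :
    ∀ᶠ x in 𝓝 x₀, Function.Injective fun i => Y i x := by
  have : ∀ i j, i ≠ j → ∀ᶠ x in 𝓝 x₀, Y i x ≠ Y j x := fun i j hij =>
    ((hY i).ne_iff_eventually_ne (hY j)).1 (h.ne hij)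
  have h2 : ∀ᶠ x in 𝓝 x₀, ∀ i j, i ≠ j → Y i x ≠ Y j x := by
    simp only [eventually_all]
    exact fun i j hij => this i j hij
  filter_upwards [h2] with x hx i j hij
  by_contra hne
  exact hx i j hne hij

/-- The fibre over w = 0 has m distinct roots. Each extends analytically, and they stay distinct
nearby, so they exhaust the roots of a monic polynomial of degree m in y. -/
lemma Couplings.branches_inf (hm : m = 2 ∨ m = 3 ∨ m = 4 ∨ m = 6)
    (hL : IsSymmetricLattice m L) (c : Couplings m L) {α : Fin (m - 1) → ℂ}
    (hα : c.AlphaRelation α) (hc : c.Generic) (z : ℂ) :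
    ∃ Y : Fin m → ℂ → ℂ,
      (∀ j, AnalyticAt ℂ (Y j) 0 ∧ Y j 0 = (c.vecInf j).1 1 ∧
        HasResidue (swPullback m L (fun _ => 1) (Y j) (fun t => t)) 0 (c.mu j 0)) ∧
      ∀ᶠ w in 𝓝 (0 : ℂ), ∀ y : ℂ,
        MvPolynomial.eval ![1, y, w] (member m L (c.bigQ α) z) = ∏ j, (y - Y j w) := by
  set F := member m L (c.bigQ α) z with hF
  set H : MvPolynomial (Fin 2) ℂ :=
    MvPolynomial.aeval ![1, MvPolynomial.X 1, MvPolynomial.X 0] F with hH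
  have hev : ∀ t s, MvPolynomial.eval ![t, s] H = MvPolynomial.eval ![1, s, t] F := fun t s => by
    rw [hH, ← MvPolynomial.coe_aeval_eq_eval, RingHom.coe_coe, MvPolynomial.comp_aeval_apply,
      ← MvPolynomial.coe_aeval_eq_eval, RingHom.coe_coe]
    congr 2
    funext i
    fin_cases i <;> simp
  have hq : ∀ s, MvPolynomial.eval ![0, s] H =
      (∏ j, (Polynomial.X - Polynomial.C ((c.vecInf j).1 1))).eval s := fun s => by
    rw [hev, hF, c.eval_member_inf hm hL hα, Polynomial.eval_prod]
    simp
  have hex := fun j => exists_analytic_root H _ hq (r := (c.vecInf j).1 1)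
    (by rw [Polynomial.eval_prod]; exact Finset.prod_eq_zero (Finset.mem_univ j) (by simp))
    (derivative_eval_ne_zero_of_prod hc.vecInf_injective j)
  choose Y hY hY0 hYe using hex
  refine ⟨Y, fun j => ⟨hY j, hY0 j, c.hasResidue_inf (hY j) (hY0 j)⟩, ?_⟩
  have hinj := eventually_injective (fun j => (hY j).continuousAt)
    (by simp only [hY0]; exact hc.vecInf_injective)
  filter_upwards [hinj, eventually_all.2 hYe] with w hw1 hw2 y
  obtain ⟨hmon, hdeg⟩ := c.fibre_monic hm α z 1 w
  have := eval_eq_prod_of_roots hmon (by rw [hdeg, Fintype.card_fin]) hw1 fun j => by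
    rw [c.eval_fibre, ← hF, ← hev]; exact hw2 j
  rw [hF, ← c.eval_fibre, this, Polynomial.eval_prod]
  simp

/-- A branch of the curve for every simple root of the initial form. -/
lemma exists_branch {F : MvPolynomial (Fin 3) ℂ} (hF : F ≠ 0) {e b : ℂ} {k : ℕ}
    (hk : k ≤ multAt F ![e, b, 1]) {r : ℂ} (h0 : (slice F ![e, b, 1] k).eval r = 0)
    (h1 : (slice F ![e, b, 1] k).derivative.eval r ≠ 0) :
    ∃ ψ : ℂ → ℂ, AnalyticAt ℂ ψ 0 ∧ ψ 0 = r ∧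
      ∀ᶠ t in 𝓝 (0 : ℂ), MvPolynomial.eval ![e + t, b + t * ψ t, 1] F = 0 := by
  -- Blow-up chart (t, s) ↦ (t, ts, 0). The pullback is divisible by t^k, and the quotient H
  -- restricted to the exceptional line t = 0 is the sliced initial form.
  set φ : MvPolynomial (Fin 3) ℂ →ₐ[ℂ] MvPolynomial (Fin 2) ℂ :=
    MvPolynomial.aeval ![MvPolynomial.X 0, MvPolynomial.X 0 * MvPolynomial.X 1, 0] with hφ
  have hdvd : MvPolynomial.X 0 ^ k ∣ φ (taylor F ![e, b, 1]) := by
    have hI : (MvPolynomial.idealOfVars (Fin 3) ℂ ^ k).map φ ≤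
        Ideal.span {MvPolynomial.X (0 : Fin 2) ^ k} := by
      rw [Ideal.map_pow, ← Ideal.span_singleton_pow]
      refine Ideal.pow_right_mono ?_ _
      rw [MvPolynomial.idealOfVars, Ideal.map_span, Ideal.span_le]
      rintro _ ⟨_, ⟨i, rfl⟩, rfl⟩
      rw [SetLike.mem_coe, Ideal.mem_span_singleton]
      fin_cases i <;> simp [hφ]
    exact Ideal.mem_span_singleton.1 (hI (Ideal.mem_map_of_mem φ ((le_multAt_iff hF _ _).1 hk)))
  obtain ⟨H, hH⟩ := hdvd
  have hev : ∀ t s, MvPolynomial.eval ![e + t, b + t * s, 1] F =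
      t ^ k * MvPolynomial.eval ![t, s] H := fun t s => by
    have h2 := congrArg (MvPolynomial.eval ![t, s]) hH
    rw [map_mul, map_pow, MvPolynomial.eval_X, hφ, ← MvPolynomial.coe_aeval_eq_eval,
      RingHom.coe_coe, MvPolynomial.comp_aeval_apply] at h2
    have h3 := eval_taylor F ![e, b, 1] ![t, t * s, 0]
    rw [show (![t, t * s, 0] : Fin 3 → ℂ) + ![e, b, 1] = ![e + t, b + t * s, 1] by
      ext i; fin_cases i <;> simp [add_comm]] at h3
    rw [← h3]
    simp only [Matrix.cons_val_zero] at h2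
    rw [← MvPolynomial.coe_aeval_eq_eval, ← MvPolynomial.coe_aeval_eq_eval, RingHom.coe_coe,
      RingHom.coe_coe, ← h2]
    congr 2
    funext i
    fin_cases i <;> simp
  have hq : ∀ s, MvPolynomial.eval ![0, s] H = (slice F ![e, b, 1] k).eval s := fun s => by
    have h2 : lineRestr F ![e, b, 1] ![1, s, 0] = Polynomial.X ^ k *
        MvPolynomial.aeval ![Polynomial.X, Polynomial.C s] H := by
      refine Polynomial.funext fun t => ?_
      rw [eval_lineRestr, Polynomial.eval_mul, Polynomial.eval_pow, Polynomial.eval_X,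
        ← Polynomial.coe_aeval_eq_eval t, MvPolynomial.comp_aeval_apply]
      rw [show (fun i => (![e, b, 1] : Fin 3 → ℂ) i + (![1, s, 0] : Fin 3 → ℂ) i * t) =
        ![e + t, b + t * s, 1] by ext i; fin_cases i <;> simp [mul_comm], hev,
        ← MvPolynomial.coe_aeval_eq_eval, RingHom.coe_coe]
      congr 3
      funext i
      fin_cases i <;> simp
    rw [eval_slice_eq_coeff, h2, coeff_X_pow_mul_self, ← Polynomial.coe_aeval_eq_eval,
      MvPolynomial.comp_aeval_apply, ← MvPolynomial.coe_aeval_eq_eval, RingHom.coe_coe]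
    congr 2
    funext i
    fin_cases i <;> simp
  obtain ⟨ψ, hψ, hψ0, hψe⟩ := exists_analytic_root H _ hq h0 h1
  refine ⟨ψ, hψ, hψ0, ?_⟩
  filter_upwards [hψe] with t ht
  rw [hev, ht, mul_zero]

/-- A simple root r of the sliced initial form gives a branch Y = b + (x - e_i)ψ(x - e_i) with slope
ψ(0) = r. The n_i m_i = m branches are distinct for x ≠ e_i near e_i, hence are all the roots. -/
lemma Couplings.branches_e (hm : m = 2 ∨ m = 3 ∨ m = 4 ∨ m = 6)
    (hL : IsSymmetricLattice m L) (c : Couplings m L) (α : Fin (m - 1) → ℂ)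
    (hc : c.Generic) (z : ℂ) (i : Fin (numBranch m))
    (hr : ∀ j, ∃ r : Fin (mult m i) → ℂ, Function.Injective r ∧ ∀ k,
      (slice (member m L (c.bigQ α) z) (c.vec i j).1 (mult m i)).eval (r k) = 0 ∧
      (slice (member m L (c.bigQ α) z) (c.vec i j).1 (mult m i)).derivative.eval (r k) ≠ 0) :
    ∃ Y : Fin (stabOrder m i) → Fin (mult m i) → ℂ → ℂ,
      (∀ j k, AnalyticAt ℂ (Y j k) (e m L i) ∧ Y j k (e m L i) = (c.vec i j).1 1 ∧
        HasResidue (swPullback m L (fun t => t) (Y j k) (fun _ => 1)) (e m L i)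
          (mult m i * c.mu j (branchPt m L i))) ∧
      (∀ j, Function.Injective fun k => deriv (Y j k) (e m L i)) ∧
      ∀ᶠ x in 𝓝 (e m L i), ∀ y : ℂ,
        MvPolynomial.eval ![x, y, 1] (member m L (c.bigQ α) z) = ∏ j, ∏ k, (y - Y j k x) := by
  set F := member m L (c.bigQ α) z with hF
  choose r hr1 hr2 using hr
  have hex := fun j k => exists_branch (c.member_ne_zero hm α z) (e := e m L i)
    (b := (c.vec i j).1 1) (c.mult_le_multAt hm hL α z i j) (hr2 j k).1 (hr2 j k).2
  choose ψ hψ hψ0 hψe using hex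
  set x₀ := e m L i with hx₀
  have hsub : Tendsto (fun x : ℂ => x - x₀) (𝓝 x₀) (𝓝 0) := by
    have : ContinuousAt (fun x : ℂ => x - x₀) x₀ := by fun_prop
    simpa [ContinuousAt] using this
  have hψ' : ∀ j k, AnalyticAt ℂ (fun x => ψ j k (x - x₀)) x₀ := fun j k =>
    AnalyticAt.fun_comp (by simpa using hψ j k) (by fun_prop)
  set Y : Fin (stabOrder m i) → Fin (mult m i) → ℂ → ℂ :=
    fun j k x => (c.vec i j).1 1 + (x - x₀) * ψ j k (x - x₀) with hY
  have hYa : ∀ j k, AnalyticAt ℂ (Y j k) x₀ := fun j k =>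
    analyticAt_const.add ((analyticAt_id.sub analyticAt_const).mul (hψ' j k))
  have hY0 : ∀ j k, Y j k x₀ = (c.vec i j).1 1 := fun j k => by simp [hY]
  have hYd : ∀ j k, deriv (Y j k) x₀ = r j k := fun j k => by
    have h1 := (((hasDerivAt_id x₀).sub_const x₀).mul
      (hψ' j k).differentiableAt.hasDerivAt).const_add ((c.vec i j).1 1)
    have h2 := h1.deriv
    simp only [id, sub_self, zero_mul, add_zero, one_mul, hψ0] at h2
    exact h2
  refine ⟨Y, fun j k => ⟨hYa j k, hY0 j k, c.hasResidue_e (e_injective hm hL) (hYa j k) (hY0 j k)⟩,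
    fun j => by simp only [hYd]; exact hr1 j, ?_⟩
  have hne : ∀ j j' k k', j ≠ j' → ∀ᶠ x in 𝓝 x₀, Y j k x ≠ Y j' k' x := fun j j' k k' hj =>
    ((hYa j k).continuousAt.ne_iff_eventually_ne (hYa j' k').continuousAt).1
      (by rw [hY0, hY0]; exact (hc.vec_injective hm hL i).ne hj)
  have hne2 : ∀ j k k', k ≠ k' → ∀ᶠ x in 𝓝 x₀, ψ j k (x - x₀) ≠ ψ j k' (x - x₀) :=
    fun j k k' hk => ((hψ' j k).continuousAt.ne_iff_eventually_ne (hψ' j k').continuousAt).1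
      (by rw [sub_self, hψ0, hψ0]; exact (hr1 j).ne hk)
  have hroot : ∀ j k, ∀ᶠ x in 𝓝 x₀, MvPolynomial.eval ![x, Y j k x, 1] F = 0 := fun j k => by
    filter_upwards [hsub.eventually (hψe j k)] with x hx
    rwa [add_sub_cancel] at hx
  have hne' : ∀ᶠ x in 𝓝 x₀, ∀ j j' k k', j ≠ j' → Y j k x ≠ Y j' k' x := by
    simp only [eventually_all]; exact hne
  have hne2' : ∀ᶠ x in 𝓝 x₀, ∀ j k k', k ≠ k' → ψ j k (x - x₀) ≠ ψ j k' (x - x₀) := by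
    simp only [eventually_all]; exact hne2
  have hroot' : ∀ᶠ x in 𝓝 x₀, ∀ j k, MvPolynomial.eval ![x, Y j k x, 1] F = 0 := by
    simp only [eventually_all]; exact hroot
  filter_upwards [hne', hne2', hroot'] with x h1 h2 h3 y
  -- At x = e_i the branches through one base point coincide, so the factorisation comes from the
  -- restriction to the line instead.
  rcases eq_or_ne x x₀ with rfl | hx
  · refine (c.eval_member_e hm hL α z i y).trans ?_
    simp only [hY0, Finset.prod_const, Finset.card_univ, Fintype.card_fin]
  · obtain ⟨hmon, hdeg⟩ := c.fibre_monic hm α z x 1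
    have hinj : Function.Injective
        fun p : Fin (stabOrder m i) × Fin (mult m i) => Y p.1 p.2 x := by
      rintro ⟨j, k⟩ ⟨j', k'⟩ h
      by_contra hcon
      by_cases hj : j = j'
      · subst hj
        have hk : k ≠ k' := fun hk => hcon (by rw [hk])
        refine h2 j k k' hk (mul_left_cancel₀ (sub_ne_zero.2 hx) (add_left_cancel h))
      · exact h1 j j' k k' hj h
    have := eval_eq_prod_of_roots hmon (by
      rw [hdeg, Fintype.card_prod, Fintype.card_fin, Fintype.card_fin, mul_comm,
        mult_mul_stabOrder hm]) hinj fun p => by rw [c.eval_fibre]; exact h3 p.1 p.2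
    rw [hF, ← c.eval_fibre, this, Polynomial.eval_prod, Fintype.prod_prod_type]
    simp

/-! ### Singular members of a pencil -/

/-- The derivation `d/dz` of the field of rational functions, over which constants have derivative
zero. -/
lemma exists_differential (K : Type*) [Field K] [Algebra (Polynomial ℂ) K]
    [IsFractionRing (Polynomial ℂ) K] : ∃ _h : Differential K,
    (∀ c : ℂ, Differential.deriv (algebraMap (Polynomial ℂ) K (Polynomial.C c)) = 0) ∧
    Differential.deriv (algebraMap (Polynomial ℂ) K Polynomial.X) = 1 := by
  -- A derivation is the second component of a ring homomorphism into the dual numbers, here sending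
  -- X to X + ε. It extends to fractions because units are detected on the first component.
  set f : Polynomial ℂ →+* TrivSqZeroExt K K := Polynomial.eval₂RingHom
    ((TrivSqZeroExt.inlHom K K).comp ((algebraMap (Polynomial ℂ) K).comp Polynomial.C))
    (TrivSqZeroExt.inl (algebraMap (Polynomial ℂ) K Polynomial.X) + TrivSqZeroExt.inr 1) with hf
  have hfst : ((TrivSqZeroExt.fstHom K K K : TrivSqZeroExt K K →ₐ[K] K) :
      TrivSqZeroExt K K →+* K).comp f = algebraMap (Polynomial ℂ) K := by
    refine Polynomial.ringHom_ext (fun c => ?_) ?_ <;> simp [hf]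
  have hfst' : ∀ p, (f p).fst = algebraMap (Polynomial ℂ) K p := fun p => RingHom.congr_fun hfst p
  have hunit : ∀ y : nonZeroDivisors (Polynomial ℂ), IsUnit (f y) := fun y => by
    rw [TrivSqZeroExt.isUnit_iff_isUnit_fst, hfst']
    exact IsLocalization.map_units K y
  set g : K →+* TrivSqZeroExt K K := IsLocalization.lift hunit with hg
  have hgp : ∀ p, g (algebraMap (Polynomial ℂ) K p) = f p := fun p => IsLocalization.lift_eq hunit p
  have hgf : ∀ a, (g a).fst = a := by
    have : ((TrivSqZeroExt.fstHom K K K : TrivSqZeroExt K K →ₐ[K] K) :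
      TrivSqZeroExt K K →+* K).comp g = RingHom.id K := by
      refine IsLocalization.ringHom_ext (nonZeroDivisors (Polynomial ℂ)) (RingHom.ext fun p => ?_)
      simp [hgp, hfst']
    exact fun a => RingHom.congr_fun this a
  set D : K →+ K := (TrivSqZeroExt.sndHom K K).toAddMonoidHom.comp g.toAddMonoidHom with hD
  have hDa : ∀ a, D a = (g a).snd := fun a => rfl
  refine ⟨⟨Derivation.mk' D.toIntLinearMap fun a b => ?_⟩, fun c => ?_, ?_⟩
  · change D (a * b) = a • D b + b • D a
    rw [hDa, map_mul, TrivSqZeroExt.snd_mul, hgf, hgf, op_smul_eq_smul, hDa, hDa]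
  · change D _ = 0
    rw [hDa, hgp]; simp [hf]
  · change D _ = 1
    rw [hDa, hgp]; simp [hf]

/-- The chain rule for a derivation that kills the constants. -/
lemma deriv_aeval {B : Type*} [CommRing B] [Algebra ℂ B] [Differential B]
    (hc : ∀ a : ℂ, Differential.deriv (algebraMap ℂ B a) = 0) (b : Fin 3 → B)
    (F : MvPolynomial (Fin 3) ℂ) :
    Differential.deriv (MvPolynomial.aeval b F) =
      ∑ i, MvPolynomial.aeval b (MvPolynomial.pderiv i F) * Differential.deriv (b i) := by
  induction F using MvPolynomial.induction_on with
  | C a => simp [hc]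
  | add p q hp hq => simp [hp, hq, add_mul, Finset.sum_add_distrib]
  | mul_X p k hp =>
    rw [map_mul, Derivation.leibniz, hp, MvPolynomial.aeval_X]
    simp only [Derivation.leibniz, MvPolynomial.pderiv_X, smul_eq_mul, map_add, map_mul,
      MvPolynomial.aeval_X, add_mul, Finset.sum_add_distrib]
    congr 1
    · rw [Finset.sum_eq_single k]
      · simp
      · intro i _ hi; simp [hi.symm]
      · simp
    · rw [Finset.mul_sum]
      exact Finset.sum_congr rfl fun i _ => by ring

/-- In a field finite over `ℂ(z)`, the equations of a critical point of `Q / P` with value `z` have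
no solution with `P ≠ 0`. -/
lemma no_generic_critical_point {K κ : Type*} [Field K] [CharZero K]
    [Algebra (Polynomial ℂ) K] [IsFractionRing (Polynomial ℂ) K] [Field κ] [Algebra K κ]
    [FiniteDimensional K κ] [Algebra ℂ κ]
    (htower : ∀ a : ℂ, algebraMap ℂ κ a = algebraMap K κ
      (algebraMap (Polynomial ℂ) K (Polynomial.C a)))
    (P Q : MvPolynomial (Fin 3) ℂ) (b : Fin 3 → κ) {z : κ}
    (hz : z = algebraMap K κ
      (algebraMap (Polynomial ℂ) K Polynomial.X))
    (h0 : MvPolynomial.aeval b Q = z * MvPolynomial.aeval b P)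
    (h1 : ∀ i, MvPolynomial.aeval b (MvPolynomial.pderiv i Q) =
      z * MvPolynomial.aeval b (MvPolynomial.pderiv i P)) :
    MvPolynomial.aeval b P = 0 := by
  obtain ⟨hK, hKC, hKX⟩ := exists_differential K
  let := hK
  let := Differential.differentialFiniteDimensional K κ
  have : DifferentialAlgebra K κ :=
    Differential.differentialAlgebraFiniteDimensional
  have hc : ∀ a : ℂ, Differential.deriv (algebraMap ℂ κ a) = 0 := fun a => by
    rw [htower, DifferentialAlgebra.deriv_algebraMap, hKC, map_zero]
  have hzd : Differential.deriv z = 1 := by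
    rw [hz, DifferentialAlgebra.deriv_algebraMap, hKX, map_one]
  -- In the derivative of Q(b) = zP(b) the gradient terms cancel by the critical point equations,
  -- leaving P(b) times the derivative of z, which is 1.
  have h2 := congrArg Differential.deriv h0
  rw [Derivation.leibniz, deriv_aeval hc, deriv_aeval hc, hzd] at h2
  simp only [h1, smul_eq_mul, mul_one, Finset.mul_sum, mul_assoc] at h2
  simpa using h2

/-- All but finitely many members of a pencil are smooth outside the base locus. -/
lemma finite_critical_values (P Q : MvPolynomial (Fin 3) ℂ) :
    {z : ℂ | ∃ a : Fin 3 → ℂ, MvPolynomial.eval a P ≠ 0 ∧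
      MvPolynomial.eval a Q = z * MvPolynomial.eval a P ∧
      ∀ i, MvPolynomial.eval a (MvPolynomial.pderiv i Q) =
        z * MvPolynomial.eval a (MvPolynomial.pderiv i P)}.Finite := by
  -- The critical point equations are written over ℂ[z], with the extra variable `none` as an
  -- inverse of P to enforce P ≠ 0.
  let b : Fin 3 → MvPolynomial (Option (Fin 3)) (Polynomial ℂ) := fun i => MvPolynomial.X (some i)
  let zS : MvPolynomial (Option (Fin 3)) (Polynomial ℂ) := MvPolynomial.C Polynomial.X
  let G : Set (MvPolynomial (Option (Fin 3)) (Polynomial ℂ)) := insert (MvPolynomial.aeval b Q - zS * MvPolynomial.aeval b P)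
    (insert (MvPolynomial.X none * MvPolynomial.aeval b P - 1)
      (Set.range fun i => MvPolynomial.aeval b (MvPolynomial.pderiv i Q) -
        zS * MvPolynomial.aeval b (MvPolynomial.pderiv i P)))
  let J : Ideal (MvPolynomial (Option (Fin 3)) (Polynomial ℂ)) := Ideal.span G
  -- a polynomial in `z` that lies in `J` vanishes at all critical values
  have hfin : ∀ p : Polynomial ℂ, p ≠ 0 → MvPolynomial.C p ∈ J →
      {z : ℂ | ∃ a : Fin 3 → ℂ, MvPolynomial.eval a P ≠ 0 ∧
      MvPolynomial.eval a Q = z * MvPolynomial.eval a P ∧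
      ∀ i, MvPolynomial.eval a (MvPolynomial.pderiv i Q) =
        z * MvPolynomial.eval a (MvPolynomial.pderiv i P)}.Finite := by
    intro p hp hpJ
    refine (Polynomial.finite_setOfPred_isRoot hp).subset ?_
    rintro z ⟨a, hP, hQ, hd⟩
    let φ : MvPolynomial (Option (Fin 3)) (Polynomial ℂ) →+* ℂ := MvPolynomial.eval₂Hom (Polynomial.evalRingHom z)
      (fun o => o.elim (MvPolynomial.eval a P)⁻¹ a)
    have hφb : ∀ F : MvPolynomial (Fin 3) ℂ, φ (MvPolynomial.aeval b F) =
        MvPolynomial.eval a F := fun F => by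
      have : (φ.comp (MvPolynomial.aeval b : MvPolynomial (Fin 3) ℂ →ₐ[ℂ] MvPolynomial (Option (Fin 3)) (Polynomial ℂ)).toRingHom) =
          MvPolynomial.eval a := by
        refine MvPolynomial.ringHom_ext (fun c => ?_) fun i => ?_
        · change φ (MvPolynomial.aeval b (MvPolynomial.C c)) = _
          rw [MvPolynomial.aeval_C, MvPolynomial.eval_C, MvPolynomial.algebraMap_apply]
          simp [φ]
        · change φ (MvPolynomial.aeval b (MvPolynomial.X i)) = _
          simp [φ, b]
      exact RingHom.congr_fun this F
    have hφz : φ zS = z := by simp [φ, zS]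
    have hφt : φ (MvPolynomial.X none) = (MvPolynomial.eval a P)⁻¹ := by simp [φ]
    have hJ : J ≤ RingHom.ker φ := by
      refine Ideal.span_le.2 fun g hg => ?_
      rw [SetLike.mem_coe, RingHom.mem_ker]
      rcases hg with rfl | rfl | ⟨i, rfl⟩
      · rw [map_sub, map_mul, hφb, hφb, hφz, hQ, sub_self]
      · rw [map_sub, map_mul, hφb, hφt, map_one, inv_mul_cancel₀ hP, sub_self]
      · beta_reduce
        rw [map_sub, map_mul, hφb, hφb, hφz, hd, sub_self]
    have := hJ hpJ
    rw [RingHom.mem_ker] at this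
    simpa [φ] using this
  let := MvPolynomial.algebraMvPolynomial (R := Polynomial ℂ) (S := FractionRing (Polynomial ℂ)) (σ := Option (Fin 3))
  -- If the equations generate the unit ideal over ℂ(z), clearing denominators yields a non-zero
  -- polynomial in z inside J.
  by_cases htop : J.map (algebraMap (MvPolynomial (Option (Fin 3)) (Polynomial ℂ)) (MvPolynomial (Option (Fin 3)) (FractionRing (Polynomial ℂ)))) = ⊤
  · have h1 := (Ideal.eq_top_iff_one _).1 htop
    rw [IsLocalization.mem_map_algebraMap_iff ((nonZeroDivisors (Polynomial ℂ)).map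
      (MvPolynomial.C (σ := Option (Fin 3))))] at h1
    obtain ⟨⟨x, ⟨_, p, hp, rfl⟩⟩, h⟩ := h1
    rw [one_mul] at h
    have hinj : Function.Injective (algebraMap (MvPolynomial (Option (Fin 3)) (Polynomial ℂ)) (MvPolynomial (Option (Fin 3)) (FractionRing (Polynomial ℂ)))) :=
      MvPolynomial.map_injective _ (IsFractionRing.injective (Polynomial ℂ) (FractionRing (Polynomial ℂ)))
    exact hfin p (nonZeroDivisors.ne_zero hp) (by
      have h3 := hinj h
      rw [show (MvPolynomial.C p : MvPolynomial (Option (Fin 3)) (Polynomial ℂ)) = x from h3]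
      exact x.2)
  · exfalso
    -- Otherwise a maximal ideal gives a solution in a field finite over ℂ(z), by the
    -- Nullstellensatz. It would have P = 0, contrary to the inverse of P.
    obtain ⟨M, hM, hJM⟩ := Ideal.exists_le_maximal _ htop
    let : Field (MvPolynomial (Option (Fin 3)) (FractionRing (Polynomial ℂ)) ⧸ M) := Ideal.Quotient.field M
    have : FiniteDimensional (FractionRing (Polynomial ℂ)) (MvPolynomial (Option (Fin 3)) (FractionRing (Polynomial ℂ)) ⧸ M) :=
      finite_of_finite_type_of_isJacobsonRing _ _
    set π : MvPolynomial (Option (Fin 3)) (Polynomial ℂ) →+* MvPolynomial (Option (Fin 3)) (FractionRing (Polynomial ℂ)) ⧸ M :=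
      (Ideal.Quotient.mk M).comp (algebraMap (MvPolynomial (Option (Fin 3)) (Polynomial ℂ)) (MvPolynomial (Option (Fin 3)) (FractionRing (Polynomial ℂ)))) with hπ
    have hπ0 : ∀ g ∈ G, π g = 0 := fun g hg => Ideal.Quotient.eq_zero_iff_mem.2
      (hJM (Ideal.mem_map_of_mem _ (Ideal.subset_span hg)))
    let : Algebra ℂ (MvPolynomial (Option (Fin 3)) (FractionRing (Polynomial ℂ)) ⧸ M) :=
      (π.comp (MvPolynomial.C.comp Polynomial.C)).toAlgebra
    have hπb : ∀ F : MvPolynomial (Fin 3) ℂ, π (MvPolynomial.aeval b F) =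
        MvPolynomial.aeval (fun i => π (b i)) F := fun F => by
      have : π.comp (MvPolynomial.aeval b : MvPolynomial (Fin 3) ℂ →ₐ[ℂ] MvPolynomial (Option (Fin 3)) (Polynomial ℂ)).toRingHom =
          (MvPolynomial.aeval (fun i => π (b i)) : MvPolynomial (Fin 3) ℂ →ₐ[ℂ] _).toRingHom := by
        refine MvPolynomial.ringHom_ext (fun c => ?_) fun i => ?_
        · change π (MvPolynomial.aeval b (MvPolynomial.C c)) =
            MvPolynomial.aeval (fun i => π (b i)) (MvPolynomial.C c)
          rw [MvPolynomial.aeval_C, MvPolynomial.aeval_C]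
          rfl
        · change π (MvPolynomial.aeval b (MvPolynomial.X i)) =
            MvPolynomial.aeval (fun i => π (b i)) (MvPolynomial.X i)
          rw [MvPolynomial.aeval_X, MvPolynomial.aeval_X]
      exact RingHom.congr_fun this F
    have hC : ∀ p : Polynomial ℂ, π (MvPolynomial.C p) =
        algebraMap (FractionRing (Polynomial ℂ)) (MvPolynomial (Option (Fin 3)) (FractionRing (Polynomial ℂ)) ⧸ M) (algebraMap (Polynomial ℂ) (FractionRing (Polynomial ℂ)) p) := by
      intro p
      rw [hπ, RingHom.comp_apply, MvPolynomial.algebraMap_def, MvPolynomial.map_C]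
      rfl
    have hP := no_generic_critical_point (κ := MvPolynomial (Option (Fin 3)) (FractionRing (Polynomial ℂ)) ⧸ M)
      (fun a => hC (Polynomial.C a)) P Q (fun i => π (b i)) (z := π zS) (hC Polynomial.X)
      (by
        have := hπ0 _ (Set.mem_insert _ _)
        rwa [map_sub, map_mul, hπb, hπb, sub_eq_zero] at this)
      (fun i => by
        have := hπ0 _ (Set.mem_insert_of_mem _ (Set.mem_insert_of_mem _ ⟨i, rfl⟩))
        beta_reduce at this
        rwa [map_sub, map_mul, hπb, hπb, sub_eq_zero] at this)
    have ht := hπ0 _ (Set.mem_insert_of_mem _ (Set.mem_insert _ _))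
    rw [map_sub, map_mul, hπb, hP, mul_zero, map_one, zero_sub, neg_eq_zero] at ht
    exact one_ne_zero ht

/-! ### Factors of weighted homogeneous polynomials -/

lemma eq_C_mul_X_pow_of_natTrailingDegree {R : Type*} [CommRing R] {p : Polynomial R}
    (h : p.natTrailingDegree = p.natDegree) :
    p = Polynomial.C (p.coeff p.natDegree) * Polynomial.X ^ p.natDegree := by
  ext n
  rw [Polynomial.coeff_C_mul, Polynomial.coeff_X_pow]
  rcases lt_trichotomy n p.natDegree with hn | rfl | hn
  · rw [if_neg hn.ne, mul_zero, Polynomial.coeff_eq_zero_of_lt_natTrailingDegree (by rwa [h])]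
  · simp
  · rw [if_neg hn.ne', mul_zero, Polynomial.coeff_eq_zero_of_natDegree_lt hn]

/-- A factor of a weighted homogeneous polynomial is weighted homogeneous. -/
lemma exists_weight_of_mul {d N : ℕ} {A B : MvPolynomial (Fin 3) ℂ}
    (hAB : (A * B).IsWeightedHomogeneous ![1, d, 1] N) (h0 : A * B ≠ 0) :
    ∃ k, ∀ (t : ℂ) (a : Fin 3 → ℂ),
      MvPolynomial.eval (wscale d t a) A = t ^ k * MvPolynomial.eval a A := by
  -- Φ attaches to every variable the power of an auxiliary T given by its weight, so homogeneous of
  -- weight N means Φ F = F T^N.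
  let Φ : MvPolynomial (Fin 3) ℂ →ₐ[ℂ] Polynomial (MvPolynomial (Fin 3) ℂ) :=
    MvPolynomial.aeval fun i => Polynomial.C (MvPolynomial.X i) *
      Polynomial.X ^ ((![1, d, 1] : Fin 3 → ℕ) i)
  have hev : ∀ (F : MvPolynomial (Fin 3) ℂ) (a : Fin 3 → ℂ) (t : ℂ),
      ((Φ F).map (MvPolynomial.eval a)).eval t = MvPolynomial.eval (wscale d t a) F := by
    intro F a t
    have : ((Polynomial.evalRingHom t).comp ((Polynomial.mapRingHom (MvPolynomial.eval a)).comp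
        Φ.toRingHom)) = MvPolynomial.eval (wscale d t a) := by
      refine MvPolynomial.ringHom_ext (fun c => ?_) fun i => ?_
      · change ((Φ (MvPolynomial.C c)).map (MvPolynomial.eval a)).eval t = _
        rw [MvPolynomial.aeval_C, IsScalarTower.algebraMap_apply ℂ (MvPolynomial (Fin 3) ℂ),
          Polynomial.algebraMap_eq, MvPolynomial.algebraMap_eq]
        simp
      · change ((Φ (MvPolynomial.X i)).map (MvPolynomial.eval a)).eval t = _
        rw [MvPolynomial.aeval_X, MvPolynomial.eval_X]
        fin_cases i <;> simp [wscale] <;> ring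
    exact RingHom.congr_fun this F
  have hΦ : Φ A * Φ B = Polynomial.C (A * B) * Polynomial.X ^ N := by
    rw [← map_mul]
    ext1 n
    refine MvPolynomial.funext fun a => ?_
    have : (Φ (A * B)).map (MvPolynomial.eval a) =
        (Polynomial.C (A * B) * Polynomial.X ^ N).map (MvPolynomial.eval a) :=
      Polynomial.funext fun t => by
        rw [hev, eval_wscale hAB]; simp [mul_comm]
    rw [← Polynomial.coeff_map, this, Polynomial.coeff_map]
  have hne : Φ A * Φ B ≠ 0 := by
    rw [hΦ]
    exact mul_ne_zero (Polynomial.C_ne_zero.2 h0) (pow_ne_zero _ Polynomial.X_ne_zero)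
  have hA := left_ne_zero_of_mul hne
  have hB := right_ne_zero_of_mul hne
  -- Degree and trailing degree in T are additive and agree for the product, so they agree for each
  -- factor, which is therefore a single power of T.
  have h1 := Polynomial.natDegree_mul hA hB
  have h2 := Polynomial.natTrailingDegree_mul hA hB
  rw [hΦ, Polynomial.natDegree_C_mul_X_pow _ _ h0] at h1
  rw [hΦ, Polynomial.C_mul_X_pow_eq_monomial, Polynomial.natTrailingDegree_monomial h0] at h2
  have h3 := (Φ A).natTrailingDegree_le_natDegree
  have h4 := (Φ B).natTrailingDegree_le_natDegree
  have h5 := eq_C_mul_X_pow_of_natTrailingDegree (p := Φ A) (by omega)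
  refine ⟨(Φ A).natDegree, fun t a => ?_⟩
  have h6 : ∀ t, MvPolynomial.eval (wscale d t a) A =
      MvPolynomial.eval a ((Φ A).coeff (Φ A).natDegree) * t ^ (Φ A).natDegree := fun t => by
    rw [← hev]
    conv_lhs => rw [h5]
    simp
  have h7 := h6 1
  rw [show wscale d 1 a = a by ext i; fin_cases i <;> simp [wscale], one_pow, mul_one] at h7
  rw [h6, h7, mul_comm]

/-- The one scalar 2 suffices because its powers are distinct: a monomial of degree k is multiplied
by 2^k. -/
lemma isHomogeneous_of_eval_smul {r : ℕ} {G : MvPolynomial (Fin 2) ℂ}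
    (h : ∀ x : Fin 2 → ℂ, MvPolynomial.eval ((2 : ℂ) • x) G = 2 ^ r * MvPolynomial.eval x G) :
    G.IsHomogeneous r := by
  have hG : MvPolynomial.bind₁ (fun i => MvPolynomial.C (2 : ℂ) * MvPolynomial.X i) G =
      MvPolynomial.C ((2 : ℂ) ^ r) * G := by
    refine MvPolynomial.funext fun x => ?_
    rw [map_mul, MvPolynomial.eval_C, ← h, ← MvPolynomial.coe_aeval_eq_eval, RingHom.coe_coe,
      MvPolynomial.aeval_bind₁, ← MvPolynomial.coe_aeval_eq_eval, RingHom.coe_coe]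
    congr 2
    funext i
    simp
  have hcoeff : ∀ (p : MvPolynomial (Fin 2) ℂ) (σ : Fin 2 →₀ ℕ),
      (MvPolynomial.bind₁ (fun i => MvPolynomial.C (2 : ℂ) * MvPolynomial.X i) p).coeff σ =
        2 ^ σ.degree * p.coeff σ := by
    intro p σ
    induction p using MvPolynomial.induction_on' with
    | monomial τ a =>
      rw [MvPolynomial.bind₁_monomial]
      have : ∏ i ∈ τ.support, (MvPolynomial.C (2 : ℂ) * MvPolynomial.X i) ^ τ i =
          MvPolynomial.C ((2 : ℂ) ^ τ.degree) *
            ∏ i ∈ τ.support, (MvPolynomial.X i : MvPolynomial (Fin 2) ℂ) ^ τ i := by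
        simp only [mul_pow, Finset.prod_mul_distrib, Finset.prod_pow_eq_pow_sum, map_pow]
        rfl
      rw [this, mul_left_comm, MvPolynomial.coeff_C_mul, ← Finsupp.prod,
        ← MvPolynomial.monomial_eq, MvPolynomial.coeff_monomial]
      split_ifs with hτ
      · rw [hτ]
      · simp
    | add p q hp hq => rw [map_add, MvPolynomial.coeff_add, hp, hq, MvPolynomial.coeff_add, mul_add]
  intro σ hσ
  have h1 := hcoeff G σ
  rw [hG, MvPolynomial.coeff_C_mul] at h1
  have h2 := mul_right_cancel₀ hσ h1
  have h3 : (2 : ℕ) ^ r = 2 ^ σ.degree := by exact_mod_cast h2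
  have h4 := Nat.pow_right_injective le_rfl h3
  rw [h4, Finsupp.degree_eq_weight_one]
  rfl

/-- The variable `y` singled out: `ℂ[x, w][y] = ℂ[x, y, w]`. -/
def toPlaneEquiv : Polynomial (MvPolynomial (Fin 2) ℂ) ≃+* MvPolynomial (Fin 3) ℂ :=
  RingEquiv.ofRingHom toPlane
    (MvPolynomial.aeval ![Polynomial.C (MvPolynomial.X 0), Polynomial.X,
      Polynomial.C (MvPolynomial.X 1)] :
      MvPolynomial (Fin 3) ℂ →ₐ[ℂ] Polynomial (MvPolynomial (Fin 2) ℂ)).toRingHom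
    (by
      refine MvPolynomial.ringHom_ext (fun c => ?_) fun i => ?_
      · change toPlane (MvPolynomial.aeval _ (MvPolynomial.C c)) = _
        rw [MvPolynomial.aeval_C, IsScalarTower.algebraMap_apply ℂ (MvPolynomial (Fin 2) ℂ),
          Polynomial.algebraMap_eq, MvPolynomial.algebraMap_eq, toPlane_C]
        simp
      · change toPlane (MvPolynomial.aeval _ (MvPolynomial.X i)) = _
        rw [MvPolynomial.aeval_X]
        fin_cases i <;> simp)
    (by
      refine Polynomial.ringHom_ext (fun p => ?_) ?_
      · change MvPolynomial.aeval _ (toPlane (Polynomial.C p)) = _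
        rw [toPlane_C, MvPolynomial.aeval_rename]
        have : (MvPolynomial.aeval ((![Polynomial.C (MvPolynomial.X 0), Polynomial.X,
            Polynomial.C (MvPolynomial.X 1)] : Fin 3 → Polynomial (MvPolynomial (Fin 2) ℂ)) ∘
              ![0, 2]) : MvPolynomial (Fin 2) ℂ →ₐ[ℂ] _).toRingHom = Polynomial.C := by
          refine MvPolynomial.ringHom_ext (fun c => ?_) fun i => ?_
          · change MvPolynomial.aeval _ (MvPolynomial.C c) = _
            rw [MvPolynomial.aeval_C, IsScalarTower.algebraMap_apply ℂ (MvPolynomial (Fin 2) ℂ),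
              Polynomial.algebraMap_eq, MvPolynomial.algebraMap_eq]
          · change MvPolynomial.aeval _ (MvPolynomial.X i) = _
            rw [MvPolynomial.aeval_X]
            fin_cases i <;> simp
        exact RingHom.congr_fun this p
      · change MvPolynomial.aeval _ (toPlane Polynomial.X) = _
        rw [toPlane_X, MvPolynomial.aeval_X]
        simp)

lemma toPlaneEquiv_apply (p : Polynomial (MvPolynomial (Fin 2) ℂ)) :
    toPlaneEquiv p = toPlane p := rfl

/-- A factor of a weighted homogeneous polynomial scales with some weight k, and the leading term
y^{deg g} identifies k as d deg g. -/
lemma isGraded_of_mul {d N : ℕ} {f g : Polynomial (MvPolynomial (Fin 2) ℂ)}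
    (hg : g.Monic) (hd : (toPlane (g * f)).IsWeightedHomogeneous ![1, d, 1] N) (h0 : g * f ≠ 0) :
    IsGraded d g.natDegree g := by
  rw [map_mul] at hd
  obtain ⟨k, hk⟩ := exists_weight_of_mul hd (by
    rw [← map_mul]
    exact fun h => h0 (toPlaneEquiv.injective (by rw [toPlaneEquiv_apply, h, map_zero])))
  have hcoeff : ∀ (j : ℕ) (x : Fin 2 → ℂ), 2 ^ (d * j) * MvPolynomial.eval ((2 : ℂ) • x) (g.coeff j) =
      2 ^ k * MvPolynomial.eval x (g.coeff j) := fun j x => by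
    have h1 : (g.map (MvPolynomial.eval ((2 : ℂ) • x))).comp
        (Polynomial.C (2 ^ d) * Polynomial.X) =
        Polynomial.C (2 ^ k) * g.map (MvPolynomial.eval x) := by
      refine Polynomial.funext fun y => ?_
      have h2 := hk 2 ![x 0, y, x 1]
      rw [eval_toPlane, eval_toPlane] at h2
      simp only [wscale, Matrix.cons_val_zero, Matrix.cons_val_one, Matrix.cons_val] at h2
      rw [Polynomial.eval_comp, Polynomial.eval_mul, Polynomial.eval_mul, Polynomial.eval_C,
        Polynomial.eval_C, Polynomial.eval_X]
      rw [show (2 : ℂ) • x = ![2 * x 0, 2 * x 1] by ext i; fin_cases i <;> simp, h2]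
      congr 4
      ext i; fin_cases i <;> simp
    have h3 := congrArg (fun p => Polynomial.coeff p j) h1
    simp only [Polynomial.comp_C_mul_X_coeff, Polynomial.coeff_C_mul, Polynomial.coeff_map] at h3
    rw [← h3, pow_mul, mul_comm]
  have hk' : k = d * g.natDegree := by
    have h1 := hcoeff g.natDegree 0
    rw [hg.coeff_natDegree] at h1
    simp only [map_one, mul_one] at h1
    have h2 : (2 : ℕ) ^ (d * g.natDegree) = 2 ^ k := by exact_mod_cast h1
    exact (Nat.pow_right_injective le_rfl h2).symm
  refine fun j => ⟨fun hj => Polynomial.coeff_eq_zero_of_natDegree_lt hj, fun hj => ?_⟩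
  refine isHomogeneous_of_eval_smul fun x => ?_
  have h1 := hcoeff j x
  have h2 : k = d * j + d * (g.natDegree - j) := by rw [← mul_add, hk']; congr 1; omega
  rw [h2, pow_add, mul_assoc] at h1
  exact mul_left_cancel₀ (pow_ne_zero _ two_ne_zero) h1

/-! ### Binary forms -/

/-- The dehomogenization of a binary form. -/
def dehom (G : MvPolynomial (Fin 2) ℂ) : Polynomial ℂ :=
  MvPolynomial.aeval ![Polynomial.X, 1] G

lemma eval_dehom (G : MvPolynomial (Fin 2) ℂ) (t : ℂ) :
    (dehom G).eval t = MvPolynomial.eval ![t, 1] G := by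
  rw [dehom, ← Polynomial.coe_aeval_eq_eval, MvPolynomial.comp_aeval_apply,
    ← MvPolynomial.coe_aeval_eq_eval, RingHom.coe_coe]
  congr 2
  funext i
  fin_cases i <;> simp

lemma dehom_facts {n : ℕ} {G : MvPolynomial (Fin 2) ℂ} (hG : G.IsHomogeneous n) :
    (dehom G).natDegree ≤ n ∧ (dehom G).coeff n = MvPolynomial.eval ![1, 0] G := by
  have h := aeval_slice_facts (hG.rename_isHomogeneous (f := (![1, 0] : Fin 2 → Fin 3)))
  have h1 : MvPolynomial.aeval (![1, Polynomial.X, 0] : Fin 3 → Polynomial ℂ)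
      (MvPolynomial.rename (![1, 0] : Fin 2 → Fin 3) G) = dehom G := by
    rw [MvPolynomial.aeval_rename, dehom]
    congr 2
    funext i
    fin_cases i <;> simp
  have h2 : MvPolynomial.eval (![0, 1, 0] : Fin 3 → ℂ)
      (MvPolynomial.rename (![1, 0] : Fin 2 → Fin 3) G) = MvPolynomial.eval ![1, 0] G := by
    rw [MvPolynomial.eval_rename]
    congr 2
    funext i
    fin_cases i <;> simp
  rwa [h1, h2] at h

/-- Homogeneity gives vanishing wherever the second variable is non-zero, and multiplication by that
variable takes care of the rest. -/
lemma eq_zero_of_dehom_eq_zero {n : ℕ} {G : MvPolynomial (Fin 2) ℂ} (hG : G.IsHomogeneous n)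
    (h : dehom G = 0) : G = 0 := by
  have h1 : G * MvPolynomial.X 1 = 0 := by
    refine MvPolynomial.funext fun x => ?_
    rw [map_mul, MvPolynomial.eval_X, map_zero]
    rcases eq_or_ne (x 1) 0 with h0 | h0
    · rw [h0, mul_zero]
    · have hx : x = (x 1) • ![x 0 / x 1, 1] := by
        ext i; fin_cases i <;> simp [mul_div_cancel₀ _ h0]
      have h2 : ∀ (t : ℂ) (y : Fin 2 → ℂ), MvPolynomial.eval (t • y) G =
          t ^ n * MvPolynomial.eval y G := fun t y => by
        rw [MvPolynomial.eval_eq', MvPolynomial.eval_eq', Finset.mul_sum]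
        refine Finset.sum_congr rfl fun σ hσ => ?_
        have h : σ.degree = n := by
          rw [Finsupp.degree_eq_weight_one]
          exact hG (MvPolynomial.mem_support_iff.1 hσ)
        simp only [← h, Pi.smul_apply, smul_eq_mul, mul_pow, Finset.prod_mul_distrib,
          Finset.prod_pow_eq_pow_sum, ← Finsupp.degree_eq_sum]
        ring
      rw [hx, h2, ← eval_dehom, h]
      simp
  exact (mul_eq_zero.1 h1).resolve_right (MvPolynomial.X_ne_zero _)

/-- A form that vanishes at infinity has a dehomogenization of smaller degree. -/
lemma dehom_degree_lt {n : ℕ} {G : MvPolynomial (Fin 2) ℂ} (hG : G.IsHomogeneous n)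
    (h : MvPolynomial.eval ![1, 0] G = 0) : (dehom G).degree < n := by
  obtain ⟨h1, h2⟩ := dehom_facts hG
  rw [h] at h2
  rw [Polynomial.degree_lt_iff_coeff_zero]
  intro k hk
  rcases hk.eq_or_lt with rfl | hk
  · exact h2
  · exact Polynomial.coeff_eq_zero_of_natDegree_lt (by omega)

/-! ### Irreducibility of almost all members -/

/-- The form `P` in the variables `x, w`. -/
def pForm (m : ℕ) (L : PeriodPair) : MvPolynomial (Fin 2) ℂ :=
  MvPolynomial.X 1 * ∏ i, lineForm m L i ^ mult m i

/-- The member `Q - z P` as a polynomial in `y`. -/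
def Couplings.fPoly (c : Couplings m L) (α : Fin (m - 1) → ℂ) (z : ℂ) :
    Polynomial (MvPolynomial (Fin 2) ℂ) :=
  c.qPoly α - Polynomial.C (MvPolynomial.C z * pForm m L)

lemma pForm_ne_zero : pForm m L ≠ 0 := by
  refine mul_ne_zero (MvPolynomial.X_ne_zero _) (Finset.prod_ne_zero_iff.2 fun i _ =>
    pow_ne_zero _ fun h => ?_)
  have := congrArg (MvPolynomial.eval ![1, 0]) h
  simp at this

lemma Couplings.toPlane_fPoly (c : Couplings m L) (α : Fin (m - 1) → ℂ) (z : ℂ) :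
    toPlane (c.fPoly α z) = member m L (c.bigQ α) z := by
  rw [fPoly, map_sub, toPlane_C, member, bigQ, map_mul, MvPolynomial.rename_C, pForm, homP,
    map_mul, map_prod]
  simp [lineForm]

lemma Couplings.fPoly_monic (hm : m = 2 ∨ m = 3 ∨ m = 4 ∨ m = 6) (c : Couplings m L)
    (α : Fin (m - 1) → ℂ) (z : ℂ) :
    (c.fPoly α z).Monic ∧ (c.fPoly α z).natDegree = m := by
  have h1 : (c.fPoly α z).coeff m = 1 := by
    rw [fPoly, Polynomial.coeff_sub, (c.qPoly_monic hm α).1, Polynomial.coeff_C,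
      if_neg (by omega), sub_zero]
  have h2 : (c.fPoly α z).natDegree ≤ m := by
    rw [Polynomial.natDegree_le_iff_coeff_eq_zero]
    intro k hk
    rw [fPoly, Polynomial.coeff_sub, (c.isGraded_qPoly hm α k).1 hk,
      Polynomial.coeff_C, if_neg (by omega), sub_zero]
  exact ⟨Polynomial.monic_of_natDegree_le_of_coeff_eq_one m h2 h1,
    le_antisymm h2 (Polynomial.le_natDegree_of_ne_zero (by rw [h1]; exact one_ne_zero))⟩

lemma Couplings.map_fPoly_inf (hm : m = 2 ∨ m = 3 ∨ m = 4 ∨ m = 6)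
    (hL : IsSymmetricLattice m L) (c : Couplings m L) {α : Fin (m - 1) → ℂ}
    (hα : c.AlphaRelation α) (z : ℂ) :
    (c.fPoly α z).map (MvPolynomial.eval ![1, 0]) =
      ∏ j, (Polynomial.X - Polynomial.C ((c.vecInf j).1 1)) := by
  refine Polynomial.funext fun y => ?_
  have h := eval_toPlane ![1, y, 0] (c.fPoly α z)
  rw [c.toPlane_fPoly, c.eval_member_inf hm hL hα] at h
  rw [Polynomial.eval_prod]
  simpa using h.symm

lemma Couplings.map_fPoly_e (hm : m = 2 ∨ m = 3 ∨ m = 4 ∨ m = 6)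
    (hL : IsSymmetricLattice m L) (c : Couplings m L) (α : Fin (m - 1) → ℂ) (z : ℂ)
    (i : Fin (numBranch m)) :
    (c.fPoly α z).map (MvPolynomial.eval ![e m L i, 1]) =
      ∏ j, (Polynomial.X - Polynomial.C ((c.vec i j).1 1)) ^ mult m i := by
  refine Polynomial.funext fun y => ?_
  have h := eval_toPlane ![e m L i, y, 1] (c.fPoly α z)
  rw [c.toPlane_fPoly, c.eval_member_e hm hL] at h
  rw [Polynomial.eval_prod]
  simpa using h.symm

/-! ### Factors of a member at the base points and on the lines -/

lemma comp_X_add_C_of_dvd (k : ℕ) (b : ℂ) (q : Polynomial ℂ) :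
    ((Polynomial.X - Polynomial.C b) ^ k * q).comp (Polynomial.X + Polynomial.C b) =
      Polynomial.X ^ k * q.comp (Polynomial.X + Polynomial.C b) := by
  simp

lemma lineRestr_toPlane_vertical (p : Polynomial (MvPolynomial (Fin 2) ℂ)) (e b : ℂ) :
    lineRestr (toPlane p) ![e, b, 1] ![0, 1, 0] =
      (p.map (MvPolynomial.eval ![e, 1])).comp (Polynomial.X + Polynomial.C b) := by
  refine Polynomial.funext fun t => ?_
  rw [eval_lineRestr, eval_toPlane, Polynomial.eval_comp]
  simp [add_comm]

/-- The restriction to the vertical line through the point has a zero of order the root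
multiplicity, which bounds the multiplicity in the plane. -/
lemma multAt_toPlane_le {p : Polynomial (MvPolynomial (Fin 2) ℂ)} {e b : ℂ}
    (hp : p.map (MvPolynomial.eval ![e, 1]) ≠ 0) :
    multAt (toPlane p) ![e, b, 1] ≤ (p.map (MvPolynomial.eval ![e, 1])).rootMultiplicity b := by
  obtain ⟨q, hq, hnd⟩ := Polynomial.exists_eq_pow_rootMultiplicity_mul_and_not_dvd _ hp b
  refine multAt_le_of_coeff_ne_zero (v := ![0, 1, 0]) ?_
  have h := congrArg (fun r => Polynomial.comp r (Polynomial.X + Polynomial.C b)) hq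
  simp only [comp_X_add_C_of_dvd] at h
  rw [lineRestr_toPlane_vertical, h, coeff_X_pow_mul_self, Polynomial.eval_comp]
  simpa [Polynomial.dvd_iff_isRoot] using hnd

lemma Couplings.rootMultiplicity_fibre_le (hm : m = 2 ∨ m = 3 ∨ m = 4 ∨ m = 6)
    (hL : IsSymmetricLattice m L) (c : Couplings m L) (hc : c.Generic)
    (i : Fin (numBranch m)) (j : Fin (stabOrder m i)) :
    (∏ k, (Polynomial.X - Polynomial.C ((c.vec i k).1 1)) ^ mult m i).rootMultiplicity
      ((c.vec i j).1 1) ≤ mult m i := by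
  have h0 : ∏ k, (Polynomial.X - Polynomial.C ((c.vec i k).1 1)) ^ mult m i ≠ 0 :=
    Finset.prod_ne_zero_iff.2 fun k _ => pow_ne_zero _ (Polynomial.X_sub_C_ne_zero _)
  rw [Polynomial.rootMultiplicity_le_iff h0, ← Finset.mul_prod_erase _ _ (Finset.mem_univ j),
    pow_succ]
  intro h
  have h1 := (mul_dvd_mul_iff_left (pow_ne_zero _ (Polynomial.X_sub_C_ne_zero _))).1 h
  rw [Polynomial.dvd_iff_isRoot, Polynomial.IsRoot, Polynomial.eval_prod,
    Finset.prod_eq_zero_iff] at h1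
  obtain ⟨k, hk, h2⟩ := h1
  rw [Polynomial.eval_pow] at h2
  have h3 := (pow_eq_zero_iff (mult_pos hm i).ne').1 h2
  rw [Polynomial.eval_sub, Polynomial.eval_X, Polynomial.eval_C, sub_eq_zero] at h3
  exact Finset.ne_of_mem_erase hk (hc.vec_injective hm hL i h3).symm

/-- The multiplicity of a factor at a base point, bounded below by the multiplicity of its
restriction to the line. -/
lemma Couplings.rootMultiplicity_le_multAt (hm : m = 2 ∨ m = 3 ∨ m = 4 ∨ m = 6)
    (hL : IsSymmetricLattice m L) (c : Couplings m L) (α : Fin (m - 1) → ℂ) (hc : c.Generic)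
    {z : ℂ} {g f : Polynomial (MvPolynomial (Fin 2) ℂ)} (hgf : g * f = c.fPoly α z)
    (i : Fin (numBranch m)) (j : Fin (stabOrder m i)) :
    (g.map (MvPolynomial.eval ![e m L i, 1])).rootMultiplicity ((c.vec i j).1 1) ≤
      multAt (toPlane g) (c.vec i j).1 := by
  have h1 := c.map_fPoly_e hm hL α z i
  rw [← hgf, Polynomial.map_mul] at h1
  have h0 : ∏ k, (Polynomial.X - Polynomial.C ((c.vec i k).1 1)) ^ mult m i ≠ 0 :=
    Finset.prod_ne_zero_iff.2 fun k _ => pow_ne_zero _ (Polynomial.X_sub_C_ne_zero _)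
  have hne := h0
  rw [← h1] at hne
  have h2 := c.rootMultiplicity_fibre_le hm hL hc i j
  rw [← h1, Polynomial.rootMultiplicity_mul hne] at h2
  have h3 := c.multAt_vec hm hL α hc z i j
  rw [← c.toPlane_fPoly, ← hgf, map_mul] at h3
  have hF : toPlane g * toPlane f ≠ 0 := by
    rw [← map_mul, hgf, c.toPlane_fPoly]; exact c.member_ne_zero hm α z
  -- Writing r for root multiplicities on ℓ_i and ν for multiplicities in the plane: r(g) + r(f) ≤
  -- n_i = ν(gf) ≤ ν(g) + ν(f) and ν(f) ≤ r(f), hence r(g) ≤ ν(g).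
  have h4 := multAt_mul_le (left_ne_zero_of_mul hF) (right_ne_zero_of_mul hF) (c.vec i j).1
  have h5 : multAt (toPlane f) (c.vec i j).1 ≤ _ :=
    multAt_toPlane_le (b := (c.vec i j).1 1) (right_ne_zero_of_mul hne)
  omega

/-- By the pigeonhole principle: the restriction of g splits completely, and its roots lie among the
m_i base points of ℓ_i. -/
lemma Couplings.exists_two_le_rootMultiplicity (hm : m = 2 ∨ m = 3 ∨ m = 4 ∨ m = 6)
    (hL : IsSymmetricLattice m L) (c : Couplings m L) (α : Fin (m - 1) → ℂ)
    {z : ℂ} {g f : Polynomial (MvPolynomial (Fin 2) ℂ)} (hg : g.Monic) (hgf : g * f = c.fPoly α z)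
    (i : Fin (numBranch m)) (hi : stabOrder m i < g.natDegree) :
    ∃ j, 2 ≤ (g.map (MvPolynomial.eval ![e m L i, 1])).rootMultiplicity ((c.vec i j).1 1) := by
  by_contra! hcon
  set q := g.map (MvPolynomial.eval ![e m L i, 1]) with hq
  have hroot : ∀ x ∈ q.roots, ∃ j, x = (c.vec i j).1 1 := fun x hx => by
    have h1 := c.map_fPoly_e hm hL α z i
    rw [← hgf, Polynomial.map_mul, ← hq] at h1
    have h2 := congrArg (Polynomial.eval x) h1
    rw [Polynomial.eval_mul, Polynomial.isRoot_of_mem_roots hx, zero_mul, eq_comm,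
      Polynomial.eval_prod, Finset.prod_eq_zero_iff] at h2
    obtain ⟨j, -, hj⟩ := h2
    rw [Polynomial.eval_pow] at hj
    have h3 := (pow_eq_zero_iff (mult_pos hm i).ne').1 hj
    rw [Polynomial.eval_sub, Polynomial.eval_X, Polynomial.eval_C, sub_eq_zero] at h3
    exact ⟨j, h3⟩
  have hnodup : q.roots.Nodup := by
    rw [Multiset.nodup_iff_count_le_one]
    intro x
    by_cases hx : x ∈ q.roots
    · obtain ⟨j, rfl⟩ := hroot x hx
      rw [Polynomial.count_roots]
      have := hcon j
      omega
    · rw [Multiset.count_eq_zero_of_notMem hx]; omega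
  have hcard : q.roots.toFinset.card = g.natDegree := by
    rw [Multiset.toFinset_card_of_nodup hnodup, ← (IsAlgClosed.splits q).natDegree_eq_card_roots,
      hq, hg.natDegree_map]
  have hsub : q.roots.toFinset ⊆ Finset.univ.image fun j => (c.vec i j).1 1 := fun x hx => by
    obtain ⟨j, rfl⟩ := hroot x (Multiset.mem_toFinset.1 hx)
    exact Finset.mem_image_of_mem _ (Finset.mem_univ j)
  have := (Finset.card_le_card hsub).trans Finset.card_image_le
  rw [hcard, Finset.card_univ, Fintype.card_fin] at this
  omega

/-- The dehomogenized difference of two factors with the same restriction to a line, at a point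
where both have multiplicity at least two. -/
lemma sq_dvd_dehom {g g' : Polynomial (MvPolynomial (Fin 2) ℂ)} {G : MvPolynomial (Fin 2) ℂ}
    (hG : g - g' = Polynomial.C G) {e b : ℂ} (h : 2 ≤ multAt (toPlane g) ![e, b, 1])
    (h' : 2 ≤ multAt (toPlane g') ![e, b, 1]) :
    (Polynomial.X - Polynomial.C e) ^ 2 ∣ dehom G := by
  have h1 : (dehom G).comp (Polynomial.X + Polynomial.C e) =
      lineRestr (toPlane g) ![e, b, 1] ![1, 0, 0] -
        lineRestr (toPlane g') ![e, b, 1] ![1, 0, 0] := by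
    refine Polynomial.funext fun t => ?_
    have h2 := congrArg (fun p => MvPolynomial.eval ![e + t, b, 1] (toPlane p)) hG
    simp only [map_sub, toPlane_C, eval_rename_zero_two] at h2
    simp only [Polynomial.eval_comp, Polynomial.eval_add, Polynomial.eval_X, Polynomial.eval_C,
      Polynomial.eval_sub, eval_lineRestr, eval_dehom]
    rw [show (fun i => (![e, b, 1] : Fin 3 → ℂ) i + (![1, 0, 0] : Fin 3 → ℂ) i * t) =
      ![e + t, b, 1] by ext i; fin_cases i <;> simp, h2]
    simp [add_comm]
  rw [Polynomial.X_sub_C_pow_dvd_iff, h1, Polynomial.X_pow_dvd_iff]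
  intro k hk
  rw [Polynomial.coeff_sub, coeff_lineRestr_eq_zero (by omega), coeff_lineRestr_eq_zero (by omega),
    sub_zero]

/-- A factor of a member is determined by its restrictions to the lines. -/
lemma Couplings.factor_unique (hm : m = 2 ∨ m = 3 ∨ m = 4 ∨ m = 6)
    (hL : IsSymmetricLattice m L) (c : Couplings m L) {α : Fin (m - 1) → ℂ} (hc : c.Generic)
    {z z' : ℂ} {g f g' f' : Polynomial (MvPolynomial (Fin 2) ℂ)} (hg : g.Monic) (hg' : g'.Monic)
    (hgf : g * f = c.fPoly α z) (hgf' : g' * f' = c.fPoly α z')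
    (hdeg : g.natDegree ≤ m / 2)
    (hinf : g.map (MvPolynomial.eval ![1, 0]) = g'.map (MvPolynomial.eval ![1, 0]))
    (he : ∀ i, g.map (MvPolynomial.eval ![e m L i, 1]) =
      g'.map (MvPolynomial.eval ![e m L i, 1])) : g = g' := by
  have hd : g.natDegree = g'.natDegree := by
    rw [← hg.natDegree_map (MvPolynomial.eval (![1, 0] : Fin 2 → ℂ)), hinf, hg'.natDegree_map]
  have hgr : IsGraded (yWeight m) g.natDegree g := isGraded_of_mul hg
    (by rw [hgf, c.toPlane_fPoly]; exact c.isWeightedHomogeneous_member hm α z)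
    (by rw [hgf]; exact (c.fPoly_monic hm α z).1.ne_zero)
  have hgr' : IsGraded (yWeight m) g.natDegree g' := by
    rw [hd]
    exact isGraded_of_mul hg'
      (by rw [hgf', c.toPlane_fPoly]; exact c.isWeightedHomogeneous_member hm α z')
      (by rw [hgf']; exact (c.fPoly_monic hm α z').1.ne_zero)
  set a := g.natDegree with ha
  have hhom : ∀ j ≤ a, ((g - g').coeff j).IsHomogeneous (yWeight m * (a - j)) := fun j hj => by
    rw [Polynomial.coeff_sub]; exact ((hgr j).2 hj).sub ((hgr' j).2 hj)
  have hinf0 : ∀ j, MvPolynomial.eval ![1, 0] ((g - g').coeff j) = 0 := fun j => by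
    rw [← Polynomial.coeff_map, Polynomial.map_sub, hinf, sub_self, Polynomial.coeff_zero]
  have he0 : ∀ i j, (dehom ((g - g').coeff j)).eval (e m L i) = 0 := fun i j => by
    rw [eval_dehom, ← Polynomial.coeff_map, Polynomial.map_sub, he, sub_self, Polynomial.coeff_zero]
  -- A coefficient of g - g' is a binary form of degree d(a - j) vanishing at infinity and at the d
  -- + 1 points e_i, so it is zero when d(a - j) ≤ d + 1.
  have hsmall : ∀ j ≤ a, yWeight m * (a - j) ≤ numBranch m → (g - g').coeff j = 0 := by
    intro j hj hle
    refine eq_zero_of_dehom_eq_zero (hhom j hj) ?_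
    by_contra h0
    have h1 := dehom_degree_lt (hhom j hj) (hinf0 j)
    rw [← Polynomial.natDegree_lt_iff_degree_lt h0] at h1
    exact h0 (Polynomial.eq_zero_of_natDegree_lt_card_of_eval_eq_zero _ (e_injective hm hL)
      (fun i => he0 i j) (by rw [Fintype.card_fin]; omega))
  rw [← sub_eq_zero]
  -- For a ≤ m/2 the degree bound fails only for the constant coefficient when m = 6 and a = 3: a
  -- cubic form with only three known zeros.
  by_cases hex : m = 6 ∧ a = 3
  · obtain ⟨rfl, ha3⟩ := hex
    have hC : g - g' = Polynomial.C ((g - g').coeff 0) := by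
      ext1 j
      rw [Polynomial.coeff_C]
      split_ifs with hj
      · rw [hj]
      · by_cases hja : j ≤ a
        · refine hsmall j hja ?_
          simp only [yWeight, numBranch]
          norm_num
          omega
        · rw [Polynomial.coeff_sub, (hgr j).1 (by omega), (hgr' j).1 (by omega), sub_zero]
    -- This line carries two triple points. A factor of degree three has a double root at one of
    -- them, so g and g' both have multiplicity at least two there. Then e_{i₁} is a double zero of
    -- the cubic form, which now has four zeros.
    let i₁ : Fin (numBranch 6) := (1 : Fin 2)
    let i₀ : Fin (numBranch 6) := (0 : Fin 2)
    obtain ⟨j, hj⟩ := c.exists_two_le_rootMultiplicity hm hL α hg hgf i₁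
      (show 2 < g.natDegree by omega)
    have h1 := c.rootMultiplicity_le_multAt hm hL α hc hgf i₁ j
    have h2 := c.rootMultiplicity_le_multAt hm hL α hc hgf' i₁ j
    rw [← he] at h2
    have h3 := sq_dvd_dehom hC (b := (c.vec i₁ j).1 1) (hj.trans h1) (hj.trans h2)
    have h4 : Polynomial.X - Polynomial.C (e 6 L i₀) ∣ dehom ((g - g').coeff 0) :=
      Polynomial.dvd_iff_isRoot.2 (he0 i₀ 0)
    have hne : e 6 L i₁ ≠ e 6 L i₀ := (e_injective hm hL).ne (show (1 : Fin 2) ≠ 0 by decide)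
    have hcop : IsCoprime ((Polynomial.X - Polynomial.C (e 6 L i₁)) ^ 2)
        (Polynomial.X - Polynomial.C (e 6 L i₀)) :=
      (Polynomial.isCoprime_X_sub_C_of_isUnit_sub (sub_ne_zero.2 hne).isUnit).pow_left
    have h5 := hcop.mul_dvd h3 h4
    have h6 : (g - g').coeff 0 = 0 := by
      refine eq_zero_of_dehom_eq_zero (hhom 0 (by omega)) ?_
      by_contra h0
      have h7 := dehom_degree_lt (hhom 0 (by omega)) (hinf0 0)
      rw [← Polynomial.natDegree_lt_iff_degree_lt h0] at h7
      have h8 := Polynomial.natDegree_le_of_dvd h5 h0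
      rw [Polynomial.natDegree_mul (pow_ne_zero _ (Polynomial.X_sub_C_ne_zero _))
        (Polynomial.X_sub_C_ne_zero _), Polynomial.natDegree_pow, Polynomial.natDegree_X_sub_C,
        Polynomial.natDegree_X_sub_C] at h8
      have h9 : yWeight 6 = 1 := rfl
      rw [h9] at h7
      omega
    rw [hC, h6, map_zero]
  · ext1 j
    rw [Polynomial.coeff_zero]
    by_cases hja : j ≤ a
    · refine hsmall j hja ?_
      rcases hm with rfl | rfl | rfl | rfl <;> simp only [yWeight, numBranch] <;> norm_num <;>
        omega
    · rw [Polynomial.coeff_sub, (hgr j).1 (by omega), (hgr' j).1 (by omega), sub_zero]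

/-- A reducible member has a monic factor of degree at most m/2 in y, whose roots on each line form
a sub-multiset of a multiset independent of z. With infinitely many such z, two of them share these
data and hence the factor. -/
lemma Couplings.finite_reducible (hm : m = 2 ∨ m = 3 ∨ m = 4 ∨ m = 6)
    (hL : IsSymmetricLattice m L) (c : Couplings m L) {α : Fin (m - 1) → ℂ}
    (hα : c.AlphaRelation α) (hc : c.Generic) :
    {z | ¬ Irreducible (member m L (c.bigQ α) z)}.Finite := by
  classical
  by_contra hinf
  have hex : ∀ z ∈ {z | ¬ Irreducible (member m L (c.bigQ α) z)},
      ∃ g f : Polynomial (MvPolynomial (Fin 2) ℂ), g.Monic ∧ g * f = c.fPoly α z ∧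
        0 < g.natDegree ∧ g.natDegree ≤ m / 2 := by
    intro z hz
    obtain ⟨hmon, hdeg⟩ := c.fPoly_monic hm α z
    have hz' : ¬ Irreducible (c.fPoly α z) := fun h => hz (by
      rw [← c.toPlane_fPoly, ← toPlaneEquiv_apply]
      exact (MulEquiv.irreducible_iff toPlaneEquiv).2 h)
    rw [hmon.irreducible_iff_lt_natDegree_lt (fun h => by
      rw [h, Polynomial.natDegree_one] at hdeg; omega)] at hz'
    push Not at hz'
    obtain ⟨g, hg, hgd, f, hf⟩ := hz'
    rw [hdeg, Finset.mem_Ioc] at hgd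
    exact ⟨g, f, hg, hf.symm, hgd.1, hgd.2⟩
  choose! g f hg hgf hpos hdeg using hex
  set Minf := (∏ j, (Polynomial.X - Polynomial.C ((c.vecInf j).1 1))).roots with hMinf
  set Me : Fin (numBranch m) → Multiset ℂ := fun i =>
    (∏ j, (Polynomial.X - Polynomial.C ((c.vec i j).1 1)) ^ mult m i).roots with hMe
  have hmaps : Set.MapsTo (fun z => (((g z).map (MvPolynomial.eval ![1, 0])).roots,
      fun i => ((g z).map (MvPolynomial.eval ![e m L i, 1])).roots))
      {z | ¬ Irreducible (member m L (c.bigQ α) z)}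
      (Set.Iic Minf ×ˢ Set.univ.pi fun i => Set.Iic (Me i)) := by
    intro z hz
    refine ⟨?_, fun i _ => ?_⟩
    · refine Polynomial.roots.le_of_dvd (Finset.prod_ne_zero_iff.2 fun k _ =>
        Polynomial.X_sub_C_ne_zero _) ?_
      rw [← c.map_fPoly_inf hm hL hα z, ← hgf z hz, Polynomial.map_mul]
      exact dvd_mul_right _ _
    · refine Polynomial.roots.le_of_dvd (Finset.prod_ne_zero_iff.2 fun k _ =>
        pow_ne_zero _ (Polynomial.X_sub_C_ne_zero _)) ?_
      rw [← c.map_fPoly_e hm hL α z i, ← hgf z hz, Polynomial.map_mul]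
      exact dvd_mul_right _ _
  obtain ⟨z, hz, z', hz', hne, heq⟩ := Set.Infinite.exists_ne_map_eq_of_mapsTo hinf hmaps
    ((Set.finite_Iic _).prod (Set.Finite.pi fun i => Set.finite_Iic _))
  have hroots : ∀ p q : Polynomial ℂ, p.Monic → q.Monic → p.roots = q.roots → p = q :=
    fun p q hp hq h => by
      rw [(IsAlgClosed.splits p).eq_prod_roots_of_monic hp,
        (IsAlgClosed.splits q).eq_prod_roots_of_monic hq, h]
  have h1 : g z = g z' := c.factor_unique hm hL hc (hg z hz) (hg z' hz') (hgf z hz) (hgf z' hz')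
    (hdeg z hz) (hroots _ _ ((hg z hz).map _) ((hg z' hz').map _) (congrArg Prod.fst heq))
    fun i => hroots _ _ ((hg z hz).map _) ((hg z' hz').map _) (congrFun (congrArg Prod.snd heq) i)
  -- The common factor divides the difference (z' - z)P of the two members, which is non-zero of
  -- degree zero in y.
  have h2 : g z ∣ Polynomial.C (MvPolynomial.C (z' - z) * pForm m L) := by
    have : Polynomial.C (MvPolynomial.C (z' - z) * pForm m L) = g z * (f z - f z') := by
      rw [mul_sub, hgf z hz]
      conv_rhs => rw [h1, hgf z' hz']
      simp only [fPoly, map_sub, map_mul]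
      ring
    exact ⟨_, this⟩
  have h3 := Polynomial.natDegree_le_of_dvd h2 (Polynomial.C_ne_zero.2
    (mul_ne_zero (MvPolynomial.C_ne_zero.2 (sub_ne_zero.2 hne.symm)) pForm_ne_zero))
  rw [Polynomial.natDegree_C] at h3
  have := hpos z hz
  omega

/-! ### Singular points and genus -/

/-- By the chain rule the partial derivative is the linear coefficient of the restriction to a
coordinate line, which vanishes at a point of multiplicity two or more. -/
lemma eval_pderiv_eq_zero {F : MvPolynomial (Fin 3) ℂ} {a : Fin 3 → ℂ} (h : 2 ≤ multAt F a)
    (i : Fin 3) : MvPolynomial.eval a (MvPolynomial.pderiv i F) = 0 := by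
  let : Differential (Polynomial ℂ) := ⟨Polynomial.derivative'.restrictScalars ℤ⟩
  have hD : ∀ p : Polynomial ℂ, Differential.deriv p = Polynomial.derivative p := fun p => rfl
  have h1 := deriv_aeval (B := Polynomial ℂ) (fun c => by rw [hD]; simp)
    (fun k => Polynomial.C (a k) + Polynomial.C ((Pi.single i 1 : Fin 3 → ℂ) k) * Polynomial.X) F
  rw [hD] at h1
  simp only [hD] at h1
  have h2 := congrArg (Polynomial.eval 0) h1
  change (Polynomial.derivative (lineRestr F a (Pi.single i 1))).eval 0 = _ at h2
  rw [← Polynomial.coeff_zero_eq_eval_zero, Polynomial.coeff_derivative,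
    coeff_lineRestr_eq_zero (by omega), zero_mul, Polynomial.eval_finsetSum,
    Finset.sum_eq_single i] at h2
  · rw [Polynomial.eval_mul] at h2
    change 0 = (lineRestr (MvPolynomial.pderiv i F) a (Pi.single i 1)).eval 0 * _ at h2
    rw [eval_lineRestr] at h2
    simpa using h2.symm
  · intro k _ hk
    simp [Pi.single_eq_of_ne hk]
  · simp

lemma eval_eq_zero_of_multAt {F : MvPolynomial (Fin 3) ℂ} (hF : F ≠ 0) {a : Fin 3 → ℂ}
    (h : 1 ≤ multAt F a) : MvPolynomial.eval a F = 0 := by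
  rwa [le_multAt_iff hF, pow_one, taylor_mem_iff] at h

/-- The members without singular points outside the base locus. -/
lemma Couplings.singularPoints_eq (hm : m = 2 ∨ m = 3 ∨ m = 4 ∨ m = 6)
    (hL : IsSymmetricLattice m L) (c : Couplings m L) {α : Fin (m - 1) → ℂ}
    (hα : c.AlphaRelation α) (hc : c.Generic) {z : ℂ}
    (hz : z ∉ {z : ℂ | ∃ a : Fin 3 → ℂ, MvPolynomial.eval a (homP m L) ≠ 0 ∧
      MvPolynomial.eval a (c.bigQ α) = z * MvPolynomial.eval a (homP m L) ∧
      ∀ i, MvPolynomial.eval a (MvPolynomial.pderiv i (c.bigQ α)) =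
        z * MvPolynomial.eval a (MvPolynomial.pderiv i (homP m L))}) :
    singularPoints (yWeight m) (member m L (c.bigQ α) z) =
      {a | ∃ i, 2 ≤ mult m i ∧ ∃ j, a = WPlane.mk (yWeight m) (c.vec i j)} := by
  have hF0 := c.member_ne_zero hm α z
  have hF := c.isWeightedHomogeneous_member hm α z
  ext x
  obtain ⟨a, rfl⟩ := x.exists_mk
  rw [singularPoints, Set.mem_ofPred_eq, Set.mem_ofPred_eq, multAt_rep hF0 hF]
  constructor
  · intro h
    have h0 := eval_eq_zero_of_multAt hF0 (le_trans one_le_two h)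
    -- On P = 0 the point is a base point of known multiplicity. Off P = 0 a singular point would
    -- make z an excluded critical value.
    by_cases hP : MvPolynomial.eval a.1 (homP m L) = 0
    · have hx : WPlane.mk (yWeight m) a ∈ curve (yWeight m) (member m L (c.bigQ α) z) :=
        (mk_mem_curve_iff hF a).2 h0
      rw [eval_homP, mul_eq_zero, Finset.prod_eq_zero_iff] at hP
      rcases hP with h2 | ⟨i, -, h2⟩
      · have h3 : WPlane.mk (yWeight m) a ∈ Set.range fun j => WPlane.mk (yWeight m) (c.vecInf j) := by
          rw [← c.curve_inter_lineInf hm hL hα z]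
          exact ⟨hx, (mk_mem_lineInf_iff a).2 h2⟩
        obtain ⟨j, hj⟩ := h3
        have h4 := multAt_rep hF0 hF a (d := yWeight m)
        rw [← hj, multAt_rep hF0 hF, c.multAt_vecInf hm hL hα hc] at h4
        omega
      · have h3 : WPlane.mk (yWeight m) a ∈ Set.range fun j => WPlane.mk (yWeight m) (c.vec i j) := by
          rw [← c.curve_inter_line hm hL α z]
          exact ⟨hx, (mk_mem_line_iff i a).2
            (sub_eq_zero.1 (pow_eq_zero_iff (mult_pos hm i).ne' |>.1 h2))⟩
        obtain ⟨j, hj⟩ := h3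
        have h4 := multAt_rep hF0 hF a (d := yWeight m)
        rw [← hj, multAt_rep hF0 hF, c.multAt_vec hm hL α hc] at h4
        exact ⟨i, by omega, j, hj.symm⟩
    · refine absurd ⟨a.1, hP, ?_, fun i => ?_⟩ hz
      · rw [eval_member] at h0
        exact sub_eq_zero.1 h0
      · have h1 := eval_pderiv_eq_zero h i
        rw [member, map_sub, Derivation.leibniz, MvPolynomial.pderiv_C] at h1
        simpa [sub_eq_zero] using h1
  · rintro ⟨i, hi, j, hj⟩
    have h4 := multAt_rep hF0 hF a (d := yWeight m)
    rw [hj, multAt_rep hF0 hF, c.multAt_vec hm hL α hc] at h4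
    omega

/-- The last coordinate 1 forces the scaling factor to be 1; then e_i determines i, and the second
coordinate determines j. -/
lemma Couplings.mk_vec_injective (hm : m = 2 ∨ m = 3 ∨ m = 4 ∨ m = 6)
    (hL : IsSymmetricLattice m L) (c : Couplings m L) (hc : c.Generic) :
    Function.Injective fun p : Σ i : Fin (numBranch m), Fin (stabOrder m i) =>
      WPlane.mk (yWeight m) (c.vec p.1 p.2) := by
  rintro ⟨i, j⟩ ⟨i', j'⟩ h
  obtain ⟨t, ht, h⟩ := WPlane.mk_eq_mk.1 h
  have h2 := congrFun h 2
  have h0 := congrFun h 0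
  have h1 := congrFun h 1
  simp only [vec, wscale, Matrix.cons_val, Matrix.cons_val_zero, mul_one] at h2 h0
  subst h2
  rw [one_mul] at h0
  obtain rfl := e_injective hm hL h0
  have h3 : (c.vec i' j').1 1 = (c.vec i' j).1 1 := by
    rw [h1]; simp [wscale]
  rw [hc.vec_injective hm hL i' h3]

/-- The base points account for the whole adjunction term: both sides are 0, 0, 4, 18 for m = 2, 3,
4, 6. This is why the genus is 1. -/
lemma sum_mult_genus (hm : m = 2 ∨ m = 3 ∨ m = 4 ∨ m = 6) :
    ∑ i : Fin (numBranch m), (stabOrder m i : ℚ) * ((mult m i : ℚ) * ((mult m i : ℚ) - 1)) =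
      (m : ℚ) * (yWeight m * m - yWeight m - 2) := by
  have h : ∑ i : Fin (numBranch m), (stabOrder m i : ℤ) * ((mult m i : ℤ) * ((mult m i : ℤ) - 1)) =
      (m : ℤ) * (yWeight m * m - yWeight m - 2) := by
    rcases hm with rfl | rfl | rfl | rfl <;> decide
  exact_mod_cast h

lemma Couplings.genus_eq_one (hm : m = 2 ∨ m = 3 ∨ m = 4 ∨ m = 6)
    (hL : IsSymmetricLattice m L) (c : Couplings m L) {α : Fin (m - 1) → ℂ}
    (hc : c.Generic) {z : ℂ}
    (hs : singularPoints (yWeight m) (member m L (c.bigQ α) z) =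
      {a | ∃ i, 2 ≤ mult m i ∧ ∃ j, a = WPlane.mk (yWeight m) (c.vec i j)}) :
    ordinaryGenus (yWeight m) m (member m L (c.bigQ α) z) = 1 := by
  classical
  have hF0 := c.member_ne_zero hm α z
  have hF := c.isWeightedHomogeneous_member hm α z
  set F := member m L (c.bigQ α) z with hFdef
  set φ : WPlane (yWeight m) → ℚ := fun x =>
    (multAt F x.rep : ℚ) * ((multAt F x.rep : ℚ) - 1) with hφ
  set g := fun p : Σ i : Fin (numBranch m), Fin (stabOrder m i) =>
      WPlane.mk (yWeight m) (c.vec p.1 p.2) with hg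
  have hsupp : Function.support φ ⊆ ((Finset.univ.image g : Finset _) : Set (WPlane (yWeight m))) := by
    intro x hx
    have h2 : x ∈ singularPoints (yWeight m) F := by
      rw [singularPoints, Set.mem_ofPred_eq]
      by_contra hlt
      have : multAt F x.rep = 0 ∨ multAt F x.rep = 1 := by omega
      apply hx
      rcases this with h | h <;> simp [hφ, h]
    rw [hs] at h2
    obtain ⟨i, -, j, rfl⟩ := h2
    simp only [Finset.coe_image, Finset.coe_univ, Set.image_univ]
    exact ⟨⟨i, j⟩, rfl⟩
  have hsum : ∑ᶠ x, φ x = (m : ℚ) * (yWeight m * m - yWeight m - 2) := by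
    rw [finsum_eq_sum_of_support_subset _ hsupp,
      Finset.sum_image ((c.mk_vec_injective hm hL hc).injOn), ← sum_mult_genus hm,
      Fintype.sum_sigma]
    refine Finset.sum_congr rfl fun i _ => ?_
    have : ∀ j, φ (g ⟨i, j⟩) = (mult m i : ℚ) * ((mult m i : ℚ) - 1) := fun j => by
      simp only [hφ, hg]
      rw [multAt_rep hF0 hF, hFdef, c.multAt_vec hm hL α hc]
    rw [Finset.sum_congr rfl fun j _ => this j, Finset.sum_const, Finset.card_univ,
      Fintype.card_fin, nsmul_eq_mul]
  rw [ordinaryGenus]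
  change 1 + (_ - ∑ᶠ x, φ x) / 2 = 1
  rw [hsum]
  ring

/-! ### Generic members -/

/-- Away from finitely many members the initial forms at the base points have distinct linear
factors. -/
lemma Couplings.finite_degenerate (hm : m = 2 ∨ m = 3 ∨ m = 4 ∨ m = 6)
    (hL : IsSymmetricLattice m L) (c : Couplings m L) (α : Fin (m - 1) → ℂ) (hc : c.Generic) :
    ∃ Z : Set ℂ, Z.Finite ∧ ∀ z ∉ Z, ∀ i j, ∃ r : Fin (mult m i) → ℂ, Function.Injective r ∧
      (∀ k, (slice (member m L (c.bigQ α) z) (c.vec i j).1 (mult m i)).eval (r k) = 0 ∧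
      (slice (member m L (c.bigQ α) z) (c.vec i j).1 (mult m i)).derivative.eval (r k) ≠ 0) ∧
      ∃ δ ≠ 0, slice (member m L (c.bigQ α) z) (c.vec i j).1 (mult m i) =
        Polynomial.C δ * ∏ k, (Polynomial.X - Polynomial.C (r k)) := by
  have hlead : ∀ i j,
      (slice (member m L (c.bigQ α) 0) (c.vec i j).1 (mult m i)).coeff (mult m i) ≠ 0 :=
    fun i j => by
      rw [coeff_slice_self]; exact c.coeff_lineRestr_vec_ne_zero hm hL α hc 0 i j
  have hγ : ∀ i, ∏ k ∈ Finset.univ.erase i, (e m L i - e m L k) ^ mult m k ≠ 0 := fun i =>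
    Finset.prod_ne_zero_iff.2 fun k hk => pow_ne_zero _ (sub_ne_zero.2
      ((e_injective hm hL).ne (Finset.ne_of_mem_erase hk).symm))
  have hex := fun i j => exists_finite_roots (mult_pos hm i)
    (natDegree_slice_le (member m L (c.bigQ α) 0) (c.vec i j).1 (mult m i)) (hlead i j) (hγ i)
  choose Z hZ hZr using hex
  refine ⟨⋃ i, ⋃ j, Z i j, Set.finite_iUnion fun i => Set.finite_iUnion fun j => hZ i j,
    fun z hz i j => ?_⟩
  simp only [Set.mem_iUnion, not_exists] at hz
  obtain ⟨r, hr, h1, h2⟩ := hZr i j z (hz i j)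
  rw [← c.slice_member] at h1 h2
  exact ⟨r, hr, h1, _, hlead i j, h2⟩



end EllipticPencil

end

/-! ### The theorem -/

open EllipticPencil
theorem mainTheorem1 (m : ℕ) (hm : m = 2 ∨ m = 3 ∨ m = 4 ∨ m = 6) (L : PeriodPair)
    (hL : IsSymmetricLattice m L) (c : Couplings m L) :
    -- the coefficients of the hamiltonian are well defined
    (∃! α : Fin (m - 1) → ℂ, c.AlphaRelation α) ∧
    ∀ α : Fin (m - 1) → ℂ, c.AlphaRelation α →
      -- the lines are distinct and `P` is the polynomial of the table
      Function.Injective (e m L) ∧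
      (∀ t : ℂ, MvPolynomial.eval ![t, 0, 1] (homP m L) =
        tableP m L t) ∧
      (∀ q : ℂ, q ∉ L.lattice →
        v m L q ^ m = tableP m L (u m L q)) ∧
      -- the lines are concurrent
      (lineInf m ∩ ⋂ i, line m L i) =
        {WPlane.mk (yWeight m)
          ⟨![0, 1, 0], fun h => one_ne_zero (congrFun h 1)⟩} ∧
      ∃ Q : MvPolynomial (Fin 3) ℂ,
        -- `Q = y^m + ∑_{j=2}^m Q_j(x, w) y^{m-j}`, and every `Q - zP` has weighted degree `d m`
        (∃ R : ℕ → MvPolynomial (Fin 2) ℂ,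
          (∀ j, (R j).IsHomogeneous (yWeight m * j)) ∧
          Q = MvPolynomial.X 1 ^ m + ∑ j ∈ Finset.Icc 2 m,
            MvPolynomial.rename ![0, 2] (R j) * MvPolynomial.X 1 ^ (m - j)) ∧
        (∀ z, MvPolynomial.IsWeightedHomogeneous ![1, yWeight m, 1]
          (member m L Q z) (yWeight m * m)) ∧
        -- the hamiltonian and its level sets in the coordinates `x = u(q)`, `y = v(q) p`
        (∀ p q : ℂ, ¬ IsFixedPoint m L q →
          MvPolynomial.eval ![u m L q, v m L q * p, 1] Q =
            tableP m L (u m L q) * c.h α p q) ∧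
        (∀ z : ℂ,
          {a : ℂ × ℂ | ∃ p q : ℂ, ¬ IsFixedPoint m L q ∧ c.h α p q = z ∧
            a = (u m L q, v m L q * p)} =
          {a : ℂ × ℂ | tableP m L a.1 ≠ 0 ∧
            MvPolynomial.eval ![a.1, a.2, 1] (member m L Q z) = 0}) ∧
        -- intersection with the lines, with multiplicities
        (∀ z y : ℂ, MvPolynomial.eval ![1, y, 0] (member m L Q z) =
          ∏ j : Fin m, (y - (c.vecInf j).1 1)) ∧
        (∀ (z : ℂ) (i : Fin (numBranch m)) (y : ℂ),
          MvPolynomial.eval ![e m L i, y, 1] (member m L Q z) =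
            ∏ j : Fin (stabOrder m i),
              (y - (c.vec i j).1 1) ^ mult m i) ∧
        (∀ z : ℂ, curve (yWeight m)
            (member m L Q z) ∩ lineInf m =
          Set.range fun j => WPlane.mk (yWeight m) (c.vecInf j)) ∧
        (∀ (z : ℂ) (i : Fin (numBranch m)),
          curve (yWeight m)
            (member m L Q z) ∩ line m L i =
          Set.range fun j => WPlane.mk (yWeight m) (c.vec i j)) ∧
        -- the base points of the pencil
        ((⋂ z : ℂ, curve (yWeight m)
            (member m L Q z)) =
          (Set.range fun j =>
            WPlane.mk (yWeight m) (c.vecInf j)) ∪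
          ⋃ i, Set.range fun j =>
            WPlane.mk (yWeight m) (c.vec i j)) ∧
        -- multiplicities at the base points, for all parameters and all members
        (∀ (z : ℂ) (i : Fin (numBranch m))
          (j : Fin (stabOrder m i)),
          mult m i ≤
            multAt (member m L Q z) (c.vec i j).1) ∧
        -- residues of `λ` along every holomorphic branch over the lines
        (∀ (z : ℂ) (Y : ℂ → ℂ), AnalyticAt ℂ Y 0 →
          (∀ᶠ w in 𝓝 (0 : ℂ),
            MvPolynomial.eval ![1, Y w, w] (member m L Q z) = 0) →
          ∃ j : Fin m, Y 0 = (c.vecInf j).1 1 ∧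
            HasResidue
              (swPullback m L (fun _ => 1) Y (fun t => t)) 0 (c.mu j 0)) ∧
        (∀ (z : ℂ) (i : Fin (numBranch m)) (Y : ℂ → ℂ),
          AnalyticAt ℂ Y (e m L i) →
          (∀ᶠ x in 𝓝 (e m L i),
            MvPolynomial.eval ![x, Y x, 1] (member m L Q z) = 0) →
          ∃ j : Fin (stabOrder m i), Y (e m L i) = (c.vec i j).1 1 ∧
            HasResidue
              (swPullback m L (fun t => t) Y (fun _ => 1))
              (e m L i)
              (mult m i * c.mu j (branchPt m L i))) ∧
        -- the case of distinct points
        (c.Generic →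
          -- exact multiplicities, for every member
          (∀ (z : ℂ) (j : Fin m),
            multAt (member m L Q z) (c.vecInf j).1 = 1) ∧
          (∀ (z : ℂ) (i : Fin (numBranch m))
            (j : Fin (stabOrder m i)),
            multAt (member m L Q z) (c.vec i j).1 =
              mult m i) ∧
          -- the properties of all but finitely many members
          ∃ Z : Set ℂ, Z.Finite ∧ ∀ z ∉ Z,
            Irreducible (member m L Q z) ∧
            singularPoints (yWeight m)
                (member m L Q z) =
              {a | ∃ i, 2 ≤ mult m i ∧ ∃ j,
                a = WPlane.mk (yWeight m) (c.vec i j)} ∧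
            (∀ i j, IsOrdinaryAt (member m L Q z) (c.vec i j).1) ∧
            ordinaryGenus (yWeight m) m
              (member m L Q z) = 1 ∧
            -- all branches over the lines, with the residues of `λ`
            (∃ Y : Fin m → ℂ → ℂ,
              (∀ j, AnalyticAt ℂ (Y j) 0 ∧ Y j 0 = (c.vecInf j).1 1 ∧
                HasResidue
                  (swPullback m L (fun _ => 1) (Y j) (fun t => t)) 0
                  (c.mu j 0)) ∧
              ∀ᶠ w in 𝓝 (0 : ℂ), ∀ y : ℂ,
                MvPolynomial.eval ![1, y, w] (member m L Q z) =
                  ∏ j, (y - Y j w)) ∧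
            (∀ i : Fin (numBranch m),
              ∃ Y : Fin (stabOrder m i) → Fin (mult m i) → ℂ → ℂ,
                (∀ j k, AnalyticAt ℂ (Y j k) (e m L i) ∧
                  Y j k (e m L i) = (c.vec i j).1 1 ∧
                  HasResidue
                    (swPullback m L (fun t => t) (Y j k) (fun _ => 1))
                    (e m L i)
                    (mult m i * c.mu j (branchPt m L i))) ∧
                (∀ j, Function.Injective fun k => deriv (Y j k) (e m L i)) ∧
                ∀ᶠ x in 𝓝 (e m L i), ∀ y : ℂ,
                  MvPolynomial.eval ![x, y, 1] (member m L Q z) =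
                    ∏ j, ∏ k, (y - Y j k x)))
    := by
  refine ⟨c.existsUnique_alpha (by omega), fun α hα => ⟨e_injective hm hL,
    fun t => eval_homP_affine hm hL t 0, fun q hq => v_pow_eq hm hL hq, lines_concurrent,
    c.bigQ α, Couplings.bigQ_eq hm c α, c.isWeightedHomogeneous_member hm α,
    c.eval_bigQ_uv hm hL α, c.levelSet hm hL α, c.eval_member_inf hm hL hα,
    c.eval_member_e hm hL α, c.curve_inter_lineInf hm hL hα, c.curve_inter_line hm hL α,
    c.basePoints hm hL hα, c.mult_le_multAt hm hL α, fun z Y hY hF => ?_,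
    fun z i Y hY hF => ?_, fun hc => ⟨c.multAt_vecInf hm hL hα hc, c.multAt_vec hm hL α hc, ?_⟩⟩⟩
  · have h0 := hF.self_of_nhds
    rw [c.eval_member_inf hm hL hα, Finset.prod_eq_zero_iff] at h0
    obtain ⟨j, -, hj⟩ := h0
    exact ⟨j, sub_eq_zero.1 hj, c.hasResidue_inf hY (sub_eq_zero.1 hj)⟩
  · have h0 := hF.self_of_nhds
    rw [c.eval_member_e hm hL α, Finset.prod_eq_zero_iff] at h0
    obtain ⟨j, -, hj⟩ := h0
    have hj' := sub_eq_zero.1 (eq_zero_of_pow_eq_zero hj)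
    exact ⟨j, hj', c.hasResidue_e (e_injective hm hL) hY hj'⟩
  · obtain ⟨Z, hZ, h⟩ := c.finite_degenerate hm hL α hc
    -- The excluded z are the critical values of Q/P off P = 0, the reducible members, and those
    -- with coinciding tangents at some base point.
    refine ⟨_, ((finite_critical_values (homP m L) (c.bigQ α)).union
      (c.finite_reducible hm hL hα hc)).union hZ, fun z hz => ?_⟩
    rw [Set.mem_union, Set.mem_union, not_or, not_or] at hz
    obtain ⟨⟨hcrit, hirr⟩, hz⟩ := hz
    have hs := c.singularPoints_eq hm hL hα hc hcrit
    refine ⟨not_not.1 hirr, hs, fun i j => ?_, c.genus_eq_one hm hL hc hs,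
      c.branches_inf hm hL hα hc z, fun i => c.branches_e hm hL α hc z i fun j => ?_⟩
    · obtain ⟨r, hr, -, δ, hδ, hsl⟩ := h z hz i j
      exact isOrdinaryAt_of_slice (c.isWeightedHomogeneous_member hm α z)
        (c.multAt_vec hm hL α hc z i j) (mult_pos hm i) hδ hr hsl
    · obtain ⟨r, hr, hr', -⟩ := h z hz i j
      exact ⟨r, hr, hr'⟩
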